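/- **Setting.** Let $\Omega\subset\mathbb R^2\cong\mathbb C$ be one of the following, all boundaries being of class $C^2$. (I) $\Omega$ is a bounded simply connected domain, with $\Gamma=\partial\Omega$. (II) $\Omega=\Omega_1\setminus\overline{\Omega_0}$ with $\Omega_0,\Omega_1$ bounded simply connected domains, $\overline{\Omega_0}\subset\Omega_1$, and $\Gamma=\partial\Omega_0$. (III) $\Omega=\mathbb R^2\setminus\overline{\Omega_0}$ with $\Omega_0$ a bounded simply connected domain and $\Gamma=\partial\Omega_0$. Let $g:\Gamma\to S^1$ be of class $C^2$. For $0<\varepsilon<1$, $0<\alpha\le 1$, $K>0$ put $\lambda=K\varepsilon^{-\alpha}$ and $$E_\varepsilon(u)=\frac12\int_\Omega\Big(|\nabla u|^2+\frac1{2\varepsilon^2}(|u|^2-1)^2\Big)dx+\frac\lambda2\int_\Gamma|u-g|^2\,dS .$$ Fix $\gamma$ with $\frac34\alpha<\gamma<\alpha$. Write $\omega_\rho(x_0)=B_\rho(x_0)\cap\Omega$, $\Gamma_\rho(x_0)=\Gamma\cap B_\rho(x_0)$ and $A_{r,R}(x_0)=\omega_R(x_0)\setminus\omega_r(x_0)$.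 The functions $u:\overline\Omega\to\mathbb C$ considered are continuous on $\overline\Omega$, $C^1$ in $\Omega$, and in case (II) equal to $1$ on $\partial\Omega_1$. They need not solve any equation. **Degrees.** If $B_R(x_0)\cap\Gamma=\emptyset$, then $d=\deg(u/|u|;\partial B_R(x_0))$ is the usual degree, where in case (II) $u$ is extended by $1$ outside $\Omega_1$ if the ball crosses $\partial\Omega_1$. If $x_0\in\Gamma$, then the degree of $u$ in $A_{r,R}(x_0)$ is $D=\deg(\tilde u/|\tilde u|;\partial\omega_R(x_0))$, where $\tilde u$ is any continuous map on $\partial\omega_R(x_0)$ with $\tilde u=u$ on $\partial\omega_R(x_0)\setminus B_r(x_0)$ and $|\tilde u-g|\le\frac12$ on $\Gamma_R(x_0)$. **Proposition 4.3.** There is $r_0>0$, depending only on $\Omega,\Gamma,g$, with the following property. For all $\alpha,\gamma,K$ as above, all constants $C_1,C_2$, every $\kappa>0$ and every $N\in\mathbb N$ there is a constant $C\in\mathbb R$, depending only on these and on $\Omega,\Gamma,g$ (in particular not on $\varepsilon,u,x_0,r,R$), such that the following holds. Let $0<\varepsilon<1$, $x_0\in\overline\Omega$, $0<r<R<r_0$,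 and let $u$ satisfy $\frac12\le|u|\le1$ in $A_{r,R}(x_0)$, $|u-g|\le\frac14$ on $\Gamma_R(x_0)\setminus B_r(x_0)$, $E_\varepsilon(u)\le C_1|\ln\varepsilon|$, and $$\frac1{2\varepsilon^2}\int_{\omega_{\varepsilon^\gamma}(x_0)}(|u|^2-1)^2\,dx+\lambda\int_{\Gamma_{\varepsilon^\gamma}(x_0)}|u-g|^2\,dS\le C_2 .$$ (a) If $B_R(x_0)\cap\Gamma=\emptyset$, $r\ge\kappa\varepsilon$, and $d=\deg(u/|u|;\partial B_R(x_0))$ has $|d|\le N$, then $$\frac12\int_{A_{r,R}(x_0)}|\nabla u|^2\,dx\ \ge\ \pi d^2\ln\frac Rr+C .$$ (b) If $x_0\in\Gamma$, $r\ge\kappa\varepsilon^\alpha$, and the degree $D$ of $u$ in $A_{r,R}(x_0)$ has $|D|\le N$, then $$\frac12\int_{A_{r,R}(x_0)}|\nabla u|^2\,dx\ \ge\ 2\pi D^2\ln\frac Rr+C .$$ -/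

import Mathlib

open Set Metric MeasureTheory
open scoped ENNReal

noncomputable section

namespace WeakAnchoring

/-! The plane is identified with `ℂ` (Euclidean norm, Lebesgue measure). -/

/-- `Ω` has a `C²` boundary: near each boundary point, `Ω` is the set where some `C²` function with
nonvanishing differential is negative. -/
def HasC2Boundary (Ω : Set ℂ) : Prop :=
  ∀ p ∈ frontier Ω, ∃ (U : Set ℂ) (h : ℂ → ℝ), IsOpen U ∧ p ∈ U ∧ ContDiffOn ℝ 2 h U ∧
    fderiv ℝ h p ≠ 0 ∧ Ω ∩ U = {x ∈ U | h x < 0}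

/-- A bounded, simply connected planar domain with `C²` boundary. -/
structure IsC2SimplyConnectedDomain (Ω : Set ℂ) : Prop where
  isOpen : IsOpen Ω
  isBounded : Bornology.IsBounded Ω
  simplyConnected : IsSimplyConnected Ω
  c2 : HasC2Boundary Ω

/-- The three geometries. In `Geometry Ω Γ S`, `Ω` is the domain, `Γ` the boundary component with
weak anchoring, and `S` the part of `∂Ω` (possibly empty) with the Dirichlet condition `u = 1`. -/
inductive Geometry : Set ℂ → Set ℂ → Set ℂ → Prop
  /-- Problem I: a simply connected domain with weak anchoring on its whole boundary. -/
  | simplyConnected (Ω : Set ℂ) (h : IsC2SimplyConnectedDomain Ω) :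
      Geometry Ω (frontier Ω) ∅
  /-- Problem II: a topological annulus with weak anchoring on the inner boundary and `u = 1` on
  the outer boundary. -/
  | annulus (Ω₀ Ω₁ : Set ℂ) (h₀ : IsC2SimplyConnectedDomain Ω₀)
      (h₁ : IsC2SimplyConnectedDomain Ω₁) (h : closure Ω₀ ⊆ Ω₁) :
      Geometry (Ω₁ \ closure Ω₀) (frontier Ω₀) (frontier Ω₁)
  /-- Problem III: the exterior of a simply connected domain. -/
  | exterior (Ω₀ : Set ℂ) (h₀ : IsC2SimplyConnectedDomain Ω₀) :
      Geometry (closure Ω₀)ᶜ (frontier Ω₀) ∅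

/-- `g` is a `C²` map on the curve `Γ` with values in the unit circle (only the values of `g` on
`Γ` matter): locally it is the restriction of a `C²` map on an open set of the plane. -/
structure IsC2CircleMapOn (g : ℂ → ℂ) (Γ : Set ℂ) : Prop where
  c2 : ∀ p ∈ Γ, ∃ (U : Set ℂ) (G : ℂ → ℂ), IsOpen U ∧ p ∈ U ∧ ContDiffOn ℝ 2 G U ∧
    EqOn g G (Γ ∩ U)
  norm_eq_one : ∀ p ∈ Γ, ‖g p‖ = 1

/-- `u` is `C¹` in `Ω`, continuous up to the boundary, and equal to `1` on `S`. -/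
structure IsAdmissible (Ω S : Set ℂ) (u : ℂ → ℂ) : Prop where
  contDiffOn : ContDiffOn ℝ 1 u Ω
  continuousOn : ContinuousOn u (closure Ω)
  eq_one : ∀ x ∈ S, u x = 1

/-- `|∇u|² = |∂₁u|² + |∂₂u|²`. -/
def gradSq (u : ℂ → ℂ) (x : ℂ) : ℝ :=
  ‖fderiv ℝ u x 1‖ ^ 2 + ‖fderiv ℝ u x Complex.I‖ ^ 2

/-- The Dirichlet energy `½ ∫_A |∇u|² dx`, as an element of `[0, ∞]`. -/
def dirichletEnergy (u : ℂ → ℂ) (A : Set ℂ) : ℝ≥0∞ :=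
  ∫⁻ x in A, ENNReal.ofReal (1 / 2 * gradSq u x)

/-- The Ginzburg-Landau energy with weak anchoring,
`E_ε(u) = ½ ∫_Ω (|∇u|² + (|u|² - 1)² / (2ε²)) dx + (lam / 2) ∫_Γ |u - g|² dS`,
as an element of `[0, ∞]`; arclength is the one-dimensional Hausdorff measure. -/
def energy (Ω Γ : Set ℂ) (g : ℂ → ℂ) (ε lam : ℝ) (u : ℂ → ℂ) : ℝ≥0∞ :=
  (∫⁻ x in Ω, ENNReal.ofReal
      (1 / 2 * (gradSq u x + 1 / (2 * ε ^ 2) * (‖u x‖ ^ 2 - 1) ^ 2))) +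
    ∫⁻ x in Γ, ENNReal.ofReal (lam / 2 * ‖u x - g x‖ ^ 2) ∂(Measure.hausdorffMeasure 1)

/-- `ω_ρ(x₀) = B_ρ(x₀) ∩ Ω`. -/
def omegaBall (Ω : Set ℂ) (x₀ : ℂ) (ρ : ℝ) : Set ℂ := ball x₀ ρ ∩ Ω

/-- `A_{r,R}(x₀) = ω_R(x₀) \ ω_r(x₀)`. -/
def annulusIn (Ω : Set ℂ) (x₀ : ℂ) (r R : ℝ) : Set ℂ :=
  omegaBall Ω x₀ R \ omegaBall Ω x₀ r

/-- The local penalty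
`(1 / (2ε²)) ∫_{ω_ρ(x₀)} (|u|² - 1)² dx + lam ∫_{Γ ∩ B_ρ(x₀)} |u - g|² dS`. -/
def localPenalty (Ω Γ : Set ℂ) (g : ℂ → ℂ) (ε lam : ℝ) (u : ℂ → ℂ) (x₀ : ℂ) (ρ : ℝ) : ℝ≥0∞ :=
  (∫⁻ x in omegaBall Ω x₀ ρ, ENNReal.ofReal (1 / (2 * ε ^ 2) * (‖u x‖ ^ 2 - 1) ^ 2)) +
    ∫⁻ x in Γ ∩ ball x₀ ρ, ENNReal.ofReal (lam * ‖u x - g x‖ ^ 2)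
      ∂(Measure.hausdorffMeasure 1)

/-- The loop `v : [0, 1] → ℂ` does not vanish and `v / |v|` has degree `d`: a continuous phase of
`v` increases by `2πd`. -/
def HasDegree (v : ℝ → ℂ) (d : ℤ) : Prop :=
  ∃ θ : ℝ → ℝ, ContinuousOn θ (Icc 0 1) ∧
    (∀ t ∈ Icc (0 : ℝ) 1, v t ≠ 0 ∧ v t / (‖v t‖ : ℂ) = Complex.exp (θ t * Complex.I)) ∧
    θ 1 - θ 0 = 2 * Real.pi * d

/-- The counterclockwise parametrization of `∂B_R(x₀)` by `[0, 1]`. -/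
def circleLoop (x₀ : ℂ) (R : ℝ) (t : ℝ) : ℂ :=
  x₀ + R * Complex.exp (2 * Real.pi * t * Complex.I)

open Classical in
/-- `u` on the closure of `Ω`, extended by the constant `1`. This only matters for balls that
cross the outer boundary of Problem II, where `u = 1`. -/
def extendByOne (Ω : Set ℂ) (u : ℂ → ℂ) (x : ℂ) : ℂ :=
  if x ∈ closure Ω then u x else 1

/-- `d = deg(u/|u|; ∂B_R(x₀))`. -/
def HasInteriorDegree (Ω : Set ℂ) (u : ℂ → ℂ) (x₀ : ℂ) (R : ℝ) (d : ℤ) : Prop :=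
  HasDegree (fun t => extendByOne Ω u (circleLoop x₀ R t)) d

/-- `c : [0, 1] → ℂ` is a positively oriented simple closed parametrization of `∂U`. -/
structure IsPositiveParam (c : ℝ → ℂ) (U : Set ℂ) : Prop where
  continuousOn : ContinuousOn c (Icc 0 1)
  closed : c 0 = c 1
  injOn : InjOn c (Ico 0 1)
  image_eq : c '' Icc 0 1 = frontier U
  positive : ∀ z ∈ U, HasDegree (fun t => c t - z) 1

/-- `D` is the degree of `u` in `A_{r,R}(x₀)` for a boundary center `x₀ ∈ Γ`: it is the degree
along `∂ω_R(x₀)` of a map `w` which equals `u` on the part of `∂ω_R(x₀)` outside `B_r(x₀)` (the arc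
`∂B_R(x₀) ∩ Ω` and the two arcs of `Γ` between the radii `r` and `R`) and which satisfies
`|w - g| ≤ 1/2` on `Γ ∩ B_R(x₀)`. -/
def HasBoundaryDegree (Ω Γ : Set ℂ) (g u : ℂ → ℂ) (x₀ : ℂ) (r R : ℝ) (D : ℤ) : Prop :=
  ∃ (w : ℂ → ℂ) (c : ℝ → ℂ),
    ContinuousOn w (frontier (omegaBall Ω x₀ R)) ∧
    (∀ x ∈ frontier (omegaBall Ω x₀ R), r ≤ dist x x₀ → w x = u x) ∧
    (∀ x ∈ Γ ∩ ball x₀ R, ‖w x - g x‖ ≤ 1 / 2) ∧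
    IsPositiveParam c (omegaBall Ω x₀ R) ∧
    HasDegree (fun t => w (c t)) D

end WeakAnchoring

end

open WeakAnchoring

namespace WeakAnchoring

/-! The bound is proved circle by circle. On the circle of radius s about x₀ put a = s|∇u| and let θ
be a phase of u as a function of the angle. Then |θ'| ≤ a/|u|, and for k ≥ 0 the inequality k a/|u|
≤ a²/2 + k²/2 + 2k²(1 - |u|²) (`young_phase`) bounds k|Δθ| by the integral of a²/2, plus k²/2 times
the opening angle, plus a defect of modulus (`ofReal_mul_abs_phase_sub_le`).

In the interior |Δθ| = 2π|d| over an angle 2π, and k = |d| leaves 2πd² - πd² = πd². At x₀ ∈ Γ the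
circle meets Ω in an arc of opening π + O(s), along which the phase changes by nearly 2πD; k = 2|D|
leaves 4πD² - 2πD² = 2πD². Dividing by s and integrating over r < s < R produces the logarithm.

The errors must integrate to a constant free of ε. Young's inequality splits the modulus defect (1 -
|u|²)/s and the endpoint defects |u - g|/s into a weight w(s) times the penalty densities, and
remainders of order ε²/(w s³) and ε^α/(w s²). The weight is 1 for s < ε^γ, where the local penalty
is at most C₂, and 1/(1 + |ln ε|) beyond, where only the energy bound is available
(`lintegral_weightedPenalty_le`, `lintegral_weighted_boundary_le`). The remainders are integrable
from κε and κε^α on, and past ε^γ the lost logarithm is beaten by ε^(2-2γ) and ε^(α-γ)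
(`lintegral_core_error_le`, `lintegral_boundary_error_le`). The curvature of Γ and the variation of
g cost O(1) per unit of radius.

The topological input is homotopy invariance of the degree. For boundary centres,
`IsBoundarySector.exists_phase_on_arc` shrinks an explicit loop around the sector, and
`exists_degree_of_same_image` relates that loop to the given parametrization of ∂ω_R. -/

/-! ### Continuous phases and degrees of loops -/

/-- `θ` is a continuous phase of `v` on `s`. -/
def IsPhase (v : ℝ → ℂ) (θ : ℝ → ℝ) (s : Set ℝ) : Prop :=
  ContinuousOn θ s ∧ ∀ t ∈ s, v t ≠ 0 ∧ v t / (‖v t‖ : ℂ) = Complex.exp (θ t * Complex.I)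

theorem hasDegree_iff {v : ℝ → ℂ} {d : ℤ} :
    HasDegree v d ↔ ∃ θ, IsPhase v θ (Icc 0 1) ∧ θ 1 - θ 0 = 2 * Real.pi * d := by
  constructor
  · rintro ⟨θ, h1, h2, h3⟩; exact ⟨θ, ⟨h1, h2⟩, h3⟩
  · rintro ⟨θ, ⟨h1, h2⟩, h3⟩; exact ⟨θ, h1, h2, h3⟩

theorem exp_mul_I_eq_iff {x y : ℝ} :
    Complex.exp (x * Complex.I) = Complex.exp (y * Complex.I) ↔
      ∃ n : ℤ, x = y + 2 * Real.pi * n := by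
  rw [Complex.exp_eq_exp_iff_exists_int]
  refine exists_congr fun n => ?_
  constructor
  · intro h
    have := congrArg Complex.im h
    simp at this
    linarith
  · intro h
    rw [h]; push_cast; ring

/-- A continuous function on an interval with values in `2πℤ` is constant. -/
theorem eq_of_continuousOn_of_two_pi_int {f : ℝ → ℝ} {a b : ℝ} (hab : a ≤ b)
    (hf : ContinuousOn f (Icc a b)) (hz : ∀ t ∈ Icc a b, ∃ n : ℤ, f t = 2 * Real.pi * n) :
    f b = f a := by
  by_contra hne
  have hpi := Real.pi_pos
  have hcount : (f '' Icc a b).Countable := by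
    refine (countable_range (fun n : ℤ => 2 * Real.pi * (n : ℝ))).mono ?_
    rintro _ ⟨t, ht, rfl⟩
    obtain ⟨n, hn⟩ := hz t ht
    exact ⟨n, hn.symm⟩
  have hsub : uIcc (f a) (f b) ⊆ f '' Icc a b := by
    have := intermediate_value_uIcc (a := a) (b := b) (f := f) (by rwa [uIcc_of_le hab])
    rwa [uIcc_of_le hab] at this
  -- By the intermediate value theorem the whole interval between the two values lies in a
  -- countable, hence null, set.
  have h0 : volume (uIcc (f a) (f b)) = 0 := (hcount.mono hsub).measure_zero _
  rw [uIcc, Real.volume_Icc, ENNReal.ofReal_eq_zero] at h0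
  rcases lt_or_gt_of_ne hne with h | h
  · rw [max_eq_left h.le, min_eq_right h.le] at h0; linarith
  · rw [max_eq_right h.le, min_eq_left h.le] at h0; linarith

theorem IsPhase.mono {v θ} {s t : Set ℝ} (h : IsPhase v θ s) (hst : t ⊆ s) : IsPhase v θ t :=
  ⟨h.1.mono hst, fun x hx => h.2 x (hst hx)⟩

theorem IsPhase.sub_eq_sub {v θ θ'} {a b : ℝ} (hab : a ≤ b) (h : IsPhase v θ (Icc a b))
    (h' : IsPhase v θ' (Icc a b)) : θ b - θ a = θ' b - θ' a := by
  have := eq_of_continuousOn_of_two_pi_int (f := fun t => θ t - θ' t) hab (h.1.sub h'.1) (by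
    intro t ht
    have e := (h.2 t ht).2.symm.trans (h'.2 t ht).2
    obtain ⟨n, hn⟩ := exp_mul_I_eq_iff.1 e
    exact ⟨n, by rw [hn]; ring⟩)
  linarith

theorem IsPhase.exists_int {v θ} {a b : ℝ} (hab : a ≤ b) (h : IsPhase v θ (Icc a b))
    (hv : v a = v b) : ∃ d : ℤ, θ b - θ a = 2 * Real.pi * d := by
  have e := (h.2 b ⟨hab, le_rfl⟩).2.symm.trans ((by rw [hv]) : v b / (‖v b‖ : ℂ) = v a / ‖v a‖)
  rw [(h.2 a ⟨le_rfl, hab⟩).2] at e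
  obtain ⟨n, hn⟩ := exp_mul_I_eq_iff.1 e
  exact ⟨n, by rw [hn]; ring⟩

theorem HasDegree.unique {v : ℝ → ℂ} {d d' : ℤ} (h : HasDegree v d) (h' : HasDegree v d') :
    d = d' := by
  rw [hasDegree_iff] at h h'
  obtain ⟨θ, h1, h2⟩ := h
  obtain ⟨θ', h1', h2'⟩ := h'
  have := h1.sub_eq_sub zero_le_one h1'
  rw [h2, h2'] at this
  exact_mod_cast mul_left_cancel₀ (by positivity) this

/-- The exponential is a covering of the punctured plane; the phase is the imaginary part of a lift
of the path. -/
theorem exists_isPhase {v : ℝ → ℂ} (hv : ContinuousOn v (Icc 0 1))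
    (h0 : ∀ t ∈ Icc (0 : ℝ) 1, v t ≠ 0) : ∃ θ, IsPhase v θ (Icc 0 1) := by
  let γ : C(unitInterval, {z : ℂ // z ≠ 0}) :=
    ⟨fun t => ⟨v t, h0 t t.2⟩, by
      refine Continuous.subtype_mk ?_ _
      exact continuousOn_iff_continuous_domRestrict.1 hv⟩
  have hγ0 : γ 0 = ⟨_, (Complex.log (v 0)).exp_ne_zero⟩ := by
    ext
    simp [γ, Complex.exp_log (h0 0 ⟨le_rfl, zero_le_one⟩)]
  obtain ⟨Γ, hΓ, -⟩ := Complex.isCoveringMap_exp.exists_path_lifts γ (Complex.log (v 0)) hγ0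
  refine ⟨fun t => (Γ (projIcc 0 1 zero_le_one t)).im, ?_, ?_⟩
  · exact (Complex.continuous_im.comp (Γ.continuous.comp continuous_projIcc)).continuousOn
  · intro t ht
    refine ⟨h0 t ht, ?_⟩
    have h1 := congrFun hΓ ⟨t, ht⟩
    have h2 : Complex.exp (Γ ⟨t, ht⟩) = v t := congrArg Subtype.val h1
    simp only [projIcc_of_mem zero_le_one ht]
    rw [← h2, Complex.norm_exp, Complex.ofReal_exp,
      ← Complex.exp_sub]
    congr 1
    apply Complex.ext <;> simp

theorem exists_hasDegree {v : ℝ → ℂ} (hv : ContinuousOn v (Icc 0 1))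
    (h0 : ∀ t ∈ Icc (0 : ℝ) 1, v t ≠ 0) (hc : v 0 = v 1) : ∃ d, HasDegree v d := by
  obtain ⟨θ, hθ⟩ := exists_isPhase hv h0
  obtain ⟨d, hd⟩ := hθ.exists_int zero_le_one hc
  exact ⟨d, hasDegree_iff.2 ⟨θ, hθ, hd⟩⟩

theorem div_norm_eq_exp_arg {z : ℂ} (hz : z ≠ 0) :
    z / (‖z‖ : ℂ) = Complex.exp (z.arg * Complex.I) := by
  rw [div_eq_iff (by simpa using hz), mul_comm, Complex.norm_mul_exp_arg_mul_I]

theorem IsPhase.mul {v w θ χ} {s : Set ℝ} (h : IsPhase v θ s) (h' : IsPhase w χ s) :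
    IsPhase (fun t => v t * w t) (fun t => θ t + χ t) s := by
  refine ⟨h.1.add h'.1, fun t ht => ⟨mul_ne_zero (h.2 t ht).1 (h'.2 t ht).1, ?_⟩⟩
  rw [norm_mul, Complex.ofReal_mul, mul_div_mul_comm, (h.2 t ht).2, (h'.2 t ht).2,
    ← Complex.exp_add]
  push_cast; ring_nf

theorem IsPhase.zpow {v θ} {s : Set ℝ} (h : IsPhase v θ s) (n : ℤ) :
    IsPhase (fun t => v t ^ n) (fun t => n * θ t) s := by
  refine ⟨continuousOn_const.mul h.1, fun t ht => ⟨zpow_ne_zero _ (h.2 t ht).1, ?_⟩⟩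
  rw [norm_zpow, Complex.ofReal_zpow, ← div_zpow, (h.2 t ht).2, ← Complex.exp_int_mul]
  push_cast; ring_nf

theorem IsPhase.congr {v w θ} {s : Set ℝ} (h : IsPhase v θ s) (e : EqOn w v s) :
    IsPhase w θ s :=
  ⟨h.1, fun t ht => by rw [e ht]; exact h.2 t ht⟩

theorem isPhase_arg {v : ℝ → ℂ} {s : Set ℝ} (hv : ContinuousOn v s)
    (h : ∀ t ∈ s, v t ∈ Complex.slitPlane) : IsPhase v (fun t => (v t).arg) s :=
  ⟨fun t ht => (Complex.continuousAt_arg (h t ht)).comp_continuousWithinAt (hv t ht),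
    fun t ht => ⟨Complex.slitPlane_ne_zero (h t ht),
      div_norm_eq_exp_arg (Complex.slitPlane_ne_zero (h t ht))⟩⟩

theorem mem_slitPlane_of_norm_sub_one_lt {z : ℂ} (h : ‖z - 1‖ < 1) : z ∈ Complex.slitPlane := by
  rw [Complex.mem_slitPlane_iff]
  left
  have := (Complex.abs_re_le_norm (z - 1)).trans_lt h
  rw [abs_lt] at this
  simp at this
  linarith

/-- The quotient w/v stays in the unit disc around 1, so its principal argument is a continuous
phase, and this argument returns to its initial value. -/
theorem HasDegree.of_norm_sub_lt {v w : ℝ → ℂ} {d : ℤ} (h : HasDegree v d)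
    (hv : ContinuousOn v (Icc 0 1)) (hw : ContinuousOn w (Icc 0 1))
    (hlt : ∀ t ∈ Icc (0 : ℝ) 1, ‖w t - v t‖ < ‖v t‖) (hv1 : v 0 = v 1) (hw1 : w 0 = w 1) :
    HasDegree w d := by
  rw [hasDegree_iff] at h ⊢
  obtain ⟨θ, h1, h2⟩ := h
  have hv0 : ∀ t ∈ Icc (0 : ℝ) 1, v t ≠ 0 := fun t ht => (h1.2 t ht).1
  have hq : IsPhase (fun t => w t / v t) (fun t => (w t / v t).arg) (Icc 0 1) := by
    refine isPhase_arg (hw.div hv hv0) fun t ht => mem_slitPlane_of_norm_sub_one_lt ?_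
    have : w t / v t - 1 = (w t - v t) / v t := by field_simp [hv0 t ht]
    rw [this, norm_div, div_lt_one (norm_pos_iff.2 (hv0 t ht))]
    exact hlt t ht
  refine ⟨_, (h1.mul hq).congr fun t ht => ?_, ?_⟩
  · have := hv0 t ht
    simp only
    field_simp
  · simp only [hv1, hw1]; linarith

/-- Homotopy invariance of the degree of loops. -/
theorem HasDegree.homotopy {H : ℝ → ℝ → ℂ} {a b : ℝ}
    (hc : ContinuousOn (fun p : ℝ × ℝ => H p.1 p.2) (Icc a b ×ˢ Icc 0 1))
    (h0 : ∀ s ∈ Icc a b, ∀ t ∈ Icc (0 : ℝ) 1, H s t ≠ 0)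
    (hcl : ∀ s ∈ Icc a b, H s 0 = H s 1) {s s' : ℝ} (hs : s ∈ Icc a b) (hs' : s' ∈ Icc a b)
    {d : ℤ} (h : HasDegree (H s) d) : HasDegree (H s') d := by
  have hK : IsCompact (Icc a b ×ˢ Icc (0 : ℝ) 1) := isCompact_Icc.prod isCompact_Icc
  have hslice : ∀ x ∈ Icc a b, ContinuousOn (H x) (Icc 0 1) := fun x hx =>
    hc.comp (f := fun t => (x, t)) (by fun_prop) fun t ht => ⟨hx, ht⟩
  obtain ⟨m, hm, hmle⟩ : ∃ m : ℝ, 0 < m ∧ ∀ x ∈ Icc a b, ∀ t ∈ Icc (0 : ℝ) 1, m ≤ ‖H x t‖ := by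
    obtain ⟨p, hp, hpm⟩ := hK.exists_isMinOn ⟨(s, 0), hs, by simp⟩ hc.norm
    exact ⟨_, norm_pos_iff.2 (h0 _ hp.1 _ hp.2), fun x hx t ht => hpm (a := (x, t)) ⟨hx, ht⟩⟩
  -- With m the minimum modulus, uniform continuity makes slices at distance below δ close enough
  -- for `HasDegree.of_norm_sub_lt`; the degree is thus locally constant in the parameter.
  obtain ⟨δ, hδ, hu⟩ := Metric.uniformContinuousOn_iff.1
    (hK.uniformContinuousOn_of_continuous hc) m hm
  have step : ∀ x ∈ Icc a b, ∀ y ∈ Icc a b, dist x y < δ → HasDegree (H x) d →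
      HasDegree (H y) d := by
    intro x hx y hy hxy hd
    refine HasDegree.of_norm_sub_lt hd (hslice x hx) (hslice y hy) (fun t ht => ?_) (hcl x hx) (hcl y hy)
    rw [← dist_eq_norm, dist_comm]
    refine (hu (x, t) ⟨hx, ht⟩ (y, t) ⟨hy, ht⟩ ?_).trans_le (hmle x hx t ht)
    simpa [Prod.dist_eq, hδ] using hxy
  have := isPreconnected_Icc.induction₂ (s := Icc a b)
    (fun x y => HasDegree (H x) d ↔ HasDegree (H y) d)
    (fun x hx => by
      filter_upwards [inter_mem_nhdsWithin _ (ball_mem_nhds x hδ)] with y hy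
      exact ⟨step x hx y hy.1 (by rw [dist_comm]; exact hy.2), step y hy.1 x hx hy.2⟩)
    (fun x y z _ _ _ h1 h2 => h1.trans h2) (fun x y _ _ h => h.symm) hs hs'
  exact this.1 h

/-- A phase along a simple closed curve which closes up is a function on the curve, hence gives
degree zero along every closed curve in its image. -/
theorem HasDegree.zero_of_simple_closed {c₀ c : ℝ → ℂ} {f : ℂ → ℂ}
    (hc₀ : ContinuousOn c₀ (Icc 0 1)) (hinj : InjOn c₀ (Ico 0 1)) (hcl₀ : c₀ 0 = c₀ 1)
    (hc : ContinuousOn c (Icc 0 1)) (hcl : c 0 = c 1) (hsub : c '' Icc 0 1 ⊆ c₀ '' Icc 0 1)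
    (h : HasDegree (fun t => f (c₀ t)) 0) : HasDegree (fun t => f (c t)) 0 := by
  rw [hasDegree_iff] at h ⊢
  obtain ⟨θ, h1, h2⟩ := h
  have h2 : θ 1 = θ 0 := by simp at h2; linarith
  choose! q hq hqe using (fun z (hz : z ∈ c₀ '' Icc 0 1) => hz)
  -- The only points identified by c₀ are the two ends, where θ agrees because the degree is 0; so θ
  -- descends to the image curve.
  have hwell : ∀ t ∈ Icc (0 : ℝ) 1, ∀ t' ∈ Icc (0 : ℝ) 1, c₀ t = c₀ t' → θ t = θ t' := by
    have key : ∀ t ∈ Icc (0 : ℝ) 1, ∃ τ ∈ Ico (0 : ℝ) 1, c₀ t = c₀ τ ∧ θ t = θ τ := by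
      intro t ht
      rcases ht.2.lt_or_eq with h | rfl
      · exact ⟨t, ⟨ht.1, h⟩, rfl, rfl⟩
      · exact ⟨0, by simp, hcl₀.symm, h2⟩
    intro t ht t' ht' e
    obtain ⟨τ, hτ, e1, e2⟩ := key t ht
    obtain ⟨τ', hτ', e1', e2'⟩ := key t' ht'
    rw [e2, e2', hinj hτ hτ' (by rw [← e1, ← e1', e])]
  -- Preimages of closed sets under the descended phase are c₀-images of compact sets, hence closed.
  have hF : ContinuousOn (fun z => θ (q z)) (c₀ '' Icc 0 1) := by
    rw [continuousOn_iff_isClosed]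
    intro Z hZ
    obtain ⟨Y, hY, hYe⟩ := continuousOn_iff_isClosed.1 h1.1 Z hZ
    refine ⟨c₀ '' (Y ∩ Icc 0 1), ?_, ?_⟩
    · exact ((isCompact_Icc.inter_left hY).image_of_continuousOn
        (hc₀.mono inter_subset_right)).isClosed
    · rw [← hYe]
      ext z
      constructor
      · rintro ⟨hz, hz'⟩
        exact ⟨⟨q z, ⟨hz, hq z hz'⟩, hqe z hz'⟩, hz'⟩
      · rintro ⟨⟨t, ⟨ht, ht'⟩, rfl⟩, hz'⟩
        refine ⟨?_, hz'⟩
        have := hwell _ (hq _ hz') t ht' (hqe _ hz')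
        simpa [this] using ht
  refine ⟨fun t => θ (q (c t)), ⟨hF.comp hc fun t ht => hsub ⟨t, ht, rfl⟩, fun t ht => ?_⟩, ?_⟩
  · have hz := hsub ⟨t, ht, rfl⟩
    have := h1.2 _ (hq _ hz)
    simpa only [hqe _ hz] using this
  · simp [hcl]

/-! ### Polar coordinates and phase increments along circles -/

/-- The point at polar coordinates `(s, φ)` with respect to the center `x₀` and axis `τ`. -/
noncomputable def polarPt (x₀ τ : ℂ) (s φ : ℝ) : ℂ := x₀ + τ * (s * Complex.exp (φ * Complex.I))

theorem continuous_polarPt (x₀ τ : ℂ) : Continuous fun p : ℝ × ℝ => polarPt x₀ τ p.1 p.2 := by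
  unfold polarPt; fun_prop

theorem continuous_polarPt_right (x₀ τ : ℂ) (s : ℝ) : Continuous fun φ : ℝ => polarPt x₀ τ s φ := by
  unfold polarPt; fun_prop

theorem dist_polarPt {x₀ τ : ℂ} (hτ : ‖τ‖ = 1) {s φ : ℝ} (hs : 0 ≤ s) :
    dist (polarPt x₀ τ s φ) x₀ = s := by
  rw [polarPt, dist_eq_norm, add_sub_cancel_left, norm_mul, norm_mul, hτ,
    Complex.norm_exp_ofReal_mul_I, Complex.norm_real, Real.norm_of_nonneg hs]
  ring

theorem lintegral_Ioc_periodic {f : ℝ → ℝ≥0∞} {T : ℝ} (hT : 0 < T) (hf : Function.Periodic f T)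
    (a b : ℝ) : ∫⁻ x in Ioc a (a + T), f x = ∫⁻ x in Ioc b (b + T), f x :=
  haveI : VAddInvariantMeasure (AddSubgroup.zmultiples T) ℝ volume :=
    ⟨fun c s _ => measure_preimage_add _ _ _⟩
  (isAddFundamentalDomain_Ioc hT a).setLIntegral_eq (isAddFundamentalDomain_Ioc hT b) f
    hf.map_vadd_zmultiples

/-- Translations and rotations preserve area, and periodicity frees the initial angle p. At a
boundary point p = -π/2 makes the arc in Ω a single interval of angles. -/
theorem lintegral_eq_lintegral_polarPt {F : ℂ → ℝ≥0∞} (hF : Measurable F) (x₀ : ℂ) {τ : ℂ}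
    (hτ : ‖τ‖ = 1) (p : ℝ) :
    ∫⁻ x, F x = ∫⁻ s in Ioi (0 : ℝ), ∫⁻ φ in Ioc p (p + 2 * Real.pi),
      ENNReal.ofReal s * F (polarPt x₀ τ s φ) := by
  have hpi := Real.pi_pos
  let e : ℂ ≃ₗᵢ[ℝ] ℂ := rotation ⟨τ, by simp [Submonoid.unitSphere, hτ]⟩
  have h1 : ∫⁻ x, F x = ∫⁻ z, F (x₀ + τ * z) := by
    rw [← lintegral_add_left_eq_self F x₀]
    exact (e.measurePreserving.lintegral_comp (hF.comp (measurable_const_add x₀))).symm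
  rw [h1, ← Complex.lintegral_comp_polarCoord_symm, polarCoord_target]
  have hm : Measurable fun q : ℝ × ℝ =>
      ENNReal.ofReal q.1 • F (x₀ + τ * Complex.polarCoord.symm q) := by
    have h2 : Measurable fun q : ℝ × ℝ => x₀ + τ * Complex.polarCoord.symm q := by
      simp only [Complex.polarCoord_symm_apply]
      fun_prop
    exact (ENNReal.measurable_ofReal.comp measurable_fst).mul (hF.comp h2)
  rw [Measure.volume_eq_prod, ← Measure.prod_restrict, lintegral_prod _ hm.aemeasurable]
  refine lintegral_congr fun s => ?_
  rw [setLIntegral_congr (Ioo_ae_eq_Ioc (a := -Real.pi) (b := Real.pi))]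
  have := lintegral_Ioc_periodic (f := fun φ => ENNReal.ofReal s * F (polarPt x₀ τ s φ))
    (T := 2 * Real.pi) (by positivity) (fun φ => by
      have : Complex.exp (((φ + 2 * Real.pi : ℝ) : ℂ) * Complex.I)
          = Complex.exp (φ * Complex.I) := exp_mul_I_eq_iff.2 ⟨1, by simp⟩
      simp only [polarPt, this]) (-Real.pi) p
  rw [← this]
  have e2 : -Real.pi + 2 * Real.pi = Real.pi := by ring
  rw [e2]
  refine lintegral_congr fun φ => ?_
  simp only [Complex.polarCoord_symm_apply, polarPt, smul_eq_mul, Complex.exp_mul_I]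
  norm_cast

/-- The increment of a function is bounded by the integral of its derivative, provided the
exceptional set has countable image. -/
theorem ofReal_abs_sub_le_lintegral_deriv {θ θ' : ℝ → ℝ} {p q : ℝ} {O : Set ℝ} (hpq : p ≤ q)
    (hO : MeasurableSet O) (hθ : ContinuousOn θ (Icc p q)) (hd : ∀ t ∈ O, HasDerivAt θ (θ' t) t)
    (hcount : (θ '' (Icc p q \ O)).Countable) :
    ENNReal.ofReal |θ q - θ p| ≤ ∫⁻ t in O, ENNReal.ofReal |θ' t| := by
  -- No absolute continuity is needed: the interval between the end values is covered by θ(O), whose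
  -- measure is at most the integral of |θ'|, and a countable set.
  have hsub : uIcc (θ p) (θ q) ⊆ θ '' (Icc p q \ O) ∪ θ '' O := by
    have := intermediate_value_uIcc (a := p) (b := q) (f := θ) (by rwa [uIcc_of_le hpq])
    rw [uIcc_of_le hpq] at this
    refine this.trans ?_
    rw [← image_union]
    exact image_mono (by intro x hx; by_cases h : x ∈ O <;> simp [h, hx])
  have hvol : volume (uIcc (θ p) (θ q)) = ENNReal.ofReal |θ q - θ p| := Real.volume_interval
  rw [← hvol]
  refine (measure_mono hsub).trans ((measure_union_le _ _).trans ?_)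
  rw [hcount.measure_zero, zero_add]
  refine (addHaar_image_le_lintegral_abs_det_fderiv volume hO
    (f' := fun t => ContinuousLinearMap.smulRight (1 : ℝ →L[ℝ] ℝ) (θ' t))
    (fun t ht => (hd t ht).hasFDerivAt.hasFDerivWithinAt)).trans (le_of_eq ?_)
  refine lintegral_congr fun t => ?_
  simp

/-- Near t the phase is θ t + Im log(v/v t): while |θ y - θ t| < π, the principal argument of v y/v
t is exactly θ y - θ t. -/
theorem IsPhase.hasDerivAt {v : ℝ → ℂ} {θ : ℝ → ℝ} {p q t : ℝ} {v' : ℂ}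
    (h : IsPhase v θ (Icc p q)) (ht : t ∈ Ioo p q) (hv : HasDerivAt v v' t) :
    HasDerivAt θ (v' / v t).im t := by
  have hI : Icc p q ∈ nhds t := Icc_mem_nhds ht.1 ht.2
  have htI : t ∈ Icc p q := Ioo_subset_Icc_self ht
  have h0 : v t ≠ 0 := (h.2 t htI).1
  have hw : HasDerivAt (fun y => v y / v t) (v' / v t) t := hv.div_const _
  have h1 : v t / v t = 1 := div_self h0
  have hlog : HasDerivAt (fun y => Complex.log (v y / v t)) (v' / v t) t := by
    have := hw.clog_real (by rw [h1]; simp [Complex.slitPlane])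
    simpa [h1] using this
  have hsum : HasDerivAt (fun y => θ t + (Complex.log (v y / v t)).im) (v' / v t).im t := by
    have := (Complex.imCLM.hasFDerivAt.comp_hasDerivAt t hlog)
    exact this.const_add (θ t)
  refine hsum.congr_of_eventuallyEq ?_
  have hθc : ContinuousAt θ t := (h.1 t htI).continuousAt hI
  have hclose : ∀ᶠ y in nhds t, |θ y - θ t| < Real.pi := by
    have := Metric.continuousAt_iff'.1 hθc Real.pi Real.pi_pos
    simpa [Real.dist_eq] using this
  filter_upwards [hclose, hI] with y hy hyI
  have e : v y / v t = (‖v y‖ / ‖v t‖ : ℝ) * Complex.exp ((θ y - θ t : ℝ) * Complex.I) := by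
    have hy0 := (h.2 y hyI).1
    have a1 := (h.2 y hyI).2
    have a2 := (h.2 t htI).2
    have n1 : (‖v y‖ : ℂ) ≠ 0 := by simpa using hy0
    have n2 : (‖v t‖ : ℂ) ≠ 0 := by simpa using h0
    push_cast
    rw [sub_mul, Complex.exp_sub, ← a1, ← a2]
    field_simp
  rw [Complex.log_im, e, Complex.arg_real_mul _ (div_pos (norm_pos_iff.2 (h.2 y hyI).1)
    (norm_pos_iff.2 h0)), Complex.arg_exp_mul_I, toIocMod_eq_self _ |>.2]
  · ring
  · rw [abs_lt] at hy
    exact ⟨hy.1, by linarith [hy.2]⟩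

theorem norm_sq_apply_le_gradSq (u : ℂ → ℂ) (x z : ℂ) :
    ‖fderiv ℝ u x z‖ ^ 2 ≤ ‖z‖ ^ 2 * gradSq u x := by
  set L := fderiv ℝ u x
  have hz : L z = z.re • L 1 + z.im • L Complex.I := by
    rw [← map_smul, ← map_smul, ← map_add]
    congr 1
    apply Complex.ext <;> simp
  have h1 : ‖L z‖ ≤ |z.re| * ‖L 1‖ + |z.im| * ‖L Complex.I‖ := by
    rw [hz]
    refine (norm_add_le _ _).trans (le_of_eq ?_)
    rw [norm_smul, norm_smul, Real.norm_eq_abs, Real.norm_eq_abs]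
  have h2 : ‖z‖ ^ 2 = |z.re| ^ 2 + |z.im| ^ 2 := by
    rw [Complex.sq_norm, Complex.normSq_apply, sq_abs, sq_abs]; ring
  have h3 : ‖L z‖ ^ 2 ≤ (|z.re| * ‖L 1‖ + |z.im| * ‖L Complex.I‖) ^ 2 :=
    pow_le_pow_left₀ (norm_nonneg _) h1 2
  refine h3.trans ?_
  rw [h2]
  change _ ≤ _ * (‖L 1‖ ^ 2 + ‖L Complex.I‖ ^ 2)
  nlinarith [sq_nonneg (|z.re| * ‖L Complex.I‖ - |z.im| * ‖L 1‖)]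

theorem measurable_gradSq (u : ℂ → ℂ) : Measurable (gradSq u) := by
  unfold gradSq
  have h1 := measurable_fderiv_apply_const ℝ u 1
  have h2 := measurable_fderiv_apply_const ℝ u Complex.I
  fun_prop

theorem gradSq_nonneg (u : ℂ → ℂ) (x : ℂ) : 0 ≤ gradSq u x := by
  unfold gradSq; positivity

/-- The energy density on a circle which controls phase increments, with angular speed `k`. -/
noncomputable def calibrated (u : ℂ → ℂ) (k s : ℝ) (x : ℂ) : ℝ :=
  1 / 2 * s ^ 2 * gradSq u x + k ^ 2 / 2 + 2 * k ^ 2 * (1 - ‖u x‖ ^ 2)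

/-- Young gives a²/2 + k²/(2ρ²), and 1/ρ² ≤ 1 + 4(1 - ρ²) because (1 - ρ²)(4ρ² - 1) ≥ 0 for 1/2 ≤ ρ
≤ 1. Equality at ρ = 1, a = k keeps the leading constant sharp. -/
theorem young_phase {k a ρ : ℝ} (hρ : 1 / 2 ≤ ρ) (hρ1 : ρ ≤ 1) :
    k * (a / ρ) ≤ 1 / 2 * a ^ 2 + k ^ 2 / 2 + 2 * k ^ 2 * (1 - ρ ^ 2) := by
  have hρ0 : 0 < ρ := by linarith
  have h1 : k * (a / ρ) ≤ 1 / 2 * a ^ 2 + 1 / 2 * (k ^ 2 / ρ ^ 2) := by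
    have : k * (a / ρ) = a * (k / ρ) := by field_simp
    rw [this, ← div_pow]
    nlinarith [sq_nonneg (a - k / ρ)]
  have h2 : k ^ 2 / ρ ^ 2 ≤ k ^ 2 + 4 * k ^ 2 * (1 - ρ ^ 2) := by
    rw [div_le_iff₀ (by positivity)]
    have : 0 ≤ (1 - ρ ^ 2) * (4 * ρ ^ 2 - 1) := by
      apply mul_nonneg <;> nlinarith
    nlinarith [mul_nonneg (sq_nonneg k) this]
  linarith

/-- The angular derivative of the phase is at most s|∇u|/|u|, to which `young_phase` applies
pointwise. The loop v has to agree with u only inside Ω, which admits the extension of u by 1: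
outside Ω the phase then takes countably many values and contributes no increment. -/
theorem ofReal_mul_abs_phase_sub_le {Ω : Set ℂ} (hΩ : IsOpen Ω) {u : ℂ → ℂ}
    (hu : ContDiffOn ℝ 1 u Ω) {x₀ τ : ℂ} (hτ : ‖τ‖ = 1) {s p q k : ℝ} (hs : 0 < s) (hpq : p ≤ q)
    (hk : 0 ≤ k) {v : ℝ → ℂ} {θ : ℝ → ℝ} (hθ : IsPhase v θ (Icc p q))
    (hv : ∀ φ ∈ Icc p q, polarPt x₀ τ s φ ∈ Ω → v φ = u (polarPt x₀ τ s φ) ∧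
      1 / 2 ≤ ‖u (polarPt x₀ τ s φ)‖ ∧ ‖u (polarPt x₀ τ s φ)‖ ≤ 1)
    (hcount : (θ '' {φ ∈ Icc p q | polarPt x₀ τ s φ ∉ Ω}).Countable) :
    ENNReal.ofReal (k * |θ q - θ p|) ≤ ∫⁻ φ in Ioo p q ∩ polarPt x₀ τ s ⁻¹' Ω,
      ENNReal.ofReal (calibrated u k s (polarPt x₀ τ s φ)) := by
  set P := polarPt x₀ τ s
  have hO : IsOpen (Ioo p q ∩ P ⁻¹' Ω) :=
    isOpen_Ioo.inter (hΩ.preimage (continuous_polarPt_right x₀ τ s))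
  have hder : ∀ φ ∈ Ioo p q ∩ P ⁻¹' Ω, HasDerivAt v
      (fderiv ℝ u (P φ) (τ * (s * (Complex.exp (φ * Complex.I) * Complex.I)))) φ := by
    intro φ hφ
    have hP : HasDerivAt P (τ * (s * (Complex.exp (φ * Complex.I) * Complex.I))) φ := by
      have h0 : HasDerivAt (fun y : ℝ => (y : ℂ) * Complex.I) Complex.I φ := by
        simpa using (Complex.ofRealCLM.hasDerivAt (x := φ)).mul_const Complex.I
      exact ((h0.cexp.const_mul (s : ℂ)).const_mul τ).const_add x₀
    have hd : DifferentiableAt ℝ u (P φ) :=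
      ((hu.contDiffAt (hΩ.mem_nhds hφ.2)).differentiableAt (by norm_num))
    refine (hd.hasFDerivAt.comp_hasDerivAt φ hP).congr_of_eventuallyEq ?_
    filter_upwards [hO.mem_nhds hφ] with y hy
    exact (hv y (Ioo_subset_Icc_self hy.1) hy.2).1
  have key := ofReal_abs_sub_le_lintegral_deriv hpq hO.measurableSet hθ.1
    (fun φ hφ => hθ.hasDerivAt hφ.1 (hder φ hφ)) (by
      refine (hcount.union ((toFinite ({p, q} : Set ℝ)).image θ).countable).mono ?_
      rw [← image_union]
      refine image_mono fun φ hφ => ?_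
      by_cases hΩφ : P φ ∈ Ω
      · right
        by_contra hne
        simp only [mem_insert_iff, mem_singleton_iff, not_or] at hne
        exact hφ.2 ⟨⟨lt_of_le_of_ne hφ.1.1 (Ne.symm hne.1), lt_of_le_of_ne hφ.1.2 hne.2⟩, hΩφ⟩
      · exact Or.inl ⟨hφ.1, hΩφ⟩)
  rw [ENNReal.ofReal_mul hk]
  refine (mul_le_mul_right key _).trans ?_
  rw [← lintegral_const_mul' _ _ ENNReal.ofReal_ne_top]
  refine setLIntegral_mono' hO.measurableSet fun φ hφ => ?_
  rw [← ENNReal.ofReal_mul hk]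
  refine ENNReal.ofReal_le_ofReal ?_
  obtain ⟨e, h1, h2⟩ := hv φ (Ioo_subset_Icc_self hφ.1) hφ.2
  rw [e]
  have hg := norm_sq_apply_le_gradSq u (P φ) (τ * (s * (Complex.exp (φ * Complex.I) * Complex.I)))
  rw [norm_mul, norm_mul, norm_mul, hτ, Complex.norm_exp_ofReal_mul_I, Complex.norm_real,
    Complex.norm_I, Real.norm_of_nonneg hs.le] at hg
  refine (mul_le_mul_of_nonneg_left ((Complex.abs_im_le_norm _).trans (le_of_eq (norm_div _ _)))
    hk).trans ((young_phase h1 h2).trans ?_)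
  unfold calibrated
  linarith

/-- Integrals over a set meeting the circles around `x₀` bound radial integrals along a section,
since the distance to `x₀` is `1`-Lipschitz. -/
theorem setLIntegral_radial_le {T : Set ℝ} {Γ' : Set ℂ} {P : ℝ → ℂ} {x₀ : ℂ}
    {f : ℂ → ℝ≥0∞} (hT : MeasurableSet T) (hP : ContinuousOn P T) (hmaps : MapsTo P T Γ')
    (hdist : ∀ s ∈ T, dist (P s) x₀ = s)
    (hf : AEMeasurable f ((Measure.hausdorffMeasure 1).restrict Γ')) :
    ∫⁻ s in T, f (P s) ≤ ∫⁻ x in Γ', f x ∂(Measure.hausdorffMeasure 1) := by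
  have hPm : AEMeasurable P (volume.restrict T) := hP.aemeasurable hT
  have hle : (volume.restrict T).map P ≤ (Measure.hausdorffMeasure 1).restrict Γ' := by
    refine Measure.le_iff.2 fun E hE => ?_
    rw [Measure.map_apply_of_aemeasurable hPm hE, Measure.restrict_apply hE,
      Measure.restrict_apply' hT]
    have hsub : P ⁻¹' E ∩ T ⊆ (fun x => dist x x₀) '' (E ∩ Γ') := fun s hs =>
      ⟨P s, ⟨hs.1, hmaps hs.2⟩, hdist s hs.2⟩
    refine (measure_mono hsub).trans ?_
    rw [← hausdorffMeasure_real]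
    have := (LipschitzWith.dist_left x₀).hausdorffMeasure_image_le (d := 1) zero_le_one (E ∩ Γ')
    simpa using this
  calc ∫⁻ s in T, f (P s) = ∫⁻ x, f x ∂((volume.restrict T).map P) :=
        (lintegral_map' (hf.mono_measure hle) hPm).symm
    _ ≤ _ := lintegral_mono' hle le_rfl

/-! ### Boundary charts and the arcs they cut from small circles -/

/-- `h` is a function on the disc of radius `ρ` around `x₀` which vanishes at `x₀` and is close to
the linear function `x ↦ -Im (conj τ (x - x₀))`, with second order error. -/
structure IsChart (x₀ τ : ℂ) (h : ℂ → ℝ) (ρ M : ℝ) : Prop where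
  norm_eq : ‖τ‖ = 1
  center : h x₀ = 0
  rho_pos : 0 < ρ
  M_pos : 0 < M
  small : M * ρ ≤ 1 / 4
  est : ∀ x ∈ ball x₀ ρ, ∀ y ∈ ball x₀ ρ,
    |h x - h y + ((starRingEnd ℂ) τ * (x - y)).im| ≤ M * max (dist x x₀) (dist y x₀) * dist x y

theorem IsChart.neg {x₀ τ : ℂ} {h : ℂ → ℝ} {ρ M : ℝ} (H : IsChart x₀ τ h ρ M) :
    IsChart x₀ (-τ) (fun x => -h x) ρ M := by
  refine ⟨by simpa using H.norm_eq, by simp [H.center], H.rho_pos, H.M_pos, H.small, ?_⟩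
  intro x hx y hy
  refine le_trans (le_of_eq ?_) (H.est x hx y hy)
  rw [← abs_neg]
  congr 1
  rw [map_neg, neg_mul, Complex.neg_im]
  ring

theorem IsChart.continuousOn {x₀ τ : ℂ} {h : ℂ → ℝ} {ρ M : ℝ} (H : IsChart x₀ τ h ρ M) :
    ContinuousOn h (ball x₀ ρ) := by
  refine (LipschitzOnWith.of_dist_le_mul (K := 2) fun x hx y hy => ?_).continuousOn
  have h1 := H.est x hx y hy
  have h2 : |((starRingEnd ℂ) τ * (x - y)).im| ≤ dist x y := by
    refine (Complex.abs_im_le_norm _).trans (le_of_eq ?_)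
    rw [norm_mul, RCLike.norm_conj, H.norm_eq, one_mul, dist_eq_norm]
  have h3 : M * max (dist x x₀) (dist y x₀) * dist x y ≤ 1 * dist x y := by
    refine mul_le_mul_of_nonneg_right ?_ dist_nonneg
    have : max (dist x x₀) (dist y x₀) ≤ ρ := max_le (mem_ball.1 hx).le (mem_ball.1 hy).le
    nlinarith [H.M_pos, H.small]
  rw [Real.dist_eq]
  have h4 := abs_le.1 h1
  have h5 := abs_le.1 h2
  rw [abs_le]
  push_cast
  constructor <;> linarith [h4.1, h4.2, h5.1, h5.2]

theorem polarPt_mem_ball {x₀ τ : ℂ} (hτ : ‖τ‖ = 1) {s φ ρ : ℝ} (hs : 0 ≤ s) (h : s < ρ) :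
    polarPt x₀ τ s φ ∈ ball x₀ ρ := by
  rw [mem_ball, dist_polarPt hτ hs]; exact h

theorem im_conj_mul_polarPt_sub {x₀ τ : ℂ} (hτ : ‖τ‖ = 1) (s φ ψ : ℝ) :
    ((starRingEnd ℂ) τ * (polarPt x₀ τ s φ - polarPt x₀ τ s ψ)).im
      = s * (Real.sin φ - Real.sin ψ) := by
  have h1 : (starRingEnd ℂ) τ * τ = 1 := by
    rw [mul_comm, Complex.mul_conj, Complex.normSq_eq_norm_sq, hτ]; simp
  have h2 : (starRingEnd ℂ) τ * (polarPt x₀ τ s φ - polarPt x₀ τ s ψ)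
      = (starRingEnd ℂ τ * τ) *
        (s * (Complex.exp (φ * Complex.I) - Complex.exp (ψ * Complex.I))) := by
    unfold polarPt; ring
  rw [h2, h1, one_mul, Complex.im_ofReal_mul]
  simp [Complex.exp_ofReal_mul_I_im]

theorem dist_polarPt_le {x₀ τ : ℂ} (hτ : ‖τ‖ = 1) {s φ ψ : ℝ} (hs : 0 ≤ s) :
    dist (polarPt x₀ τ s φ) (polarPt x₀ τ s ψ) ≤ s * |φ - ψ| := by
  have h2 : polarPt x₀ τ s φ - polarPt x₀ τ s ψ
      = τ * (s * (Complex.exp (ψ * Complex.I) *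
        (Complex.exp (Complex.I * ((φ - ψ : ℝ) : ℂ)) - 1))) := by
    unfold polarPt
    rw [mul_sub, ← Complex.exp_add]
    push_cast
    ring_nf
  rw [dist_eq_norm, h2, norm_mul, norm_mul, norm_mul, hτ, Complex.norm_exp_ofReal_mul_I,
    Complex.norm_real, Real.norm_of_nonneg hs, one_mul, one_mul]
  exact mul_le_mul_of_nonneg_left (Real.norm_exp_I_mul_ofReal_sub_one_le.trans le_rfl) hs

theorem IsChart.abs_add_sin_le {x₀ τ : ℂ} {h : ℂ → ℝ} {ρ M : ℝ} (H : IsChart x₀ τ h ρ M)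
    {s φ : ℝ} (hs : 0 ≤ s) (hsρ : s < ρ) :
    |h (polarPt x₀ τ s φ) + s * Real.sin φ| ≤ M * s ^ 2 := by
  have h1 := H.est _ (polarPt_mem_ball H.norm_eq hs hsρ (φ := φ)) x₀ (mem_ball_self H.rho_pos)
  have h2 : ((starRingEnd ℂ) τ * (polarPt x₀ τ s φ - x₀)).im = s * Real.sin φ := by
    have h3 : (starRingEnd ℂ) τ * τ = 1 := by
      rw [mul_comm, Complex.mul_conj, Complex.normSq_eq_norm_sq, H.norm_eq]; simp
    have h2 : (starRingEnd ℂ) τ * (polarPt x₀ τ s φ - x₀)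
        = (starRingEnd ℂ τ * τ) * (s * (Complex.exp (φ * Complex.I))) := by
      unfold polarPt; ring
    rw [h2, h3, one_mul]
    simp [Complex.exp_ofReal_mul_I_im]
  rw [h2, H.center, dist_polarPt H.norm_eq hs, dist_self, max_eq_left hs] at h1
  simpa [pow_two, mul_assoc] using h1

/-- For angles in [-1/2, 1/2] the increment of sin exceeds 1/4 of the increment of the angle, while
the chart error is at most Ms ≤ 1/4 times the chord. -/
theorem IsChart.strictAnti {x₀ τ : ℂ} {h : ℂ → ℝ} {ρ M : ℝ} (H : IsChart x₀ τ h ρ M)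
    {s : ℝ} (hs : 0 < s) (hsρ : s < ρ) {φ ψ : ℝ} (hφ : -(1 / 2) ≤ φ) (hφψ : φ < ψ)
    (hψ : ψ ≤ 1 / 2) : h (polarPt x₀ τ s ψ) < h (polarPt x₀ τ s φ) := by
  have h1 := H.est _ (polarPt_mem_ball H.norm_eq hs.le hsρ (φ := ψ)) _
    (polarPt_mem_ball H.norm_eq hs.le hsρ (φ := φ))
  rw [im_conj_mul_polarPt_sub H.norm_eq, dist_polarPt H.norm_eq hs.le,
    dist_polarPt H.norm_eq hs.le, max_self] at h1
  have h2 := dist_polarPt_le (x₀ := x₀) H.norm_eq (φ := ψ) (ψ := φ) hs.le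
  rw [abs_of_pos (by linarith)] at h2
  have hMs : M * s ≤ 1 / 4 := by nlinarith [H.M_pos, H.small]
  have h3 : M * s * dist (polarPt x₀ τ s ψ) (polarPt x₀ τ s φ) ≤ 1 / 4 * (s * (ψ - φ)) :=
    mul_le_mul hMs h2 dist_nonneg (by norm_num)
  have hpi := Real.pi_pos
  have hpi3 := Real.pi_lt_four
  have hpi4 := Real.pi_gt_three
  have h4 : 1 / 2 * ((ψ - φ) / 2) ≤ Real.sin ((ψ - φ) / 2) := by
    refine le_trans ?_ (Real.mul_le_sin (x := (ψ - φ) / 2) (by linarith) (by linarith))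
    refine mul_le_mul_of_nonneg_right ?_ (by linarith)
    rw [div_le_div_iff₀ (by norm_num) hpi]; linarith
  have h5 : 7 / 8 ≤ Real.cos ((ψ + φ) / 2) := by
    have := Real.one_sub_sq_div_two_le_cos (x := (ψ + φ) / 2)
    nlinarith
  have h6 : Real.sin ψ - Real.sin φ > 1 / 4 * (ψ - φ) := by
    rw [Real.sin_sub_sin]
    have : 1 / 2 * ((ψ - φ) / 2) * (7 / 8) ≤ Real.sin ((ψ - φ) / 2) * Real.cos ((ψ + φ) / 2) :=
      mul_le_mul h4 h5 (by norm_num) (by linarith)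
    nlinarith
  have := (abs_le.1 h1).2
  have h7 : s * (Real.sin ψ - Real.sin φ) > s * (1 / 4 * (ψ - φ)) :=
    mul_lt_mul_of_pos_left h6 hs
  linarith

theorem lt_abs_sin {M s φ : ℝ} (h1 : |φ| ≤ Real.pi / 2) (h2 : 2 * M * s < |φ|) :
    M * s < |Real.sin φ| := by
  refine lt_of_lt_of_le ?_ (Real.mul_abs_le_abs_sin h1)
  have : 1 / 2 * |φ| ≤ 2 / Real.pi * |φ| := by
    refine mul_le_mul_of_nonneg_right ?_ (abs_nonneg _)
    rw [div_le_div_iff₀ (by norm_num) Real.pi_pos]; linarith [Real.pi_lt_four]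
  linarith

/-- On the circle h is -s sin φ up to Ms². Once the angle exceeds 2Ms, the sine term dominates and
fixes the sign. -/
theorem IsChart.neg_of_lt {x₀ τ : ℂ} {h : ℂ → ℝ} {ρ M : ℝ} (H : IsChart x₀ τ h ρ M)
    {s φ : ℝ} (hs : 0 < s) (hsρ : s < ρ) (h1 : φ ≤ Real.pi / 2) (h2 : 2 * M * s < φ) :
    h (polarPt x₀ τ s φ) < 0 := by
  have hMs := mul_pos H.M_pos hs
  have hφ : 0 < φ := by linarith
  have h3 := lt_abs_sin (M := M) (s := s) (by rwa [abs_of_pos hφ]) (by rwa [abs_of_pos hφ])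
  rw [abs_of_nonneg (Real.sin_nonneg_of_nonneg_of_le_pi hφ.le (by linarith [Real.pi_pos]))] at h3
  have := (abs_le.1 (H.abs_add_sin_le (φ := φ) hs.le hsρ)).2
  nlinarith

theorem IsChart.pos_of_lt {x₀ τ : ℂ} {h : ℂ → ℝ} {ρ M : ℝ} (H : IsChart x₀ τ h ρ M)
    {s φ : ℝ} (hs : 0 < s) (hsρ : s < ρ) (h1 : -(Real.pi / 2) ≤ φ) (h2 : φ < -(2 * M * s)) :
    0 < h (polarPt x₀ τ s φ) := by
  have hMs := mul_pos H.M_pos hs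
  have hφ : φ < 0 := by linarith
  have h3 := lt_abs_sin (M := M) (s := s) (φ := φ) (by rw [abs_of_neg hφ]; linarith)
    (by rw [abs_of_neg hφ]; linarith)
  rw [abs_of_nonpos (Real.sin_nonpos_of_nonpos_of_neg_pi_le hφ.le (by linarith [Real.pi_pos]))]
    at h3
  have := (abs_le.1 (H.abs_add_sin_le (φ := φ) hs.le hsρ)).1
  nlinarith

/-- On each small circle around `x₀`, the right half of `{h < 0}` is an arc ending at an angle
depending continuously on the radius. -/
theorem IsChart.exists_angle {x₀ τ : ℂ} {h : ℂ → ℝ} {ρ M : ℝ} (H : IsChart x₀ τ h ρ M) :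
    ∃ a : ℝ → ℝ, ContinuousOn a (Ico 0 ρ) ∧ a 0 = 0 ∧ ∀ s ∈ Ioo 0 ρ, |a s| ≤ 2 * M * s ∧
      ∀ φ ∈ Icc (-(Real.pi / 2)) (Real.pi / 2),
        (h (polarPt x₀ τ s φ) < 0 ↔ a s < φ) ∧ (h (polarPt x₀ τ s φ) = 0 ↔ φ = a s) := by
  have hpi := Real.pi_gt_three
  have hM := H.M_pos
  have hρ := H.rho_pos
  have hsm := H.small
  have hcont : ∀ s ∈ Ioo 0 ρ, Continuous fun φ => h (polarPt x₀ τ s φ) := fun s hs =>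
    H.continuousOn.comp_continuous (continuous_polarPt_right x₀ τ s)
      fun φ => polarPt_mem_ball H.norm_eq hs.1.le hs.2
  have h2s : ∀ s ∈ Ioo 0 ρ, 2 * M * s < 1 / 2 := fun s hs => by nlinarith [hs.1, hs.2]
  -- The value 0 off (0, ρ) is what makes a 0 = 0, and later makes the sides of the sector start at
  -- x₀.
  have hex : ∀ s, ∃ x : ℝ, (s ∈ Ioo 0 ρ → |x| ≤ 2 * M * s ∧ h (polarPt x₀ τ s x) = 0) ∧
      (s ∉ Ioo 0 ρ → x = 0) := by
    intro s
    by_cases hs : s ∈ Ioo 0 ρ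
    · have hs2 := h2s s hs
      have hMs := mul_pos hM hs.1
      obtain ⟨x, hx, hx0⟩ : (0 : ℝ) ∈ (fun φ => h (polarPt x₀ τ s φ)) '' Icc (-(1 / 2)) (1 / 2) :=
        intermediate_value_Icc' (by norm_num) (hcont s hs).continuousOn
          ⟨(H.neg_of_lt hs.1 hs.2 (by linarith) hs2).le,
            (H.pos_of_lt hs.1 hs.2 (by linarith) (by linarith)).le⟩
      refine ⟨x, fun _ => ⟨?_, hx0⟩, fun h => (h hs).elim⟩
      rw [abs_le]
      simp only at hx0
      constructor
      · by_contra hc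
        have := H.pos_of_lt (φ := x) hs.1 hs.2 (by linarith [hx.1]) (by linarith)
        linarith
      · by_contra hc
        have := H.neg_of_lt (φ := x) hs.1 hs.2 (by linarith [hx.2]) (by linarith)
        linarith
    · exact ⟨0, fun h => (hs h).elim, fun _ => rfl⟩
  choose a ha ha0 using hex
  have hlt : ∀ s ∈ Ioo 0 ρ, ∀ φ ∈ Icc (-(Real.pi / 2)) (Real.pi / 2), a s < φ →
      h (polarPt x₀ τ s φ) < 0 := by
    intro s hs φ hφ hlt
    have hs2 := h2s s hs
    obtain ⟨h1, h2⟩ := ha s hs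
    rw [abs_le] at h1
    by_cases hc : φ ≤ 1 / 2
    · rw [← h2]; exact H.strictAnti hs.1 hs.2 (by linarith) hlt hc
    · exact H.neg_of_lt hs.1 hs.2 hφ.2 (by linarith)
  have hgt : ∀ s ∈ Ioo 0 ρ, ∀ φ ∈ Icc (-(Real.pi / 2)) (Real.pi / 2), φ < a s →
      0 < h (polarPt x₀ τ s φ) := by
    intro s hs φ hφ hlt
    have hs2 := h2s s hs
    obtain ⟨h1, h2⟩ := ha s hs
    rw [abs_le] at h1
    by_cases hc : -(1 / 2) ≤ φ
    · rw [← h2]; exact H.strictAnti hs.1 hs.2 hc hlt (by linarith)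
    · exact H.pos_of_lt hs.1 hs.2 hφ.1 (by linarith)
  refine ⟨a, ?_, ha0 0 (by simp), fun s hs => ⟨(ha s hs).1, fun φ hφ => ?_⟩⟩
  · intro s hs
    -- At radius 0 continuity follows from |a t| ≤ 2Mt. At s > 0 the signs of h at the angles a s ±
    -- δ persist for nearby radii and trap a t between them.
    rcases hs.1.eq_or_lt with rfl | hs0
    · rw [ContinuousWithinAt, ha0 0 (by simp)]
      refine squeeze_zero_norm' (a := fun s => 2 * M * s) ?_ ?_
      · filter_upwards [self_mem_nhdsWithin] with t ht
        rcases ht.1.eq_or_lt with rfl | ht0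
        · simp [ha0 0 (by simp)]
        · exact (ha t ⟨ht0, ht.2⟩).1
      · have : Continuous fun s => 2 * M * s := by fun_prop
        simpa using (this.tendsto 0).mono_left nhdsWithin_le_nhds
    · have hs' : s ∈ Ioo 0 ρ := ⟨hs0, hs.2⟩
      refine ContinuousAt.continuousWithinAt ?_
      rw [Metric.continuousAt_iff']
      intro η hη
      set δ := min (η / 2) (1 / 2)
      have hδ : 0 < δ := by positivity
      have hδ2 : δ ≤ 1 / 2 := min_le_right _ _
      have hδη : δ < η := (min_le_left _ _).trans_lt (by linarith)
      have hs2 := h2s s hs'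
      have hb := abs_le.1 (ha s hs').1
      have hc : ∀ φ, ContinuousAt (fun t => h (polarPt x₀ τ t φ)) s := by
        intro φ
        have : ContinuousAt h (polarPt x₀ τ s φ) := H.continuousOn.continuousAt
          (isOpen_ball.mem_nhds (polarPt_mem_ball H.norm_eq hs0.le hs.2))
        refine ContinuousAt.comp (f := fun t => polarPt x₀ τ t φ) this ?_
        exact ((continuous_polarPt x₀ τ).comp (by fun_prop : Continuous fun t : ℝ => (t, φ))).continuousAt
      have m1 : a s + δ ∈ Icc (-(Real.pi / 2)) (Real.pi / 2) := ⟨by linarith, by linarith⟩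
      have m2 : a s - δ ∈ Icc (-(Real.pi / 2)) (Real.pi / 2) := ⟨by linarith, by linarith⟩
      filter_upwards [(hc (a s + δ)).eventually (gt_mem_nhds (hlt s hs' _ m1 (by linarith))),
        (hc (a s - δ)).eventually (lt_mem_nhds (hgt s hs' _ m2 (by linarith))),
        isOpen_Ioo.mem_nhds hs'] with t h1 h2 ht
      have e1 : a t ≤ a s + δ := by
        by_contra hcon
        have := hgt t ht _ m1 (by linarith)
        linarith
      have e2 : a s - δ ≤ a t := by
        by_contra hcon
        have := hlt t ht _ m2 (by linarith)
        linarith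
      rw [Real.dist_eq, abs_lt]
      constructor <;> linarith
  · have h0 := (ha s hs).2
    rcases lt_trichotomy (a s) φ with hc | hc | hc
    · have := hlt s hs φ hφ hc
      exact ⟨⟨fun _ => hc, fun _ => this⟩, ⟨fun h => by linarith, fun h => by linarith⟩⟩
    · subst hc
      simp [h0]
    · have := hgt s hs φ hφ hc
      exact ⟨⟨fun _ => by linarith, fun _ => by linarith⟩,
        ⟨fun h => by linarith, fun h => by linarith⟩⟩

/-- Near `x₀ ∈ Γ`, the circle of radius `s` around `x₀` meets `Ω` in the arc between the angles
`a s` and `b s` (relative to the axis `τ`), and it meets `Γ` in the endpoints of this arc. -/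
structure IsBoundarySector (Ω Γ : Set ℂ) (x₀ τ : ℂ) (ρ M : ℝ) (a b : ℝ → ℝ) : Prop where
  norm_eq : ‖τ‖ = 1
  M_pos : 0 < M
  small : M * ρ ≤ 1 / 4
  cont_a : ContinuousOn a (Ico 0 ρ)
  cont_b : ContinuousOn b (Ico 0 ρ)
  a_zero : a 0 = 0
  b_zero : b 0 = Real.pi
  a_le : ∀ s ∈ Ioo 0 ρ, |a s| ≤ 2 * M * s
  b_le : ∀ s ∈ Ioo 0 ρ, |b s - Real.pi| ≤ 2 * M * s
  mem_domain : ∀ s ∈ Ioo 0 ρ, ∀ φ ∈ Icc (-(Real.pi / 2)) (3 * Real.pi / 2),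
    (polarPt x₀ τ s φ ∈ Ω ↔ a s < φ ∧ φ < b s)
  mem_curve : ∀ s ∈ Ioo 0 ρ, ∀ φ ∈ Icc (-(Real.pi / 2)) (3 * Real.pi / 2),
    (polarPt x₀ τ s φ ∈ Γ ↔ φ = a s ∨ φ = b s)
  mem_of_closure : ∀ x ∈ ball x₀ ρ, x ∈ closure Ω → x ∈ Ω ∨ x ∈ Γ

/-- Reflection of the plane in the line through `x₀` orthogonal to `τ`. -/
noncomputable def reflectAt (x₀ τ x : ℂ) : ℂ := x₀ - τ * (starRingEnd ℂ) ((starRingEnd ℂ) τ * (x - x₀))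

theorem reflectAt_polarPt {x₀ τ : ℂ} (hτ : ‖τ‖ = 1) (s φ : ℝ) :
    reflectAt x₀ τ (polarPt x₀ τ s φ) = polarPt x₀ τ s (Real.pi - φ) := by
  have h3 : (starRingEnd ℂ) τ * τ = 1 := by
    rw [mul_comm, Complex.mul_conj, Complex.normSq_eq_norm_sq, hτ]; simp
  have h2 : (starRingEnd ℂ) τ * (polarPt x₀ τ s φ - x₀) = s * Complex.exp (φ * Complex.I) := by
    have : (starRingEnd ℂ) τ * (polarPt x₀ τ s φ - x₀)
        = (starRingEnd ℂ τ * τ) * (s * (Complex.exp (φ * Complex.I))) := by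
      unfold polarPt; ring
    rw [this, h3, one_mul]
  rw [reflectAt, h2, polarPt, map_mul, Complex.conj_ofReal, ← Complex.exp_conj]
  have h4 : Complex.exp ((Real.pi - φ : ℝ) * Complex.I)
      = -Complex.exp ((starRingEnd ℂ) (φ * Complex.I)) := by
    push_cast
    rw [sub_mul, Complex.exp_sub, Complex.exp_pi_mul_I, map_mul, Complex.conj_ofReal,
      Complex.conj_I, mul_neg, Complex.exp_neg]
    ring
  rw [h4]; ring

/-- The reflection sends the angle φ to π - φ and preserves Im (conj τ (x - y)), so
`IsChart.exists_angle` for the reflected chart yields the other end of the arc. -/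
theorem IsChart.reflect {x₀ τ : ℂ} {h : ℂ → ℝ} {ρ M : ℝ} (H : IsChart x₀ τ h ρ M) :
    IsChart x₀ τ (fun x => h (reflectAt x₀ τ x)) ρ M := by
  have hτ := H.norm_eq
  have hd : ∀ x y, dist (reflectAt x₀ τ x) (reflectAt x₀ τ y) = dist x y := by
    intro x y
    have : reflectAt x₀ τ x - reflectAt x₀ τ y
        = -(τ * (starRingEnd ℂ) ((starRingEnd ℂ) τ * (x - y))) := by
      unfold reflectAt
      simp only [map_mul, map_sub]
      ring
    rw [dist_eq_norm, this, norm_neg, norm_mul, RCLike.norm_conj, norm_mul, RCLike.norm_conj, hτ,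
      one_mul, one_mul, dist_eq_norm]
  have h0 : reflectAt x₀ τ x₀ = x₀ := by simp [reflectAt]
  have hd0 : ∀ x, dist (reflectAt x₀ τ x) x₀ = dist x x₀ := fun x => by
    rw [← hd x x₀, h0]
  refine ⟨hτ, by simp [h0, H.center], H.rho_pos, H.M_pos, H.small, ?_⟩
  intro x hx y hy
  have := H.est (reflectAt x₀ τ x) (by rwa [mem_ball, hd0]) (reflectAt x₀ τ y)
    (by rwa [mem_ball, hd0])
  rw [hd, hd0, hd0] at this
  have e : ((starRingEnd ℂ) τ * (reflectAt x₀ τ x - reflectAt x₀ τ y)).im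
      = ((starRingEnd ℂ) τ * (x - y)).im := by
    have h3 : (starRingEnd ℂ) τ * τ = 1 := by
      rw [mul_comm, Complex.mul_conj, Complex.normSq_eq_norm_sq, hτ]; simp
    have : (starRingEnd ℂ) τ * (reflectAt x₀ τ x - reflectAt x₀ τ y)
        = -((starRingEnd ℂ) ((starRingEnd ℂ) τ * (x - y))) := by
      have : (starRingEnd ℂ) τ * (reflectAt x₀ τ x - reflectAt x₀ τ y)
        = -(((starRingEnd ℂ) τ * τ) * (starRingEnd ℂ) ((starRingEnd ℂ) τ * (x - y))) := by
        unfold reflectAt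
        simp only [map_mul, map_sub]
        ring
      rw [this, h3, one_mul]
    rw [this, Complex.neg_im, Complex.conj_im, neg_neg]
  rwa [e] at this

theorem IsChart.exists_sector {Ω Γ : Set ℂ} {x₀ τ : ℂ} {h : ℂ → ℝ} {ρ M : ℝ}
    (H : IsChart x₀ τ h ρ M) (hΩ : ∀ x ∈ ball x₀ ρ, (x ∈ Ω ↔ h x < 0))
    (hΓ : ∀ x ∈ ball x₀ ρ, (x ∈ Γ ↔ h x = 0)) :
    ∃ a b, IsBoundarySector Ω Γ x₀ τ ρ M a b := by
  obtain ⟨a, ha, ha0, haM⟩ := H.exists_angle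
  obtain ⟨b, hb, hb0, hbM⟩ := H.reflect.exists_angle
  have hpi := Real.pi_gt_three
  have h2s : ∀ s ∈ Ioo 0 ρ, 2 * M * s < 1 / 2 := fun s hs => by
    nlinarith [hs.1, hs.2, H.M_pos, H.small]
  have hrange : ∀ s ∈ Ioo 0 ρ, |a s| < 1 / 2 ∧ |b s| < 1 / 2 := fun s hs =>
    ⟨(haM s hs).1.trans_lt (h2s s hs), (hbM s hs).1.trans_lt (h2s s hs)⟩
  have key : ∀ s ∈ Ioo 0 ρ, ∀ φ ∈ Icc (-(Real.pi / 2)) (3 * Real.pi / 2),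
      (h (polarPt x₀ τ s φ) < 0 ↔ a s < φ ∧ φ < Real.pi - b s) ∧
      (h (polarPt x₀ τ s φ) = 0 ↔ φ = a s ∨ φ = Real.pi - b s) := by
    intro s hs φ hφ
    obtain ⟨h1, h2⟩ := hrange s hs
    rw [abs_lt] at h1 h2
    by_cases hc : φ ≤ Real.pi / 2
    · obtain ⟨e1, e2⟩ := (haM s hs).2 φ ⟨hφ.1, hc⟩
      rw [e1, e2]
      constructor
      · exact ⟨fun h => ⟨h, by linarith⟩, fun h => h.1⟩
      · exact ⟨fun h => Or.inl h, fun h => h.resolve_right (by intro h; linarith)⟩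
    · obtain ⟨e1, e2⟩ := (hbM s hs).2 (Real.pi - φ) ⟨by linarith [hφ.2], by linarith⟩
      simp only [reflectAt_polarPt H.norm_eq, sub_sub_cancel] at e1 e2
      rw [e1, e2]
      constructor
      · exact ⟨fun h => ⟨by linarith, by linarith⟩, fun h => by linarith [h.2]⟩
      · constructor
        · intro h; right; linarith
        · rintro (h | h) <;> linarith
  refine ⟨a, fun s => Real.pi - b s, ⟨H.norm_eq, H.M_pos, H.small, ha, continuousOn_const.sub hb,
    ha0, by simp [hb0], fun s hs => (haM s hs).1, fun s hs => ?_, fun s hs φ hφ => ?_,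
    fun s hs φ hφ => ?_, fun x hx hxc => ?_⟩⟩
  · have := (hbM s hs).1
    simpa [abs_neg] using this
  · rw [hΩ _ (polarPt_mem_ball H.norm_eq hs.1.le hs.2)]; exact (key s hs φ hφ).1
  · rw [hΓ _ (polarPt_mem_ball H.norm_eq hs.1.le hs.2)]; exact (key s hs φ hφ).2
  · rw [hΩ x hx, hΓ x hx, ← le_iff_lt_or_eq]
    by_contra hcon
    -- Where h > 0, a whole neighbourhood misses Ω, so the point is not in its closure.
    have hev := ((H.continuousOn.continuousAt (isOpen_ball.mem_nhds hx)).eventually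
      (lt_mem_nhds (not_le.1 hcon))).and (isOpen_ball.mem_nhds hx)
    obtain ⟨y, hy, hyΩ⟩ := mem_closure_iff_nhds.1 hxc _ hev
    exact absurd ((hΩ y hy.2).1 hyΩ) (not_lt.2 hy.1.le)

/-! ### Uniform charts for the three geometries, and regularity of g -/

/-- `Ω` and `Γ` are the negative set and the zero set of a chart around `x₀`. -/
def HasChart (Ω Γ : Set ℂ) (x₀ : ℂ) (ρ M : ℝ) : Prop :=
  ∃ τ h, IsChart x₀ τ h ρ M ∧ ∀ x ∈ ball x₀ ρ, (x ∈ Ω ↔ h x < 0) ∧ (x ∈ Γ ↔ h x = 0)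

theorem IsChart.mono {x₀ τ : ℂ} {h : ℂ → ℝ} {ρ M ρ' M' : ℝ} (H : IsChart x₀ τ h ρ M)
    (hρ0 : 0 < ρ') (hρ : ρ' ≤ ρ) (hM : M ≤ M') (hs : M' * ρ' ≤ 1 / 4) : IsChart x₀ τ h ρ' M' := by
  refine ⟨H.norm_eq, H.center, hρ0, H.M_pos.trans_le hM, hs, fun x hx y hy => ?_⟩
  refine (H.est x (ball_subset_ball hρ hx) y (ball_subset_ball hρ hy)).trans ?_
  gcongr

theorem HasChart.mono {Ω Γ : Set ℂ} {x₀ : ℂ} {ρ M ρ' M' : ℝ} (H : HasChart Ω Γ x₀ ρ M)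
    (hρ0 : 0 < ρ') (hρ : ρ' ≤ ρ) (hM : M ≤ M') (hs : M' * ρ' ≤ 1 / 4) :
    HasChart Ω Γ x₀ ρ' M' := by
  obtain ⟨τ, h, h1, h2⟩ := H
  exact ⟨τ, h, h1.mono hρ0 hρ hM hs, fun x hx => h2 x (ball_subset_ball hρ hx)⟩

/-- Moving by t in the direction τ i lowers h by at least 3t/4, so every zero of h is a limit of
points with h < 0. -/
theorem IsChart.mem_closure {D : Set ℂ} {x₀ τ : ℂ} {h : ℂ → ℝ} {ρ M : ℝ} (H : IsChart x₀ τ h ρ M)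
    (hD : ∀ x ∈ ball x₀ ρ, h x < 0 → x ∈ D) {x : ℂ} (hx : x ∈ ball x₀ ρ) (h0 : h x = 0) :
    x ∈ closure D := by
  have hτ := H.norm_eq
  have hlim : Filter.Tendsto (fun t : ℝ => x + t * (τ * Complex.I)) (nhdsWithin 0 (Ioi 0))
      (nhds x) := by
    have : Continuous fun t : ℝ => x + t * (τ * Complex.I) := by fun_prop
    have h1 := this.tendsto 0
    simp only [Complex.ofReal_zero, zero_mul, add_zero] at h1
    exact h1.mono_left nhdsWithin_le_nhds
  refine mem_closure_of_tendsto hlim ?_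
  filter_upwards [hlim (isOpen_ball.mem_nhds hx), self_mem_nhdsWithin] with t ht ht0
  have ht0 : 0 < t := ht0
  refine hD _ ht ?_
  have h1 := H.est _ ht x hx
  have h3 : (starRingEnd ℂ) τ * τ = 1 := by
    rw [mul_comm, Complex.mul_conj, Complex.normSq_eq_norm_sq, hτ]; simp
  have h2 : ((starRingEnd ℂ) τ * (x + t * (τ * Complex.I) - x)).im = t := by
    have : (starRingEnd ℂ) τ * (x + t * (τ * Complex.I) - x)
        = t * (((starRingEnd ℂ) τ * τ) * Complex.I) := by ring
    rw [this, h3]; simp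
  have h4 : dist (x + t * (τ * Complex.I)) x = t := by
    rw [dist_eq_norm, add_sub_cancel_left, norm_mul, norm_mul, hτ, Complex.norm_I,
      Complex.norm_real, Real.norm_of_nonneg ht0.le]; ring
  rw [h2, h4, h0] at h1
  have h5 : M * max (dist (x + t * (τ * Complex.I)) x₀) (dist x x₀) ≤ 1 / 4 := by
    refine le_trans ?_ H.small
    exact mul_le_mul_of_nonneg_left (max_le (mem_ball.1 ht).le (mem_ball.1 hx).le) H.M_pos.le
  have h6 := (abs_le.1 h1).2
  have h7 := mul_le_mul_of_nonneg_right h5 ht0.le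
  linarith

/-- Dividing h by |Dh(x₀)| makes its linear part -Im (conj τ (x - x₀)) with |τ| = 1; the quadratic
error comes from the Lipschitz bound K on Dh. Near p the differential is bounded below by m, so ρ
and M serve all centres x₀ near p. -/
theorem exists_isChart_of_contDiffOn {U : Set ℂ} {h : ℂ → ℝ} {p : ℂ} (hU : IsOpen U) (hp : p ∈ U)
    (hh : ContDiffOn ℝ 2 h U) (h' : fderiv ℝ h p ≠ 0) :
    ∃ ρ M : ℝ, 0 < ρ ∧ 0 < M ∧ M * ρ ≤ 1 / 4 ∧ ∀ x₀ ∈ ball p ρ, ball x₀ ρ ⊆ U ∧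
      (h x₀ = 0 → ∃ (τ : ℂ) (c : ℝ), 0 < c ∧ IsChart x₀ τ (fun x => c * h x) ρ M) := by
  have hcd : ContDiffAt ℝ 2 h p := hh.contDiffAt (hU.mem_nhds hp)
  have hcd' : ContDiffAt ℝ 1 (fderiv ℝ h) p := hcd.fderiv_right (by norm_num)
  obtain ⟨K, t, ht, hK⟩ := hcd'.exists_lipschitzOnWith
  set m := ‖fderiv ℝ h p‖ / 2
  have hm : 0 < m := by have := norm_pos_iff.2 h'; positivity
  have hev : ∀ᶠ x in nhds p, m < ‖fderiv ℝ h x‖ :=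
    hcd'.continuousAt.norm.eventually (lt_mem_nhds (by
      have := norm_pos_iff.2 h'
      simp only [m]; linarith))
  obtain ⟨δ, hδ, hδs⟩ := Metric.mem_nhds_iff.1
    (Filter.inter_mem (Filter.inter_mem (hU.mem_nhds hp) ht) hev)
  set M : ℝ := K / m + 1
  have hM : 0 < M := by positivity
  refine ⟨min (δ / 2) (1 / (4 * M)), M, by positivity, hM, ?_, ?_⟩
  · calc M * min (δ / 2) (1 / (4 * M)) ≤ M * (1 / (4 * M)) := by gcongr; exact min_le_right _ _
      _ = 1 / 4 := by field_simp
  intro x₀ hx₀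
  have hsub : ball x₀ (min (δ / 2) (1 / (4 * M))) ⊆ ball p δ := by
    refine ball_subset_ball' ?_
    have h1 := mem_ball.1 hx₀
    have h2 : min (δ / 2) (1 / (4 * M)) ≤ δ / 2 := min_le_left _ _
    linarith
  refine ⟨fun x hx => (hδs (hsub hx)).1.1, fun h0 => ?_⟩
  have hx₀' : x₀ ∈ ball p δ := hsub (mem_ball_self (by positivity))
  set L := fderiv ℝ h x₀
  set A := L 1
  set B := L Complex.I
  have hL : ∀ v : ℂ, L v = A * v.re + B * v.im := by
    intro v
    have hv : v = v.re • (1 : ℂ) + v.im • Complex.I := by apply Complex.ext <;> simp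
    conv_lhs => rw [hv]
    rw [map_add, map_smul, map_smul, smul_eq_mul, smul_eq_mul]
    ring
  -- The gradient A + iB rotated by a right angle: a tangent vector, whose normalization is τ.
  set w : ℂ := ⟨-B, A⟩
  have hw2 : ‖w‖ ^ 2 = A ^ 2 + B ^ 2 := by
    rw [Complex.sq_norm, Complex.normSq_apply]; simp only [w]; ring
  have hLw : ∀ v : ℂ, L v = -((starRingEnd ℂ) w * v).im := by
    intro v; rw [hL]; simp [w]
  have hκ : m ≤ ‖w‖ := by
    refine (hδs hx₀').2.le.trans ?_
    refine L.opNorm_le_bound (norm_nonneg _) fun v => ?_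
    rw [hLw, norm_neg]
    refine (Complex.abs_im_le_norm _).trans (le_of_eq ?_)
    rw [norm_mul, RCLike.norm_conj]
  have hw0 : 0 < ‖w‖ := hm.trans_le hκ
  have hτn : ‖((‖w‖⁻¹ : ℝ) : ℂ) * w‖ = 1 := by
    rw [norm_mul, Complex.norm_real, norm_inv, norm_norm, inv_mul_cancel₀ hw0.ne']
  refine ⟨((‖w‖⁻¹ : ℝ) : ℂ) * w, ‖w‖⁻¹, inv_pos.2 hw0,
    ⟨hτn, by simp [h0], by positivity, hM, ?_, ?_⟩⟩
  · calc M * min (δ / 2) (1 / (4 * M)) ≤ M * (1 / (4 * M)) := by gcongr; exact min_le_right _ _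
      _ = 1 / 4 := by field_simp
  intro x hx y hy
  set r := max (dist x x₀) (dist y x₀)
  have hr : closedBall x₀ r ⊆ ball p δ := by
    refine (closedBall_subset_ball ?_).trans hsub
    exact max_lt (mem_ball.1 hx) (mem_ball.1 hy)
  have hmv : ‖h x - h y - L (x - y)‖ ≤ K * r * ‖x - y‖ := by
    refine (convex_closedBall x₀ r).norm_image_sub_le_of_norm_fderiv_le' (𝕜 := ℝ) (f := h)
      (fun z hz => ?_) (fun z hz => ?_) (mem_closedBall.2 (le_max_right _ _))
      (mem_closedBall.2 (le_max_left _ _))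
    · exact (hh.contDiffAt (hU.mem_nhds (hδs (hr hz)).1.1)).differentiableAt (by norm_num)
    · rw [← dist_eq_norm]
      refine (hK.dist_le_mul _ (hδs (hr hz)).1.2 _ (hδs hx₀').1.2).trans ?_
      exact mul_le_mul_of_nonneg_left (mem_closedBall.1 hz) K.2
  have e : ‖w‖⁻¹ * h x - ‖w‖⁻¹ * h y + ((starRingEnd ℂ) (((‖w‖⁻¹ : ℝ) : ℂ) * w) * (x - y)).im
      = ‖w‖⁻¹ * (h x - h y - L (x - y)) := by
    rw [hLw, map_mul, Complex.conj_ofReal, mul_assoc, Complex.im_ofReal_mul]; ring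
  rw [e, abs_mul, abs_of_pos (inv_pos.2 hw0), dist_eq_norm, ← Real.norm_eq_abs]
  have h1 : ‖w‖⁻¹ ≤ m⁻¹ := inv_anti₀ hm hκ
  calc ‖w‖⁻¹ * ‖h x - h y - L (x - y)‖ ≤ m⁻¹ * (K * r * ‖x - y‖) := by gcongr
    _ = (K / m) * r * ‖x - y‖ := by ring
    _ ≤ M * r * ‖x - y‖ := by
      have : 0 ≤ r := le_max_of_le_left dist_nonneg
      gcongr
      simp [M]

/-- Continuity of the defining function puts the boundary into its zero set; the converse inclusion
uses the nonvanishing differential, through `IsChart.mem_closure`. -/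
theorem HasC2Boundary.exists_hasChart {D : Set ℂ} (hD : IsOpen D) (h2 : HasC2Boundary D) {p : ℂ}
    (hp : p ∈ frontier D) : ∃ ρ M : ℝ, 0 < ρ ∧ 0 < M ∧ M * ρ ≤ 1 / 4 ∧
      ∀ x₀ ∈ frontier D ∩ ball p ρ, HasChart D (frontier D) x₀ ρ M := by
  obtain ⟨U, h, hU, hpU, hh, h', hDU⟩ := h2 p hp
  obtain ⟨ρ, M, hρ, hM, hs, H⟩ := exists_isChart_of_contDiffOn hU hpU hh h'
  refine ⟨ρ, M, hρ, hM, hs, fun x₀ hx₀ => ?_⟩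
  obtain ⟨hsub, hch⟩ := H x₀ hx₀.2
  have hmem : ∀ x ∈ U, (x ∈ D ↔ h x < 0) := fun x hx =>
    ⟨fun hxD => ((hDU ▸ ⟨hxD, hx⟩ : x ∈ {x ∈ U | h x < 0})).2,
      fun hlt => ((hDU.symm ▸ ⟨hx, hlt⟩ : x ∈ D ∩ U)).1⟩
  have hfr : ∀ x ∈ U, x ∈ frontier D → h x = 0 := by
    intro x hx hxf
    rw [hD.frontier_eq] at hxf
    refine le_antisymm ?_ (not_lt.1 fun hc => hxf.2 ((hmem x hx).2 hc))
    by_contra hc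
    have hcx : ContinuousAt h x := (hh.contDiffAt (hU.mem_nhds hx)).continuousAt
    have hev := (hcx.eventually (lt_mem_nhds (not_le.1 hc))).and (hU.mem_nhds hx)
    obtain ⟨y, hy, hyD⟩ := mem_closure_iff_nhds.1 hxf.1 _ hev
    exact absurd ((hmem y hy.2).1 hyD) (not_lt.2 hy.1.le)
  obtain ⟨τ, c, hc, hC⟩ := hch (hfr _ (hsub (mem_ball_self hρ)) hx₀.1)
  refine ⟨τ, _, hC, fun x hx => ⟨?_, ?_⟩⟩
  · rw [hmem x (hsub hx)]
    exact ⟨fun h => mul_neg_of_pos_of_neg hc h, fun h => by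
      by_contra hcon
      exact absurd h (not_lt.2 (mul_nonneg hc.le (not_lt.1 hcon)))⟩
  · constructor
    · intro hxf; simp [hfr x (hsub hx) hxf]
    · intro h0
      rw [hD.frontier_eq]
      refine ⟨hC.mem_closure (fun y hy hlt => (hmem y (hsub hy)).2 ?_) hx h0, fun hxD => ?_⟩
      · by_contra hcon
        exact absurd hlt (not_lt.2 (mul_nonneg hc.le (not_lt.1 hcon)))
      · have := (hmem x (hsub hx)).1 hxD
        rcases mul_eq_zero.1 h0 with h0 | h0 <;> linarith

/-- The closure of D is locally {h ≤ 0}, so the exterior is the negative set of -h. This serves the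
annulus and the exterior domain. -/
theorem HasChart.compl_closure {D : Set ℂ} {x₀ : ℂ} {ρ M : ℝ}
    (H : HasChart D (frontier D) x₀ ρ M) : HasChart (closure D)ᶜ (frontier D) x₀ ρ M := by
  obtain ⟨τ, h, h1, h2⟩ := H
  refine ⟨-τ, _, h1.neg, fun x hx => ⟨?_, ?_⟩⟩
  · have : x ∈ closure D ↔ x ∈ D ∨ x ∈ frontier D := by
      rw [closure_eq_self_union_frontier]; rfl
    rw [mem_compl_iff, this, (h2 x hx).1, (h2 x hx).2, ← le_iff_lt_or_eq, not_le]
    constructor <;> intro h <;> linarith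
  · rw [(h2 x hx).2, neg_eq_zero]

theorem HasChart.congr {Ω Ω' Γ : Set ℂ} {x₀ : ℂ} {ρ M : ℝ} (H : HasChart Ω Γ x₀ ρ M)
    (h : ∀ x ∈ ball x₀ ρ, (x ∈ Ω' ↔ x ∈ Ω)) : HasChart Ω' Γ x₀ ρ M := by
  obtain ⟨τ, k, h1, h2⟩ := H
  exact ⟨τ, k, h1, fun x hx => ⟨(h x hx).trans (h2 x hx).1, (h2 x hx).2⟩⟩

/-- The properties of the three geometries which matter for the estimates. -/
theorem Geometry.exists_local_hasChart {Ω Γ S : Set ℂ} (h : Geometry Ω Γ S) {p : ℂ} (hp : p ∈ Γ) :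
    ∃ ρ M : ℝ, 0 < ρ ∧ 0 < M ∧ M * ρ ≤ 1 / 4 ∧ ∀ x₀ ∈ Γ ∩ ball p ρ, HasChart Ω Γ x₀ ρ M := by
  cases h with
  | simplyConnected _ h => exact h.c2.exists_hasChart h.isOpen hp
  | annulus Ω₀ Ω₁ h₀ h₁ h =>
    obtain ⟨ρ, M, hρ, hM, hs, H⟩ := h₀.c2.exists_hasChart h₀.isOpen hp
    -- Radii at most δ/2 keep the chart balls inside Ω₁, where the outer boundary is invisible.
    obtain ⟨δ, hδ, hδs⟩ := Metric.isOpen_iff.1 h₁.isOpen p (h hp.1)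
    have hmin : min ρ (δ / 2) ≤ ρ := min_le_left _ _
    have hs' : M * min ρ (δ / 2) ≤ 1 / 4 := (mul_le_mul_of_nonneg_left hmin hM.le).trans hs
    refine ⟨min ρ (δ / 2), M, by positivity, hM, hs', fun x₀ hx₀ => ?_⟩
    refine (((H x₀ ⟨hx₀.1, ball_subset_ball hmin hx₀.2⟩).compl_closure).mono
      (by positivity) hmin le_rfl hs').congr fun x hx => ?_
    have : x ∈ Ω₁ := by
      refine hδs (mem_ball.2 ?_)
      have h1 := mem_ball.1 hx
      have h2 := mem_ball.1 hx₀.2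
      have h3 : min ρ (δ / 2) ≤ δ / 2 := min_le_right _ _
      linarith [dist_triangle x x₀ p]
    simp [this]
  | exterior Ω₀ h₀ =>
    obtain ⟨ρ, M, hρ, hM, hs, H⟩ := h₀.c2.exists_hasChart h₀.isOpen hp
    exact ⟨ρ, M, hρ, hM, hs, fun x₀ hx₀ => (H x₀ hx₀).compl_closure⟩

theorem Geometry.isOpen {Ω Γ S : Set ℂ} (h : Geometry Ω Γ S) : IsOpen Ω := by
  cases h with
  | simplyConnected _ h => exact h.isOpen
  | annulus Ω₀ Ω₁ h₀ h₁ h => exact h₁.isOpen.sdiff isClosed_closure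
  | exterior Ω₀ h₀ => exact isClosed_closure.isOpen_compl

theorem Geometry.isCompact {Ω Γ S : Set ℂ} (h : Geometry Ω Γ S) : IsCompact Γ := by
  have key : ∀ D : Set ℂ, IsC2SimplyConnectedDomain D → IsCompact (frontier D) := fun D hD =>
    hD.isBounded.isCompact_closure.of_isClosed_subset isClosed_frontier frontier_subset_closure
  cases h with
  | simplyConnected _ h => exact key _ h
  | annulus Ω₀ Ω₁ h₀ h₁ h => exact key _ h₀
  | exterior Ω₀ h₀ => exact key _ h₀

theorem Geometry.isClosed {Ω Γ S : Set ℂ} (h : Geometry Ω Γ S) : IsClosed S := by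
  cases h with
  | simplyConnected _ h => exact isClosed_empty
  | annulus Ω₀ Ω₁ h₀ h₁ h => exact isClosed_frontier
  | exterior Ω₀ h₀ => exact isClosed_empty

theorem Geometry.disjoint {Ω Γ S : Set ℂ} (h : Geometry Ω Γ S) : Disjoint Γ S := by
  cases h with
  | simplyConnected _ h => exact disjoint_empty _
  | annulus Ω₀ Ω₁ h₀ h₁ h =>
    rw [Set.disjoint_left]
    intro x hx hx'
    rw [h₁.isOpen.frontier_eq] at hx'
    exact hx'.2 (h hx.1)
  | exterior Ω₀ h₀ => exact disjoint_empty _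

theorem Geometry.frontier_subset {Ω Γ S : Set ℂ} (h : Geometry Ω Γ S) : frontier Ω ⊆ Γ ∪ S := by
  cases h with
  | simplyConnected _ h => simp
  | annulus Ω₀ Ω₁ h₀ h₁ h =>
    intro x hx
    rw [sdiff_eq] at hx
    rcases frontier_inter_subset _ _ hx with h | h
    · exact Or.inr h.1
    · left
      rw [frontier_compl] at h
      exact frontier_closure_subset h.2
  | exterior Ω₀ h₀ =>
    rw [frontier_compl]
    exact frontier_closure_subset.trans subset_union_left

/-- Compactness of Γ gives one ρ and one M. Merging two pieces enlarges M, so ρ is also cut to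
1/(4M) to keep Mρ ≤ 1/4. -/
theorem Geometry.exists_hasChart {Ω Γ S : Set ℂ} (h : Geometry Ω Γ S) :
    ∃ ρ M : ℝ, 0 < ρ ∧ 0 < M ∧ M * ρ ≤ 1 / 4 ∧ ∀ x₀ ∈ Γ, HasChart Ω Γ x₀ ρ M := by
  have := h.isCompact.induction_on
    (p := fun s => ∃ ρ M : ℝ, 0 < ρ ∧ 0 < M ∧ M * ρ ≤ 1 / 4 ∧ ∀ x₀ ∈ Γ ∩ s, HasChart Ω Γ x₀ ρ M)
    ⟨1, 1 / 4, by norm_num, by norm_num, by norm_num, by simp⟩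
    (fun s t hst ⟨ρ, M, h1, h2, h3, h4⟩ => ⟨ρ, M, h1, h2, h3, fun x hx => h4 x ⟨hx.1, hst hx.2⟩⟩)
    (fun s t ⟨ρ, M, h1, h2, h3, h4⟩ ⟨ρ', M', h1', h2', h3', h4'⟩ => by
      have hs : max M M' * min (min ρ ρ') (1 / (4 * max M M')) ≤ 1 / 4 :=
        calc max M M' * min (min ρ ρ') (1 / (4 * max M M'))
            ≤ max M M' * (1 / (4 * max M M')) := by gcongr; exact min_le_right _ _
          _ = 1 / 4 := by have : 0 < max M M' := by positivity
                          field_simp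
      refine ⟨min (min ρ ρ') (1 / (4 * max M M')), max M M', by positivity, by positivity, hs, ?_⟩
      rintro x ⟨hx, hx' | hx'⟩
      · exact (h4 x ⟨hx, hx'⟩).mono (by positivity)
          ((min_le_left _ _).trans (min_le_left _ _)) (le_max_left _ _) hs
      · exact (h4' x ⟨hx, hx'⟩).mono (by positivity)
          ((min_le_left _ _).trans (min_le_right _ _)) (le_max_right _ _) hs)
    (fun p hp => by
      obtain ⟨ρ, M, h1, h2, h3, h4⟩ := h.exists_local_hasChart hp
      exact ⟨ball p ρ, mem_nhdsWithin_of_mem_nhds (ball_mem_nhds p h1), ρ, M, h1, h2, h3, h4⟩)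
  simpa using this

theorem Geometry.subset_closure {Ω Γ S : Set ℂ} (h : Geometry Ω Γ S) : Γ ⊆ closure Ω := by
  intro x hx
  obtain ⟨ρ, M, -, -, -, H⟩ := h.exists_hasChart
  obtain ⟨τ, k, h1, h2⟩ := H x hx
  exact h1.mem_closure (fun y hy => (h2 y hy).1.2) (mem_ball_self h1.rho_pos) h1.center

theorem Geometry.disjoint_domain {Ω Γ S : Set ℂ} (h : Geometry Ω Γ S) : Disjoint Γ Ω := by
  rw [Set.disjoint_left]
  intro x hx hxΩ
  obtain ⟨ρ, M, -, -, -, H⟩ := h.exists_hasChart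
  obtain ⟨τ, k, h1, h2⟩ := H x hx
  have := (h2 x (mem_ball_self h1.rho_pos)).1.1 hxΩ
  rw [h1.center] at this
  exact lt_irrefl _ this

theorem IsC2CircleMapOn.continuousOn {g : ℂ → ℂ} {Γ : Set ℂ} (hg : IsC2CircleMapOn g Γ) :
    ContinuousOn g Γ := by
  intro p hp
  obtain ⟨U, G, hU, hpU, hG, e⟩ := hg.c2 p hp
  have h1 : ContinuousWithinAt G Γ p :=
    (hG.continuousOn.continuousAt (hU.mem_nhds hpU)).continuousWithinAt
  refine h1.congr_of_eventuallyEq ?_ (e ⟨hp, hpU⟩)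
  filter_upwards [self_mem_nhdsWithin, mem_nhdsWithin_of_mem_nhds (hU.mem_nhds hpU)] with x hx hx'
  exact e ⟨hx, hx'⟩

theorem IsC2CircleMapOn.exists_lipschitz {g : ℂ → ℂ} {Γ : Set ℂ} (hg : IsC2CircleMapOn g Γ)
    (hΓ : IsCompact Γ) : ∃ ρ L : ℝ, 0 < ρ ∧ 0 < L ∧ ∀ x₀ ∈ Γ, ∀ x ∈ Γ ∩ ball x₀ ρ,
      ‖g x - g x₀‖ ≤ L * dist x x₀ := by
  have := hΓ.induction_on
    (p := fun s => ∃ ρ L : ℝ, 0 < ρ ∧ 0 < L ∧ ∀ x₀ ∈ Γ ∩ s, ∀ x ∈ Γ ∩ ball x₀ ρ,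
      ‖g x - g x₀‖ ≤ L * dist x x₀)
    ⟨1, 1, by norm_num, by norm_num, by simp⟩
    (fun s t hst ⟨ρ, M, h1, h2, h4⟩ => ⟨ρ, M, h1, h2, fun x hx => h4 x ⟨hx.1, hst hx.2⟩⟩)
    (fun s t ⟨ρ, M, h1, h2, h4⟩ ⟨ρ', M', h1', h2', h4'⟩ => by
      refine ⟨min ρ ρ', max M M', by positivity, by positivity, ?_⟩
      rintro x ⟨hx, hx' | hx'⟩ y ⟨hy, hy'⟩
      · exact (h4 x ⟨hx, hx'⟩ y ⟨hy, ball_subset_ball (min_le_left _ _) hy'⟩).trans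
          (mul_le_mul_of_nonneg_right (le_max_left _ _) dist_nonneg)
      · exact (h4' x ⟨hx, hx'⟩ y ⟨hy, ball_subset_ball (min_le_right _ _) hy'⟩).trans
          (mul_le_mul_of_nonneg_right (le_max_right _ _) dist_nonneg))
    (fun p hp => by
      obtain ⟨U, G, hU, hpU, hG, e⟩ := hg.c2 p hp
      obtain ⟨K, t, ht, hK⟩ := ((hG.contDiffAt (hU.mem_nhds hpU)).of_le
        (by norm_num : (1 : WithTop ℕ∞) ≤ 2)).exists_lipschitzOnWith
      obtain ⟨δ, hδ, hδs⟩ := Metric.mem_nhds_iff.1 (Filter.inter_mem (hU.mem_nhds hpU) ht)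
      refine ⟨ball p (δ / 2), mem_nhdsWithin_of_mem_nhds (ball_mem_nhds p (by positivity)),
        δ / 2, K + 1, by positivity, by positivity, fun x hx y hy => ?_⟩
      have hx' : x ∈ ball p δ := ball_subset_ball (by linarith) hx.2
      have hy' : y ∈ ball p δ := by
        have h1 := mem_ball.1 hx.2
        have h2 := mem_ball.1 hy.2
        exact mem_ball.2 (by linarith [dist_triangle y x p])
      rw [e ⟨hx.1, (hδs hx').1⟩, e ⟨hy.1, (hδs hy').1⟩, ← dist_eq_norm]
      refine (hK.dist_le_mul _ (hδs hy').2 _ (hδs hx').2).trans ?_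
      exact mul_le_mul_of_nonneg_right (by simp) dist_nonneg)
  simpa using this

/-! ### Weighted penalties and the integration of circle-wise bounds -/

/-- The weight used to balance penalty terms at distance `s`: the local penalty is bounded below the
scale `ε ^ γ`, while the energy only has a logarithmic bound. -/
noncomputable def scaleWeight (ε γ s : ℝ) : ℝ :=
  if s < ε ^ γ then 1 else (1 + |Real.log ε|)⁻¹

theorem scaleWeight_pos (ε γ s : ℝ) : 0 < scaleWeight ε γ s := by
  unfold scaleWeight; split_ifs <;> positivity

theorem measurable_scaleWeight (ε γ : ℝ) : Measurable (scaleWeight ε γ) :=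
  Measurable.ite measurableSet_Iio measurable_const measurable_const

theorem young_weight {w x y : ℝ} (hw : 0 < w) : x * y ≤ w * x ^ 2 / 2 + y ^ 2 / (2 * w) := by
  have h : w * x ^ 2 / 2 + y ^ 2 / (2 * w) - x * y = (w * x - y) ^ 2 / (2 * w) := by
    field_simp; ring
  have : 0 ≤ (w * x - y) ^ 2 / (2 * w) := by positivity
  linarith

theorem lintegral_Ioi_rpow {c p : ℝ} (hc : 0 < c) (hp : 1 < p) :
    ∫⁻ s in Ioi c, ENNReal.ofReal (s ^ (-p)) = ENNReal.ofReal (c ^ (1 - p) / (p - 1)) := by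
  rw [← ofReal_integral_eq_lintegral_ofReal (integrableOn_Ioi_rpow_of_lt (by linarith) hc),
    integral_Ioi_rpow_of_lt (by linarith) hc]
  · congr 1
    rw [show -p + 1 = 1 - p by ring, ← neg_sub p 1, div_neg, neg_div, neg_neg]
  · filter_upwards [ae_restrict_mem measurableSet_Ioi] with s hs
    exact Real.rpow_nonneg (hc.trans hs).le _

/-- The reciprocal weight is at most 1 plus (1 + |ln ε|) times the indicator of s ≥ ε^γ, so the
logarithm multiplies only the tail of the convergent integral. -/
theorem lintegral_inv_scaleWeight_le {ε γ r R η p : ℝ} (hε : 0 < ε) (hr : 0 < r) (hη : 0 ≤ η)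
    (hp : 1 < p) :
    ∫⁻ s in Ioo r R, ENNReal.ofReal (η / scaleWeight ε γ s * s ^ (-p)) ≤
      ENNReal.ofReal (η * r ^ (1 - p) / (p - 1) +
        η * (1 + |Real.log ε|) * (ε ^ γ) ^ (1 - p) / (p - 1)) := by
  have hεγ : 0 < ε ^ γ := Real.rpow_pos_of_pos hε γ
  have h1 : ∀ s ∈ Ioo r R, ENNReal.ofReal (η / scaleWeight ε γ s * s ^ (-p)) ≤
      ENNReal.ofReal η * ENNReal.ofReal (s ^ (-p)) +
        (Ici (ε ^ γ)).indicator (fun s => ENNReal.ofReal (η * (1 + |Real.log ε|)) *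
          ENNReal.ofReal (s ^ (-p))) s := by
    intro s hs
    by_cases h : s < ε ^ γ
    · rw [scaleWeight, if_pos h, div_one, ENNReal.ofReal_mul hη]
      exact le_self_add
    · rw [scaleWeight, if_neg h, indicator_of_mem (show s ∈ Ici (ε ^ γ) from not_lt.1 h),
        div_inv_eq_mul, ENNReal.ofReal_mul (by positivity)]
      exact le_add_self
  have hm : Measurable fun s : ℝ => ENNReal.ofReal η * ENNReal.ofReal (s ^ (-p)) := by fun_prop
  refine (setLIntegral_mono' measurableSet_Ioo h1).trans ?_
  rw [lintegral_add_left hm, ENNReal.ofReal_add (by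
    have := Real.rpow_nonneg hr.le (1 - p)
    have : 0 < p - 1 := by linarith
    positivity) (by
    have := Real.rpow_nonneg hεγ.le (1 - p)
    have : 0 < p - 1 := by linarith
    positivity)]
  refine add_le_add ?_ ?_
  · rw [lintegral_const_mul' _ _ ENNReal.ofReal_ne_top, mul_div_assoc, ENNReal.ofReal_mul hη,
      ← lintegral_Ioi_rpow hr hp]
    gcongr
    exact Ioo_subset_Ioi_self
  · refine (setLIntegral_le_lintegral _ _).trans ?_
    rw [lintegral_indicator measurableSet_Ici, lintegral_const_mul' _ _ ENNReal.ofReal_ne_top,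
      mul_div_assoc, ENNReal.ofReal_mul (p := η * (1 + |Real.log ε|)) (by positivity),
      ← lintegral_Ioi_rpow hεγ hp,
      setLIntegral_congr Ioi_ae_eq_Ici]

theorem rpow_mul_one_add_abs_log_le {ε δ : ℝ} (hε : 0 < ε) (hε1 : ε < 1) (hδ : 0 < δ) :
    ε ^ δ * (1 + |Real.log ε|) ≤ 1 + 1 / δ := by
  have h1 := (Real.abs_log_mul_self_rpow_lt ε δ hε hε1.le hδ).le
  have h2 := Real.rpow_le_one hε.le hε1.le hδ.le
  have h3 := Real.rpow_nonneg hε.le δ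
  rw [abs_mul, abs_of_nonneg h3] at h1
  linarith

theorem lintegral_inv_self {c r R : ℝ} (hr : 0 < r) (hrR : r < R) (hc : 0 ≤ c) :
    ∫⁻ s in Ioo r R, ENNReal.ofReal (c / s) = ENNReal.ofReal (c * Real.log (R / r)) := by
  have hint : IntervalIntegrable (fun s => c / s) volume r R := by
    refine ContinuousOn.intervalIntegrable ?_
    rw [uIcc_of_le hrR.le]
    exact continuousOn_const.div continuousOn_id fun s hs => (hr.trans_le hs.1).ne'
  rw [setLIntegral_congr Ioo_ae_eq_Ioc, ← ofReal_integral_eq_lintegral_ofReal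
    ((intervalIntegrable_iff_integrableOn_Ioc_of_le hrR.le).1 hint),
    ← intervalIntegral.integral_of_le hrR.le]
  · simp only [div_eq_mul_inv c]
    rw [intervalIntegral.integral_const_mul, integral_inv_of_pos hr (hr.trans hrR)]
  · filter_upwards [ae_restrict_mem measurableSet_Ioc] with s hs
    exact div_nonneg hc (hr.trans hs.1).le

/-- The weight beyond ε^γ is chosen to cancel the logarithm in the energy bound. The factor 2
appears because the penalties enter the energy with half their coefficient in `localPenalty`. -/
theorem scaled_energy_le {ε C₁ : ℝ} {I : ℝ≥0∞} (hI : I ≤ ENNReal.ofReal (C₁ * |Real.log ε|)) :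
    ENNReal.ofReal (1 + |Real.log ε|)⁻¹ * (2 * I) ≤ ENNReal.ofReal (2 * |C₁|) := by
  have h2 : (2 : ℝ≥0∞) = ENNReal.ofReal 2 := by simp
  refine (mul_le_mul_right (mul_le_mul_right hI 2) _).trans ?_
  rw [h2, ← ENNReal.ofReal_mul (by norm_num), ← ENNReal.ofReal_mul (by positivity)]
  refine ENNReal.ofReal_le_ofReal ?_
  rw [inv_mul_le_iff₀ (by positivity)]
  nlinarith [le_abs_self C₁, abs_nonneg C₁, abs_nonneg (Real.log ε)]

theorem measurableSet_annulusIn {Ω : Set ℂ} (hΩ : IsOpen Ω) (x₀ : ℂ) (r R : ℝ) :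
    MeasurableSet (annulusIn Ω x₀ r R) :=
  (isOpen_ball.inter hΩ).measurableSet.diff (isOpen_ball.inter hΩ).measurableSet

theorem mem_annulusIn {Ω : Set ℂ} {x₀ x : ℂ} {r R : ℝ} :
    x ∈ annulusIn Ω x₀ r R ↔ x ∈ Ω ∧ r ≤ dist x x₀ ∧ dist x x₀ < R := by
  simp only [annulusIn, omegaBall, mem_sdiff, mem_inter_iff, mem_ball, not_and]
  constructor
  · rintro ⟨⟨h1, h2⟩, h3⟩
    exact ⟨h2, not_lt.1 fun h => h3 h h2, h1⟩
  · rintro ⟨h1, h2, h3⟩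
    exact ⟨⟨h3, h1⟩, fun h => absurd h (not_lt.2 h2)⟩

/-- Penalty density in the domain, weighted according to scale. -/
noncomputable def weightedPenalty (ε γ : ℝ) (u : ℂ → ℂ) (x₀ x : ℂ) : ℝ :=
  scaleWeight ε γ (dist x x₀) * (1 / (2 * ε ^ 2) * (‖u x‖ ^ 2 - 1) ^ 2)

/-- The annulus is cut at radius ε^γ: the local penalty bounds the inner piece, the energy the outer
one. -/
theorem lintegral_weightedPenalty_le {Ω Γ : Set ℂ} {g u : ℂ → ℂ}
    {ε γ lam C₁ C₂ r R : ℝ} {x₀ : ℂ}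
    (hE : energy Ω Γ g ε lam u ≤ ENNReal.ofReal (C₁ * |Real.log ε|))
    (hP : localPenalty Ω Γ g ε lam u x₀ (ε ^ γ) ≤ ENNReal.ofReal C₂) :
    ∫⁻ x in annulusIn Ω x₀ r R, ENNReal.ofReal (weightedPenalty ε γ u x₀ x) ≤
      ENNReal.ofReal (|C₂| + 2 * |C₁|) := by
  set A := annulusIn Ω x₀ r R
  have hAΩ : A ⊆ Ω := fun x hx => hx.1.2
  set β := (1 + |Real.log ε|)⁻¹
  have hβ : 0 ≤ β := by positivity
  set X : ℂ → ℝ := fun x => 1 / (2 * ε ^ 2) * (‖u x‖ ^ 2 - 1) ^ 2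
  have hX : ∀ x, 0 ≤ X x := fun x => by positivity
  have hEΩ : ∫⁻ x in Ω, ENNReal.ofReal (X x) ≤ 2 * energy Ω Γ g ε lam u := by
    have h2 : (2 : ℝ≥0∞) = ENNReal.ofReal 2 := by simp
    calc ∫⁻ x in Ω, ENNReal.ofReal (X x)
        ≤ ∫⁻ x in Ω, 2 * ENNReal.ofReal (1 / 2 * (gradSq u x + X x)) := by
          refine lintegral_mono fun x => ?_
          rw [h2, ← ENNReal.ofReal_mul (by norm_num)]
          refine ENNReal.ofReal_le_ofReal ?_
          linarith [gradSq_nonneg u x]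
      _ = 2 * ∫⁻ x in Ω, ENNReal.ofReal (1 / 2 * (gradSq u x + X x)) :=
          lintegral_const_mul' _ _ (by simp)
      _ ≤ 2 * energy Ω Γ g ε lam u := by
          gcongr
          exact le_self_add
  rw [← lintegral_inter_add_sdiff _ A (measurableSet_ball (x := x₀) (ε := ε ^ γ)),
    ENNReal.ofReal_add (abs_nonneg _) (by positivity)]
  refine add_le_add ?_ ?_
  · refine le_trans ?_ ((le_self_add.trans hP).trans (ENNReal.ofReal_le_ofReal (le_abs_self C₂)))
    refine le_trans (lintegral_mono_ae ?_) (lintegral_mono_set (s := A ∩ ball x₀ (ε ^ γ))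
      (fun x hx => ⟨hx.2, hAΩ hx.1⟩))
    refine (ae_restrict_of_ae_restrict_of_subset inter_subset_right
      (ae_restrict_mem measurableSet_ball)).mono fun x hx => ?_
    rw [weightedPenalty, scaleWeight, if_pos (mem_ball.1 hx), one_mul]
  · refine le_trans ?_ (scaled_energy_le hE)
    refine le_trans ?_ (mul_le_mul_right hEΩ _)
    rw [← lintegral_const_mul' _ _ ENNReal.ofReal_ne_top]
    refine le_trans (lintegral_mono_ae ?_) (lintegral_mono_set (s := A \ ball x₀ (ε ^ γ))
      (fun x hx => hAΩ hx.1))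
    refine (ae_restrict_of_ae_restrict_of_subset (fun x hx => hx.2)
      (ae_restrict_mem measurableSet_ball.compl)).mono fun x hx => ?_
    rw [weightedPenalty, scaleWeight, if_neg (fun h => hx (mem_ball.2 h)),
      ENNReal.ofReal_mul hβ]

/-- The same cut at ε^γ for a branch P of Γ parametrized by distance to x₀; `setLIntegral_radial_le`
compares ds with arclength. -/
theorem lintegral_weighted_boundary_le {Ω Γ : Set ℂ} {g u : ℂ → ℂ} {P : ℝ → ℂ}
    {ε γ lam C₁ C₂ r R : ℝ} {x₀ : ℂ} (hΓ : IsClosed Γ)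
    (hu : ContinuousOn u Γ) (hg : ContinuousOn g Γ)
    (hP : ContinuousOn P (Ioo r R)) (hmaps : MapsTo P (Ioo r R) Γ)
    (hdist : ∀ s ∈ Ioo r R, dist (P s) x₀ = s)
    (hE : energy Ω Γ g ε lam u ≤ ENNReal.ofReal (C₁ * |Real.log ε|))
    (hPen : localPenalty Ω Γ g ε lam u x₀ (ε ^ γ) ≤ ENNReal.ofReal C₂) :
    ∫⁻ s in Ioo r R, ENNReal.ofReal (scaleWeight ε γ s * (lam * ‖u (P s) - g (P s)‖ ^ 2)) ≤
      ENNReal.ofReal (|C₂| + 2 * |C₁|) := by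
  set β := (1 + |Real.log ε|)⁻¹
  have hβ : 0 ≤ β := by positivity
  set X : ℂ → ℝ := fun x => lam * ‖u x - g x‖ ^ 2
  have hXm : AEMeasurable (fun x => ENNReal.ofReal (X x))
      ((Measure.hausdorffMeasure 1).restrict Γ) := by
    have : ContinuousOn X Γ := continuousOn_const.mul ((hu.sub hg).norm.pow 2)
    exact (this.aemeasurable hΓ.measurableSet).ennreal_ofReal
  have hEΓ : ∫⁻ x in Γ, ENNReal.ofReal (X x) ∂(Measure.hausdorffMeasure 1)
      ≤ 2 * energy Ω Γ g ε lam u := by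
    have h2 : (2 : ℝ≥0∞) = ENNReal.ofReal 2 := by simp
    calc ∫⁻ x in Γ, ENNReal.ofReal (X x) ∂(Measure.hausdorffMeasure 1)
        = ∫⁻ x in Γ, 2 * ENNReal.ofReal (lam / 2 * ‖u x - g x‖ ^ 2)
            ∂(Measure.hausdorffMeasure 1) := by
          refine lintegral_congr fun x => ?_
          rw [h2, ← ENNReal.ofReal_mul (by norm_num)]
          congr 1
          simp only [X]; ring
      _ = 2 * ∫⁻ x in Γ, ENNReal.ofReal (lam / 2 * ‖u x - g x‖ ^ 2)
            ∂(Measure.hausdorffMeasure 1) := lintegral_const_mul' _ _ (by simp)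
      _ ≤ 2 * energy Ω Γ g ε lam u := by
          gcongr
          exact le_add_self
  rw [← lintegral_inter_add_sdiff _ (Ioo r R) (measurableSet_Iio (a := ε ^ γ)),
    ENNReal.ofReal_add (abs_nonneg _) (by positivity)]
  have hT1 : MeasurableSet (Ioo r R ∩ Iio (ε ^ γ)) := measurableSet_Ioo.inter measurableSet_Iio
  have hT2 : MeasurableSet (Ioo r R \ Iio (ε ^ γ)) := measurableSet_Ioo.diff measurableSet_Iio
  refine add_le_add ?_ ?_
  · refine le_trans ?_ ((le_add_self.trans hPen).trans (ENNReal.ofReal_le_ofReal (le_abs_self C₂)))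
    refine le_trans ?_ (setLIntegral_radial_le (f := fun x => ENNReal.ofReal (X x)) hT1
      (hP.mono inter_subset_left)
      (fun s hs => ⟨hmaps hs.1, mem_ball.2 (by rw [hdist s hs.1]; exact hs.2)⟩)
      (fun s hs => hdist s hs.1) (hXm.mono_set inter_subset_left))
    refine setLIntegral_mono' hT1 fun s hs => ?_
    rw [scaleWeight, if_pos (mem_Iio.1 hs.2), one_mul]
  · refine le_trans ?_ (scaled_energy_le hE)
    refine le_trans ?_ (mul_le_mul_right hEΓ _)
    refine le_trans ?_ (mul_le_mul_right (setLIntegral_radial_le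
      (f := fun x => ENNReal.ofReal (X x)) hT2 (hP.mono sdiff_subset)
      (fun s hs => hmaps hs.1) (fun s hs => hdist s hs.1) hXm) _)
    rw [← lintegral_const_mul' _ _ ENNReal.ofReal_ne_top]
    refine setLIntegral_mono' hT2 fun s hs => ?_
    rw [scaleWeight, if_neg (fun h => hs.2 (mem_Iio.2 h)), ENNReal.ofReal_mul hβ]

/-- Dirichlet density plus weighted penalty. -/
noncomputable def totalDensity (ε γ k : ℝ) (u : ℂ → ℂ) (x₀ x : ℂ) : ℝ≥0∞ :=
  ENNReal.ofReal (1 / 2 * gradSq u x) +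
    ENNReal.ofReal (2 * k ^ 2) * ENNReal.ofReal (weightedPenalty ε γ u x₀ x)

/-- Division by s turns s²|∇u|² into |∇u|² times the polar factor s. The defect 2k²(1 - |u|²)/s is
split by `young_weight` between the weighted penalty and k²ε²/(w s³). -/
theorem ofReal_div_le_lintegral_circle {Ω : Set ℂ} {u : ℂ → ℂ} {x₀ τ : ℂ}
    (hτ : ‖τ‖ = 1) {ε γ s p q k X : ℝ} (hε : 0 < ε) (hs : 0 < s) (hpq : p ≤ q)
    (hle : ENNReal.ofReal X ≤ ∫⁻ φ in Ioo p q ∩ polarPt x₀ τ s ⁻¹' Ω,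
      ENNReal.ofReal (calibrated u k s (polarPt x₀ τ s φ))) :
    ENNReal.ofReal (X / s) ≤ (∫⁻ φ in Ioo p q ∩ polarPt x₀ τ s ⁻¹' Ω,
        ENNReal.ofReal s * totalDensity ε γ k u x₀ (polarPt x₀ τ s φ)) +
      ENNReal.ofReal ((q - p) * (k ^ 2 / (2 * s)) +
        (q - p) * k ^ 2 * (ε ^ 2 / scaleWeight ε γ s * s ^ (-3 : ℝ))) := by
  set O := Ioo p q ∩ polarPt x₀ τ s ⁻¹' Ω
  set w := scaleWeight ε γ s
  have hw : 0 < w := scaleWeight_pos _ _ _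
  have hs3 : s ^ (-3 : ℝ) = (s ^ 3)⁻¹ := by
    rw [Real.rpow_neg hs.le]; norm_cast
  set Y := k ^ 2 / (2 * s) + k ^ 2 * (ε ^ 2 / w * s ^ (-3 : ℝ))
  have hY : 0 ≤ Y := by
    have := Real.rpow_nonneg hs.le (-3)
    positivity
  have hO : volume O ≤ ENNReal.ofReal (q - p) := by
    refine (measure_mono inter_subset_left).trans ?_
    rw [Real.volume_Ioo]
  have e1 : (q - p) * (k ^ 2 / (2 * s)) + (q - p) * k ^ 2 * (ε ^ 2 / w * s ^ (-3 : ℝ))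
      = (q - p) * Y := by simp only [Y]; ring
  rw [e1, div_eq_inv_mul, ENNReal.ofReal_mul (by positivity)]
  refine (mul_le_mul_right hle _).trans ?_
  rw [← lintegral_const_mul' _ _ ENNReal.ofReal_ne_top]
  have hpt : ∀ φ, ENNReal.ofReal s⁻¹ * ENNReal.ofReal (calibrated u k s (polarPt x₀ τ s φ)) ≤
      ENNReal.ofReal s * totalDensity ε γ k u x₀ (polarPt x₀ τ s φ) + ENNReal.ofReal Y := by
    intro φ
    set x := polarPt x₀ τ s φ
    have hx : dist x x₀ = s := dist_polarPt hτ hs.le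
    have hG := gradSq_nonneg u x
    rw [totalDensity, ← ENNReal.ofReal_mul (by positivity), ← ENNReal.ofReal_mul (by positivity),
      ← ENNReal.ofReal_add (by positivity) (by unfold weightedPenalty; rw [hx]; positivity),
      ← ENNReal.ofReal_mul hs.le, ← ENNReal.ofReal_add (by
        unfold weightedPenalty; rw [hx]; positivity) hY]
    refine ENNReal.ofReal_le_ofReal ?_
    rw [weightedPenalty, hx]
    simp only [calibrated, Y, hs3]
    have hyoung := young_weight (w := w) (x := (1 - ‖u x‖ ^ 2) / ε) (y := ε / s ^ 2) hw
    have e2 : (1 - ‖u x‖ ^ 2) / ε * (ε / s ^ 2) = (1 - ‖u x‖ ^ 2) / s ^ 2 := by field_simp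
    rw [e2] at hyoung
    have h3 := mul_le_mul_of_nonneg_left hyoung (show 0 ≤ 2 * k ^ 2 * s by positivity)
    have e3 : s⁻¹ * (1 / 2 * s ^ 2 * gradSq u x + k ^ 2 / 2 + 2 * k ^ 2 * (1 - ‖u x‖ ^ 2))
        = s * (1 / 2 * gradSq u x) + k ^ 2 / (2 * s)
          + 2 * k ^ 2 * s * ((1 - ‖u x‖ ^ 2) / s ^ 2) := by field_simp
    have e4 : 2 * k ^ 2 * s * (w * ((1 - ‖u x‖ ^ 2) / ε) ^ 2 / 2 + (ε / s ^ 2) ^ 2 / (2 * w))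
        = s * (2 * k ^ 2 * (w * (1 / (2 * ε ^ 2) * (‖u x‖ ^ 2 - 1) ^ 2)))
          + k ^ 2 * (ε ^ 2 / w * (s ^ 3)⁻¹) := by field_simp; ring
    rw [e3]
    rw [e4] at h3
    linarith
  refine (lintegral_mono fun φ => hpt φ).trans ?_
  rw [lintegral_add_right _ measurable_const, setLIntegral_const, mul_comm (ENNReal.ofReal Y),
    ENNReal.ofReal_mul (by linarith)]
  gcongr

theorem measurable_indicator_totalDensity {Ω : Set ℂ} (hΩ : IsOpen Ω) {u : ℂ → ℂ}
    (hu : ContinuousOn u Ω) (ε γ k : ℝ) (x₀ : ℂ) (r R : ℝ) :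
    Measurable ((annulusIn Ω x₀ r R).indicator (totalDensity ε γ k u x₀)) := by
  classical
  -- Nothing is known about u off Ω, so measurability is checked for the extension by 0, which
  -- agrees with u on the annulus.
  set v : ℂ → ℂ := Ω.piecewise u 0
  have hv : Measurable v :=
    ContinuousOn.measurable_piecewise hu continuousOn_const hΩ.measurableSet
  have e : (annulusIn Ω x₀ r R).indicator (totalDensity ε γ k u x₀) =
      (annulusIn Ω x₀ r R).indicator (fun x => ENNReal.ofReal (1 / 2 * gradSq u x) +
        ENNReal.ofReal (2 * k ^ 2) * ENNReal.ofReal (weightedPenalty ε γ v x₀ x)) := by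
    refine indicator_congr fun x hx => ?_
    have : v x = u x := piecewise_eq_of_mem _ _ _ hx.1.2
    simp only [totalDensity, weightedPenalty, this]
  rw [e]
  refine Measurable.indicator ?_ (measurableSet_annulusIn hΩ x₀ r R)
  have h1 := measurable_gradSq u
  have h2 : Measurable fun x => weightedPenalty ε γ v x₀ x := by
    unfold weightedPenalty
    have := (measurable_scaleWeight ε γ).comp (measurable_id.dist measurable_const :
      Measurable fun x : ℂ => dist x x₀)
    exact this.mul (by fun_prop)
  fun_prop

theorem lintegral_radial_le_annulus {Ω : Set ℂ} (hΩ : IsOpen Ω) {u : ℂ → ℂ}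
    (hu : ContinuousOn u Ω) {ε γ k r R p₀ : ℝ} {x₀ τ : ℂ} (hτ : ‖τ‖ = 1) (hr : 0 < r)
    {p q : ℝ → ℝ}
    (hpq : ∀ s ∈ Ioo r R, Ioo (p s) (q s) ⊆ Ioc p₀ (p₀ + 2 * Real.pi)) :
    ∫⁻ s in Ioo r R, (∫⁻ φ in Ioo (p s) (q s) ∩ polarPt x₀ τ s ⁻¹' Ω,
        ENNReal.ofReal s * totalDensity ε γ k u x₀ (polarPt x₀ τ s φ)) ≤
      ∫⁻ x in annulusIn Ω x₀ r R, totalDensity ε γ k u x₀ x := by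
  rw [← lintegral_indicator (measurableSet_annulusIn hΩ x₀ r R),
    lintegral_eq_lintegral_polarPt (measurable_indicator_totalDensity hΩ hu ε γ k x₀ r R) x₀ hτ p₀]
  refine le_trans (setLIntegral_mono' measurableSet_Ioo fun s hs => ?_)
    (lintegral_mono_set (s := Ioo r R) (fun s hs => hr.trans hs.1))
  have hO : MeasurableSet (Ioo (p s) (q s) ∩ polarPt x₀ τ s ⁻¹' Ω) :=
    measurableSet_Ioo.inter (hΩ.preimage (continuous_polarPt_right x₀ τ s)).measurableSet
  refine le_trans (setLIntegral_mono' hO fun φ hφ => ?_)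
    (lintegral_mono_set (inter_subset_left.trans (hpq s hs)))
  rw [indicator_of_mem]
  rw [mem_annulusIn, dist_polarPt hτ (hr.trans hs.1).le]
  exact ⟨hφ.2, hs.1.le, hs.2⟩

/-- Circle-wise lower bounds integrate to a lower bound of the Dirichlet energy. -/
theorem ofReal_log_le_dirichletEnergy {Ω Γ : Set ℂ} (hΩ : IsOpen Ω) {g u : ℂ → ℂ}
    (hu : ContinuousOn u Ω) {ε γ k r R p₀ lam C₁ C₂ Q B : ℝ} {x₀ τ : ℂ} (hτ : ‖τ‖ = 1)
    (hr : 0 < r) (hrR : r < R) (hQ : 0 ≤ Q) (hB : 0 ≤ B) {p q : ℝ → ℝ}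
    (hpq : ∀ s ∈ Ioo r R, Ioo (p s) (q s) ⊆ Ioc p₀ (p₀ + 2 * Real.pi))
    (hE : energy Ω Γ g ε lam u ≤ ENNReal.ofReal (C₁ * |Real.log ε|))
    (hP : localPenalty Ω Γ g ε lam u x₀ (ε ^ γ) ≤ ENNReal.ofReal C₂) {e : ℝ → ℝ≥0∞}
    (he : AEMeasurable e (volume.restrict (Ioo r R)))
    (heB : ∫⁻ s in Ioo r R, e s ≤ ENNReal.ofReal B)
    (hcirc : ∀ s ∈ Ioo r R, ENNReal.ofReal (Q / s) ≤
      (∫⁻ φ in Ioo (p s) (q s) ∩ polarPt x₀ τ s ⁻¹' Ω,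
        ENNReal.ofReal s * totalDensity ε γ k u x₀ (polarPt x₀ τ s φ)) + e s) :
    ENNReal.ofReal (Q * Real.log (R / r) + -(2 * k ^ 2 * (|C₂| + 2 * |C₁|) + B)) ≤
      dirichletEnergy u (annulusIn Ω x₀ r R) := by
  have h1 : ENNReal.ofReal (Q * Real.log (R / r)) ≤
      (∫⁻ x in annulusIn Ω x₀ r R, totalDensity ε γ k u x₀ x) + ENNReal.ofReal B := by
    rw [← lintegral_inv_self hr hrR hQ]
    refine (setLIntegral_mono' measurableSet_Ioo hcirc).trans ?_
    rw [lintegral_add_right' _ he]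
    exact add_le_add (lintegral_radial_le_annulus hΩ hu hτ hr hpq) heB
  -- The penalty part of the density has bounded integral and joins the constant; only the Dirichlet
  -- part remains.
  have h2 : ∫⁻ x in annulusIn Ω x₀ r R, totalDensity ε γ k u x₀ x ≤
      dirichletEnergy u (annulusIn Ω x₀ r R) +
        ENNReal.ofReal (2 * k ^ 2 * (|C₂| + 2 * |C₁|)) := by
    unfold totalDensity
    rw [lintegral_add_left ((measurable_gradSq u).const_mul _).ennreal_ofReal,
      lintegral_const_mul' _ _ ENNReal.ofReal_ne_top,
      ENNReal.ofReal_mul (p := 2 * k ^ 2) (by positivity)]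
    exact add_le_add le_rfl (mul_le_mul_right (lintegral_weightedPenalty_le hE hP) _)
  have h3 := h1.trans (add_le_add h2 le_rfl)
  rw [add_assoc, ← ENNReal.ofReal_add (by positivity) hB] at h3
  rw [← sub_eq_add_neg, ENNReal.ofReal_sub _ (by positivity)]
  exact tsub_le_iff_right.2 h3

theorem ofReal_le_of_add_le {A B C : ℝ} {I : ℝ≥0∞} (hB : 0 ≤ B) (hC : 0 ≤ C)
    (h : ENNReal.ofReal (A + B) ≤ I + ENNReal.ofReal (B + C)) :
    ENNReal.ofReal A ≤ I + ENNReal.ofReal C := by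
  rcases le_or_gt A 0 with hA | hA
  · rw [ENNReal.ofReal_of_nonpos hA]; exact zero_le
  · rw [ENNReal.ofReal_add hA.le hB, add_comm B, ENNReal.ofReal_add hC hB, ← add_assoc] at h
    exact (ENNReal.add_le_add_iff_right ENNReal.ofReal_ne_top).1 h

/-- The near part is ε²/(2r²) ≤ 1/(2κ²); the tail is ε^(2-2γ)(1 + |ln ε|)/2, bounded since γ < 1. -/
theorem lintegral_core_error_le {ε γ κ r R : ℝ} (hε : 0 < ε) (hε1 : ε < 1) (hγ : γ < 1)
    (hκ : 0 < κ) (hr : κ * ε ≤ r) :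
    ∫⁻ s in Ioo r R, ENNReal.ofReal (ε ^ 2 / scaleWeight ε γ s * s ^ (-3 : ℝ)) ≤
      ENNReal.ofReal (1 / (2 * κ ^ 2) + (1 + 1 / (2 - 2 * γ)) / 2) := by
  have hr0 : 0 < r := (mul_pos hκ hε).trans_le hr
  refine (lintegral_inv_scaleWeight_le hε hr0 (by positivity) (by norm_num)).trans
    (ENNReal.ofReal_le_ofReal ?_)
  have e1 : r ^ ((1 : ℝ) - 3) = (r ^ 2)⁻¹ := by
    rw [show (1 : ℝ) - 3 = -2 by norm_num, Real.rpow_neg hr0.le]; norm_cast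
  have e2 : ε ^ 2 * (1 + |Real.log ε|) * (ε ^ γ) ^ ((1 : ℝ) - 3)
      = ε ^ (2 - 2 * γ) * (1 + |Real.log ε|) := by
    rw [← Real.rpow_mul hε.le, ← Real.rpow_natCast ε 2, mul_right_comm, ← Real.rpow_add hε]
    congr 2
    push_cast; ring
  rw [e1, e2]
  have h1 := rpow_mul_one_add_abs_log_le hε hε1 (show 0 < 2 - 2 * γ by linarith)
  have h2 : ε ^ 2 * (r ^ 2)⁻¹ ≤ 1 / κ ^ 2 := by
    rw [← div_eq_mul_inv, div_le_div_iff₀ (by positivity) (by positivity), one_mul, ← mul_pow,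
      mul_comm ε]
    exact pow_le_pow_left₀ (by positivity) hr 2
  have h3 : 1 / (2 * κ ^ 2) = 1 / κ ^ 2 / 2 := by field_simp
  norm_num only
  rw [h3]
  linarith

/-! ### The interior estimate -/

theorem extendByOne_eq_one {Ω Γ S : Set ℂ} (hΩ : IsOpen Ω) (hfr : frontier Ω ⊆ Γ ∪ S)
    {u : ℂ → ℂ} (hS : ∀ x ∈ S, u x = 1) {x : ℂ} (hx : x ∉ Ω) (hxΓ : x ∉ Γ) :
    extendByOne Ω u x = 1 := by
  unfold extendByOne
  split_ifs with h
  · refine hS x ((hfr ?_).resolve_left hxΓ)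
    rw [hΩ.frontier_eq]; exact ⟨h, hx⟩
  · rfl

theorem extendByOne_of_mem {Ω : Set ℂ} {u : ℂ → ℂ} {x : ℂ} (hx : x ∈ closure Ω) :
    extendByOne Ω u x = u x := if_pos hx

/-- If the ball misses S it meets no boundary, so by connectedness it lies in Ω and its closure in
the closure of Ω. If the closed ball misses Γ, then u and the constant 1 agree on the overlap of two
closed sets and glue. -/
theorem continuousOn_extendByOne {Ω Γ S : Set ℂ} (hΩ : IsOpen Ω) (hfr : frontier Ω ⊆ Γ ∪ S)
    {u : ℂ → ℂ} (hu : IsAdmissible Ω S u) {x₀ : ℂ} {R : ℝ} (hx₀ : x₀ ∈ closure Ω) (hR : 0 < R)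
    (hb : ball x₀ R ∩ Γ = ∅) (hor : ball x₀ R ∩ S = ∅ ∨ closedBall x₀ R ∩ Γ = ∅) :
    ContinuousOn (extendByOne Ω u) (closedBall x₀ R) := by
  have hcl : ContinuousOn (extendByOne Ω u) (closure Ω) :=
    hu.continuousOn.congr fun x hx => extendByOne_of_mem hx
  rcases hor with h | h
  · have hnf : ∀ x ∈ ball x₀ R, x ∉ frontier Ω := by
      intro x hx hxf
      rcases hfr hxf with h' | h'
      · exact (hb.subset ⟨hx, h'⟩).elim
      · exact (h.subset ⟨hx, h'⟩).elim
    have hsub : ball x₀ R ⊆ Ω := by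
      refine (convex_ball x₀ R).isPreconnected.subset_left_of_subset_union hΩ
        isClosed_closure.isOpen_compl (disjoint_compl_right.mono_left subset_closure) ?_ ?_
      · intro x hx
        by_cases hxc : x ∈ closure Ω
        · left
          by_contra hxΩ
          exact hnf x hx (by rw [hΩ.frontier_eq]; exact ⟨hxc, hxΩ⟩)
        · exact Or.inr hxc
      · refine ⟨x₀, mem_ball_self hR, ?_⟩
        by_contra hxΩ
        exact hnf x₀ (mem_ball_self hR) (by rw [hΩ.frontier_eq]; exact ⟨hx₀, hxΩ⟩)
    refine hcl.mono ?_
    rw [← closure_ball x₀ hR.ne']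
    exact closure_mono hsub
  · have h1 : ContinuousOn (extendByOne Ω u) (closedBall x₀ R ∩ Ωᶜ) := by
      refine (continuousOn_const (c := (1 : ℂ))).congr fun x hx => ?_
      exact extendByOne_eq_one hΩ hfr hu.eq_one hx.2 fun hxΓ => (h.subset ⟨hx.1, hxΓ⟩).elim
    refine (hcl.union_of_isClosed h1 isClosed_closure
      (isClosed_closedBall.inter hΩ.isClosed_compl)).mono fun x hx => ?_
    by_cases hxΩ : x ∈ Ω
    · exact Or.inl (subset_closure hxΩ)
    · exact Or.inr ⟨hx, hxΩ⟩

theorem circleLoop_eq_polarPt (x₀ : ℂ) (s φ : ℝ) :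
    circleLoop x₀ s (φ / (2 * Real.pi)) = polarPt x₀ 1 s φ := by
  have hpi : (Real.pi : ℂ) ≠ 0 := by exact_mod_cast Real.pi_ne_zero
  rw [circleLoop, polarPt, one_mul]
  push_cast
  congr 3
  field_simp

/-- The calibration is k = |d|: the phase term 2πd²/s pays the loss πd²/s of the circle and leaves
πd²/s. -/
theorem interior_lower_bound {Ω Γ S : Set ℂ} (hΩ : IsOpen Ω) (hfr : frontier Ω ⊆ Γ ∪ S)
    {g u : ℂ → ℂ} (hu : IsAdmissible Ω S u) {x₀ : ℂ} {ε γ lam κ C₁ C₂ r R : ℝ}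
    (hx₀ : x₀ ∈ closure Ω) (hε : 0 < ε) (hε1 : ε < 1) (hγ : γ < 1) (hκ : 0 < κ)
    (hr : κ * ε ≤ r) (hrR : r < R) (hb : ball x₀ R ∩ Γ = ∅)
    (hor : ball x₀ R ∩ S = ∅ ∨ closedBall x₀ R ∩ Γ = ∅)
    (hA : ∀ x ∈ annulusIn Ω x₀ r R, 1 / 2 ≤ ‖u x‖ ∧ ‖u x‖ ≤ 1)
    (hE : energy Ω Γ g ε lam u ≤ ENNReal.ofReal (C₁ * |Real.log ε|))
    (hP : localPenalty Ω Γ g ε lam u x₀ (ε ^ γ) ≤ ENNReal.ofReal C₂) {d : ℤ}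
    (hd : HasInteriorDegree Ω u x₀ R d) :
    ENNReal.ofReal (Real.pi * d ^ 2 * Real.log (R / r) + -(2 * |(d : ℝ)| ^ 2 * (|C₂| + 2 * |C₁|)
      + 2 * Real.pi * d ^ 2 * (1 / (2 * κ ^ 2) + (1 + 1 / (2 - 2 * γ)) / 2))) ≤
      dirichletEnergy u (annulusIn Ω x₀ r R) := by
  have hpi := Real.pi_pos
  have hr0 : 0 < r := (mul_pos hκ hε).trans_le hr
  have hR0 : 0 < R := hr0.trans hrR
  have hτ : ‖(1 : ℂ)‖ = 1 := norm_one
  have hcont := continuousOn_extendByOne hΩ hfr hu hx₀ hR0 hb hor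
  have hγ2 : 0 < 2 - 2 * γ := by linarith
  set v := extendByOne Ω u
  have hloop : ∀ s : ℝ, 0 ≤ s → ∀ t, dist (circleLoop x₀ s t) x₀ = s := by
    intro s hs t
    have := dist_polarPt (x₀ := x₀) hτ (s := s) (φ := t * (2 * Real.pi)) hs
    rwa [← circleLoop_eq_polarPt, mul_div_cancel_right₀ _ (by positivity)] at this
  have hne : ∀ x, r < dist x x₀ → dist x x₀ < R →
      (x ∈ Ω → v x = u x ∧ 1 / 2 ≤ ‖u x‖ ∧ ‖u x‖ ≤ 1) ∧ (x ∉ Ω → v x = 1) := by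
    intro x h1 h2
    refine ⟨fun hx => ⟨extendByOne_of_mem (subset_closure hx),
      hA x (mem_annulusIn.2 ⟨hx, h1.le, h2⟩)⟩, fun hx => ?_⟩
    exact extendByOne_eq_one hΩ hfr hu.eq_one hx fun hxΓ => (hb.subset ⟨h2, hxΓ⟩).elim
  -- The degree passes from radius R to s. On the circle of radius R itself u is nonzero only
  -- because the degree is defined there.
  have hdeg : ∀ s ∈ Ioo r R, HasDegree (fun t => v (circleLoop x₀ s t)) d := by
    intro s hs
    have hs0 : 0 < s := hr0.trans hs.1
    refine HasDegree.homotopy (H := fun s t => v (circleLoop x₀ s t)) (a := s) (b := R) ?_ ?_ ?_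
      (right_mem_Icc.2 hs.2.le) (left_mem_Icc.2 hs.2.le) hd
    · refine hcont.comp (f := fun p : ℝ × ℝ => circleLoop x₀ p.1 p.2)
        (by unfold circleLoop; fun_prop) fun p hp => ?_
      rw [mem_closedBall, hloop _ (hs0.le.trans hp.1.1)]
      exact hp.1.2
    · intro s' hs' t ht
      rcases hs'.2.eq_or_lt with rfl | hlt
      · obtain ⟨θ, -, h2, -⟩ := hd
        exact (h2 t ht).1
      · have hdist := hloop s' (hs0.le.trans hs'.1) t
        obtain ⟨h1, h2⟩ := hne (circleLoop x₀ s' t) (by rw [hdist]; exact hs.1.trans_le hs'.1)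
          (by rw [hdist]; exact hlt)
        by_cases hx : circleLoop x₀ s' t ∈ Ω
        · obtain ⟨e, h3, -⟩ := h1 hx
          simp only [e]
          intro h0
          rw [h0, norm_zero] at h3
          norm_num at h3
        · simp [h2 hx]
    · intro s' _
      have : circleLoop x₀ s' 0 = circleLoop x₀ s' 1 := by
        simp [circleLoop, Complex.exp_two_pi_mul_I]
      simp only [this]
  have hcirc : ∀ s ∈ Ioo r R, ENNReal.ofReal (Real.pi * d ^ 2 / s) ≤
      (∫⁻ φ in Ioo 0 (2 * Real.pi) ∩ polarPt x₀ 1 s ⁻¹' Ω,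
        ENNReal.ofReal s * totalDensity ε γ |(d : ℝ)| u x₀ (polarPt x₀ 1 s φ)) +
      ENNReal.ofReal (2 * Real.pi * d ^ 2 * (ε ^ 2 / scaleWeight ε γ s * s ^ (-3 : ℝ))) := by
    intro s hs
    have hs0 : 0 < s := hr0.trans hs.1
    obtain ⟨θ, hθ, hθd⟩ := hasDegree_iff.1 (hdeg s hs)
    have hφ : IsPhase (fun φ => v (polarPt x₀ 1 s φ)) (fun φ => θ (φ / (2 * Real.pi)))
        (Icc 0 (2 * Real.pi)) := by
      have hmem : ∀ φ ∈ Icc 0 (2 * Real.pi), φ / (2 * Real.pi) ∈ Icc (0 : ℝ) 1 := fun φ hφ =>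
        ⟨div_nonneg hφ.1 (by positivity), (div_le_one (by positivity)).2 hφ.2⟩
      refine ⟨hθ.1.comp (by fun_prop) hmem, fun φ hφ => ?_⟩
      have := hθ.2 _ (hmem φ hφ)
      simpa only [circleLoop_eq_polarPt] using this
    have hdist : ∀ φ, dist (polarPt x₀ 1 s φ) x₀ = s := fun φ => dist_polarPt hτ hs0.le
    have h1 := ofReal_mul_abs_phase_sub_le hΩ hu.contDiffOn hτ hs0 (by positivity)
      (abs_nonneg (d : ℝ)) hφ (fun φ _ hx => (hne _ (by rw [hdist]; exact hs.1)
        (by rw [hdist]; exact hs.2)).1 hx) (by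
        -- Outside Ω the extension equals 1, so the phase lies in 2πℤ there.
        refine (countable_range (fun n : ℤ => 2 * Real.pi * (n : ℝ))).mono ?_
        rintro _ ⟨φ, ⟨hφI, hφΩ⟩, rfl⟩
        have e := (hφ.2 φ hφI).2
        simp only [(hne _ (by rw [hdist]; exact hs.1) (by rw [hdist]; exact hs.2)).2 hφΩ] at e
        obtain ⟨n, hn⟩ := (exp_mul_I_eq_iff (x := θ (φ / (2 * Real.pi))) (y := 0)).1 (by
          rw [← e]; simp)
        exact ⟨n, by simp only [hn]; ring⟩)
    have hΔ : |(d : ℝ)| * |θ (2 * Real.pi / (2 * Real.pi)) - θ (0 / (2 * Real.pi))|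
        = 2 * Real.pi * d ^ 2 := by
      rw [div_self (by positivity), zero_div, hθd, abs_mul,
        abs_of_pos (show 0 < 2 * Real.pi by positivity),
        ← sq_abs (d : ℝ)]
      ring
    rw [hΔ] at h1
    have h2 := ofReal_div_le_lintegral_circle (γ := γ) hτ hε hs0 (by positivity) h1
    have hw := scaleWeight_pos ε γ s
    have hs3 := Real.rpow_pos_of_pos hs0 (-3)
    rw [sq_abs] at h2
    refine ofReal_le_of_add_le (B := Real.pi * d ^ 2 / s) (by positivity) (by positivity) ?_
    convert h2 using 2
    · ring
    · congr 1; field_simp; ring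
  refine ofReal_log_le_dirichletEnergy (p₀ := 0) hΩ hu.contDiffOn.continuousOn hτ hr0 hrR
    (by positivity) (by positivity) (p := fun _ => 0) (q := fun _ => 2 * Real.pi) ?_ hE hP ?_ ?_
    hcirc
  · intro s _
    rw [zero_add]; exact Ioo_subset_Ioc_self
  · have := measurable_scaleWeight ε γ
    exact (by fun_prop : Measurable fun s => ENNReal.ofReal (2 * Real.pi * d ^ 2 *
      (ε ^ 2 / scaleWeight ε γ s * s ^ (-3 : ℝ)))).aemeasurable
  · have e : ∀ s : ℝ, ENNReal.ofReal (2 * Real.pi * d ^ 2 *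
        (ε ^ 2 / scaleWeight ε γ s * s ^ (-3 : ℝ))) = ENNReal.ofReal (2 * Real.pi * d ^ 2) *
          ENNReal.ofReal (ε ^ 2 / scaleWeight ε γ s * s ^ (-3 : ℝ)) := fun s =>
      ENNReal.ofReal_mul (by positivity)
    simp only [e]
    rw [lintegral_const_mul' _ _ ENNReal.ofReal_ne_top,
      ENNReal.ofReal_mul (p := 2 * Real.pi * d ^ 2) (by positivity)]
    exact mul_le_mul_right (lintegral_core_error_le hε hε1 hγ hκ hr) _

/-! ### The explicit loop around a boundary sector -/

theorem exists_eq_polarPt {x₀ τ : ℂ} (hτ : ‖τ‖ = 1) (x : ℂ) :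
    ∃ φ ∈ Icc (-(Real.pi / 2)) (3 * Real.pi / 2), x = polarPt x₀ τ (dist x x₀) φ := by
  have hpi := Real.pi_pos
  have h3 : τ * (starRingEnd ℂ) τ = 1 := by
    rw [Complex.mul_conj, Complex.normSq_eq_norm_sq, hτ]; simp
  set z := (starRingEnd ℂ) τ * (x - x₀)
  have hz : ‖z‖ = dist x x₀ := by
    rw [norm_mul, RCLike.norm_conj, hτ, one_mul, dist_eq_norm]
  have hx : ∀ φ : ℝ, Complex.exp (φ * Complex.I) = Complex.exp (z.arg * Complex.I) →
      x = polarPt x₀ τ (dist x x₀) φ := by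
    intro φ h
    rw [polarPt, h, ← hz, Complex.norm_mul_exp_arg_mul_I]
    simp only [z]
    rw [← mul_assoc, h3]; ring
  by_cases h : -(Real.pi / 2) ≤ z.arg
  · exact ⟨z.arg, ⟨h, by linarith [Complex.arg_le_pi z]⟩, hx _ rfl⟩
  · refine ⟨z.arg + 2 * Real.pi, ⟨by linarith [Complex.neg_pi_lt_arg z], by linarith⟩, hx _ ?_⟩
    exact exp_mul_I_eq_iff.2 ⟨1, by simp⟩

theorem polarPt_inj {x₀ τ : ℂ} (hτ : ‖τ‖ = 1) {s φ ψ : ℝ} (hs : 0 < s)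
    (h : |φ - ψ| < 2 * Real.pi) (he : polarPt x₀ τ s φ = polarPt x₀ τ s ψ) : φ = ψ := by
  have hτ0 : τ ≠ 0 := norm_pos_iff.1 (by rw [hτ]; norm_num)
  have hs0 : (s : ℂ) ≠ 0 := by exact_mod_cast hs.ne'
  have e := mul_left_cancel₀ hs0 (mul_left_cancel₀ hτ0 (add_left_cancel he))
  obtain ⟨n, hn⟩ := exp_mul_I_eq_iff.1 e
  have hn0 : n = 0 := by
    have h1 : φ - ψ = 2 * Real.pi * n := by linarith
    rw [h1, abs_mul, abs_of_pos (show 0 < 2 * Real.pi by positivity)] at h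
    have h2 : |(n : ℝ)| < 1 := by
      by_contra hc
      nlinarith [Real.pi_pos]
    exact Int.abs_lt_one_iff.1 (by exact_mod_cast h2)
  rw [hn, hn0]; simp

/-- Radius along the loop around a boundary sector of radius `s`. -/
noncomputable def sectorRad (s t : ℝ) : ℝ := s * min 1 (min (3 * t) (3 - 3 * t))

/-- Position between the two sides of the sector along the loop. -/
noncomputable def sectorMix (t : ℝ) : ℝ := max 0 (min 1 (3 * t - 1))

/-- The loop which runs along one side of the sector of radius `s`, the arc, and the other side. -/
noncomputable def sectorLoop (x₀ τ : ℂ) (a b : ℝ → ℝ) (s t : ℝ) : ℂ :=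
  polarPt x₀ τ (sectorRad s t)
    ((1 - sectorMix t) * a (sectorRad s t) + sectorMix t * b (sectorRad s t))

theorem sectorRad_mem {s t : ℝ} (hs : 0 ≤ s) (ht : t ∈ Icc (0 : ℝ) 1) :
    sectorRad s t ∈ Icc 0 s := by
  have h1 : 0 ≤ min 1 (min (3 * t) (3 - 3 * t)) :=
    le_min zero_le_one (le_min (by linarith [ht.1]) (by linarith [ht.2]))
  exact ⟨mul_nonneg hs h1, mul_le_of_le_one_right hs (min_le_left _ _)⟩

theorem sector_left {t : ℝ} (ht : t ≤ 1 / 3) :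
    sectorMix t = 0 ∧ min 1 (min (3 * t) (3 - 3 * t)) = 3 * t := by
  constructor
  · rw [sectorMix, max_eq_left]
    exact (min_le_right _ _).trans (by linarith)
  · rw [min_eq_left (show 3 * t ≤ 3 - 3 * t by linarith), min_eq_right (by linarith)]

theorem sector_right {t : ℝ} (ht : 2 / 3 ≤ t) :
    sectorMix t = 1 ∧ min 1 (min (3 * t) (3 - 3 * t)) = 3 - 3 * t := by
  constructor
  · rw [sectorMix, min_eq_left (by linarith), max_eq_right zero_le_one]
  · rw [min_eq_right (show 3 - 3 * t ≤ 3 * t by linarith), min_eq_right (by linarith)]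

theorem sector_mid {t : ℝ} (ht : t ∈ Icc (1 / 3 : ℝ) (2 / 3)) :
    sectorMix t = 3 * t - 1 ∧ min 1 (min (3 * t) (3 - 3 * t)) = 1 := by
  constructor
  · rw [sectorMix, min_eq_right (by linarith [ht.2]), max_eq_right (by linarith [ht.1])]
  · exact min_eq_left (le_min (by linarith [ht.1]) (by linarith [ht.2]))

/-- The angular mix determines t on the middle third; on the outer thirds it is 0 or 1, which tells
the sides apart, and the radial factor determines t. -/
theorem sector_param_inj {t t' : ℝ} (h1 : sectorMix t = sectorMix t')
    (h2 : min 1 (min (3 * t) (3 - 3 * t)) = min 1 (min (3 * t') (3 - 3 * t'))) : t = t' := by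
  have cover : ∀ t : ℝ, t ≤ 1 / 3 ∨ t ∈ Icc (1 / 3 : ℝ) (2 / 3) ∨ 2 / 3 ≤ t := fun t => by
    rcases le_total t (1 / 3) with h | h
    · exact Or.inl h
    · rcases le_total t (2 / 3) with h' | h'
      · exact Or.inr (Or.inl ⟨h, h'⟩)
      · exact Or.inr (Or.inr h')
  rcases cover t with h | h | h <;> rcases cover t' with h' | h' | h' <;>
    first
    | rw [(sector_left h).1] at h1
    | rw [(sector_mid h).1] at h1
    | rw [(sector_right h).1] at h1
  all_goals
    first
    | rw [(sector_left h).2] at h2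
    | rw [(sector_mid h).2] at h2
    | rw [(sector_right h).2] at h2
  all_goals
    first
    | rw [(sector_left h').1] at h1
    | rw [(sector_mid h').1] at h1
    | rw [(sector_right h').1] at h1
  all_goals
    first
    | rw [(sector_left h').2] at h2
    | rw [(sector_mid h').2] at h2
    | rw [(sector_right h').2] at h2
  all_goals linarith

theorem sectorLoop_left {x₀ τ : ℂ} {a b : ℝ → ℝ} {s t : ℝ} (ht : t ≤ 1 / 3) :
    sectorLoop x₀ τ a b s t = polarPt x₀ τ (s * (3 * t)) (a (s * (3 * t))) := by
  rw [sectorLoop, sectorRad, (sector_left ht).1, (sector_left ht).2]; simp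

theorem sectorLoop_right {x₀ τ : ℂ} {a b : ℝ → ℝ} {s t : ℝ} (ht : 2 / 3 ≤ t) :
    sectorLoop x₀ τ a b s t = polarPt x₀ τ (s * (3 - 3 * t)) (b (s * (3 - 3 * t))) := by
  rw [sectorLoop, sectorRad, (sector_right ht).1, (sector_right ht).2]; simp

theorem sectorLoop_mid {x₀ τ : ℂ} {a b : ℝ → ℝ} {s t : ℝ} (ht : t ∈ Icc (1 / 3 : ℝ) (2 / 3)) :
    sectorLoop x₀ τ a b s t = polarPt x₀ τ s (a s + (3 * t - 1) * (b s - a s)) := by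
  rw [sectorLoop, sectorRad, (sector_mid ht).1, (sector_mid ht).2, mul_one]; ring_nf

theorem polarPt_zero (x₀ τ : ℂ) (φ : ℝ) : polarPt x₀ τ 0 φ = x₀ := by simp [polarPt]

theorem sectorLoop_closed {x₀ τ : ℂ} {a b : ℝ → ℝ} {s : ℝ} :
    sectorLoop x₀ τ a b s 0 = sectorLoop x₀ τ a b s 1 := by
  rw [sectorLoop_left (by norm_num), sectorLoop_right (by norm_num)]
  simp [polarPt_zero]

theorem continuous_sectorRad : Continuous fun p : ℝ × ℝ => sectorRad p.1 p.2 := by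
  unfold sectorRad; fun_prop

theorem continuous_sectorMix : Continuous sectorMix := by
  unfold sectorMix; fun_prop

theorem continuousOn_sectorLoop {x₀ τ : ℂ} {a b : ℝ → ℝ} {ρ R : ℝ}
    (ha : ContinuousOn a (Ico 0 ρ)) (hb : ContinuousOn b (Ico 0 ρ)) (hR : R < ρ) :
    ContinuousOn (fun p : ℝ × ℝ => sectorLoop x₀ τ a b p.1 p.2) (Icc 0 R ×ˢ Icc 0 1) := by
  have hrad := continuous_sectorRad.continuousOn (s := Icc 0 R ×ˢ Icc (0 : ℝ) 1)
  have hmix : ContinuousOn (fun p : ℝ × ℝ => sectorMix p.2) (Icc 0 R ×ˢ Icc (0 : ℝ) 1) :=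
    (continuous_sectorMix.comp continuous_snd).continuousOn
  have hmaps : MapsTo (fun p : ℝ × ℝ => sectorRad p.1 p.2) (Icc 0 R ×ˢ Icc 0 1) (Ico 0 ρ) :=
    fun p hp =>
      have := sectorRad_mem hp.1.1 hp.2
      ⟨this.1, (this.2.trans hp.1.2).trans_lt hR⟩
  have hang := ((continuousOn_const (c := (1 : ℝ))).sub hmix).mul (ha.comp hrad hmaps) |>.add
    (hmix.mul (hb.comp hrad hmaps))
  refine ((continuous_polarPt x₀ τ).comp_continuousOn (hrad.prodMk hang)).congr fun p _ => ?_
  rw [sectorLoop]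
  rfl

namespace IsBoundarySector

variable {Ω Γ : Set ℂ} {x₀ τ : ℂ} {ρ M : ℝ} {a b : ℝ → ℝ}

theorem angle_bounds (H : IsBoundarySector Ω Γ x₀ τ ρ M a b) {s : ℝ} (hs : s ∈ Ioo 0 ρ) :
    |a s| < 1 / 2 ∧ |b s - Real.pi| < 1 / 2 := by
  have h : 2 * M * s < 1 / 2 := by nlinarith [hs.1, hs.2, H.M_pos, H.small]
  exact ⟨(H.a_le s hs).trans_lt h, (H.b_le s hs).trans_lt h⟩

theorem a_lt_b (H : IsBoundarySector Ω Γ x₀ τ ρ M a b) {s : ℝ} (hs : s ∈ Ioo 0 ρ) :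
    a s < b s := by
  obtain ⟨h1, h2⟩ := H.angle_bounds hs
  rw [abs_lt] at h1 h2
  linarith [Real.pi_gt_three]

theorem Icc_subset (H : IsBoundarySector Ω Γ x₀ τ ρ M a b) {s : ℝ} (hs : s ∈ Ioo 0 ρ) :
    Icc (a s) (b s) ⊆ Ioc (-(Real.pi / 2)) (3 * Real.pi / 2) := by
  obtain ⟨h1, h2⟩ := H.angle_bounds hs
  rw [abs_lt] at h1 h2
  intro φ hφ
  constructor <;> linarith [Real.pi_gt_three, hφ.1, hφ.2]

theorem mem_domain_of_mem_Ioo (H : IsBoundarySector Ω Γ x₀ τ ρ M a b) {s φ : ℝ}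
    (hs : s ∈ Ioo 0 ρ) (hφ : φ ∈ Ioo (a s) (b s)) : polarPt x₀ τ s φ ∈ Ω :=
  (H.mem_domain s hs φ (Ioc_subset_Icc_self (H.Icc_subset hs (Ioo_subset_Icc_self hφ)))).2 hφ

theorem left_mem_curve (H : IsBoundarySector Ω Γ x₀ τ ρ M a b) (hx₀ : x₀ ∈ Γ) {s : ℝ}
    (hs : s ∈ Ico 0 ρ) : polarPt x₀ τ s (a s) ∈ Γ := by
  rcases hs.1.eq_or_lt with rfl | h0
  · rwa [polarPt_zero]
  · have hs' : s ∈ Ioo 0 ρ := ⟨h0, hs.2⟩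
    exact (H.mem_curve s hs' _ (Ioc_subset_Icc_self (H.Icc_subset hs'
      (left_mem_Icc.2 (H.a_lt_b hs').le)))).2 (Or.inl rfl)

theorem right_mem_curve (H : IsBoundarySector Ω Γ x₀ τ ρ M a b) (hx₀ : x₀ ∈ Γ) {s : ℝ}
    (hs : s ∈ Ico 0 ρ) : polarPt x₀ τ s (b s) ∈ Γ := by
  rcases hs.1.eq_or_lt with rfl | h0
  · rwa [polarPt_zero]
  · have hs' : s ∈ Ioo 0 ρ := ⟨h0, hs.2⟩
    exact (H.mem_curve s hs' _ (Ioc_subset_Icc_self (H.Icc_subset hs'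
      (right_mem_Icc.2 (H.a_lt_b hs').le)))).2 (Or.inr rfl)

/-- Points of the open arc are limits of points of Ω on the same ray at smaller radii; the end
points follow by taking the closure of the arc. -/
theorem arc_mem_frontier (H : IsBoundarySector Ω Γ x₀ τ ρ M a b) (hΩ : IsOpen Ω) {R φ : ℝ}
    (hR : R ∈ Ioo 0 ρ) (hφ : φ ∈ Icc (a R) (b R)) :
    polarPt x₀ τ R φ ∈ frontier (omegaBall Ω x₀ R) := by
  have hop : IsOpen (omegaBall Ω x₀ R) := isOpen_ball.inter hΩ
  rw [hop.frontier_eq]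
  refine ⟨?_, fun h => ?_⟩
  · have hIoo : Ioo (a R) (b R) ⊆ polarPt x₀ τ R ⁻¹' closure (omegaBall Ω x₀ R) := by
      intro ψ hψ
      have hc : Continuous fun s : ℝ => polarPt x₀ τ s ψ :=
        (continuous_polarPt x₀ τ).comp (by fun_prop : Continuous fun s : ℝ => (s, ψ))
      refine mem_closure_of_tendsto (f := fun s : ℝ => polarPt x₀ τ s ψ)
        (b := nhdsWithin R (Iio R)) ((hc.tendsto R).mono_left nhdsWithin_le_nhds) ?_
      filter_upwards [self_mem_nhdsWithin, mem_nhdsWithin_of_mem_nhds (lt_mem_nhds hR.1),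
        mem_nhdsWithin_of_mem_nhds (hc.continuousAt.preimage_mem_nhds
          (hΩ.mem_nhds (H.mem_domain_of_mem_Ioo hR hψ)))] with s h1 h2 h3
      exact ⟨polarPt_mem_ball H.norm_eq (le_of_lt h2) h1, h3⟩
    have := closure_minimal hIoo (isClosed_closure.preimage (continuous_polarPt_right x₀ τ R))
    rw [closure_Ioo (H.a_lt_b hR).ne] at this
    exact this hφ
  · have := mem_ball.1 h.1
    rw [dist_polarPt H.norm_eq hR.1.le] at this
    exact lt_irrefl _ this

theorem curve_mem_frontier (hΩ : IsOpen Ω) (hcl : Γ ⊆ closure Ω) (hdis : Disjoint Γ Ω) {R : ℝ}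
    {x : ℂ} (hx : x ∈ Γ) (hxR : x ∈ ball x₀ R) : x ∈ frontier (omegaBall Ω x₀ R) := by
  have hop : IsOpen (omegaBall Ω x₀ R) := isOpen_ball.inter hΩ
  rw [hop.frontier_eq]
  exact ⟨isOpen_ball.inter_closure ⟨hxR, hcl hx⟩, fun h => Set.disjoint_left.1 hdis hx h.2⟩

theorem left_mem_frontier (H : IsBoundarySector Ω Γ x₀ τ ρ M a b) (hΩ : IsOpen Ω)
    (hcl : Γ ⊆ closure Ω) (hdis : Disjoint Γ Ω) (hx₀ : x₀ ∈ Γ) {R s : ℝ} (hR : R ∈ Ioo 0 ρ)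
    (hs : s ∈ Icc 0 R) : polarPt x₀ τ s (a s) ∈ frontier (omegaBall Ω x₀ R) := by
  rcases hs.2.eq_or_lt with rfl | hlt
  · exact H.arc_mem_frontier hΩ hR (left_mem_Icc.2 (H.a_lt_b hR).le)
  · exact curve_mem_frontier hΩ hcl hdis (H.left_mem_curve hx₀ ⟨hs.1, hlt.trans hR.2⟩)
      (polarPt_mem_ball H.norm_eq hs.1 hlt)

theorem right_mem_frontier (H : IsBoundarySector Ω Γ x₀ τ ρ M a b) (hΩ : IsOpen Ω)
    (hcl : Γ ⊆ closure Ω) (hdis : Disjoint Γ Ω) (hx₀ : x₀ ∈ Γ) {R s : ℝ} (hR : R ∈ Ioo 0 ρ)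
    (hs : s ∈ Icc 0 R) : polarPt x₀ τ s (b s) ∈ frontier (omegaBall Ω x₀ R) := by
  rcases hs.2.eq_or_lt with rfl | hlt
  · exact H.arc_mem_frontier hΩ hR (right_mem_Icc.2 (H.a_lt_b hR).le)
  · exact curve_mem_frontier hΩ hcl hdis (H.right_mem_curve hx₀ ⟨hs.1, hlt.trans hR.2⟩)
      (polarPt_mem_ball H.norm_eq hs.1 hlt)

theorem mid_angle_mem (H : IsBoundarySector Ω Γ x₀ τ ρ M a b) {s t : ℝ} (hs : s ∈ Ioo 0 ρ)
    (ht : t ∈ Icc (1 / 3 : ℝ) (2 / 3)) : a s + (3 * t - 1) * (b s - a s) ∈ Icc (a s) (b s) := by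
  have := H.a_lt_b hs
  constructor <;> nlinarith [ht.1, ht.2]

/-- A frontier point at distance R from x₀ lies on the closed arc. A closer one cannot lie in Ω,
hence lies on Γ, at the angle a or b of its radius. -/
theorem image_sectorLoop (H : IsBoundarySector Ω Γ x₀ τ ρ M a b) (hΩ : IsOpen Ω)
    (hcl : Γ ⊆ closure Ω) (hdis : Disjoint Γ Ω) (hx₀ : x₀ ∈ Γ) {R : ℝ} (hR : R ∈ Ioo 0 ρ) :
    sectorLoop x₀ τ a b R '' Icc 0 1 = frontier (omegaBall Ω x₀ R) := by
  have hτ := H.norm_eq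
  refine Subset.antisymm ?_ ?_
  · rintro _ ⟨t, ht, rfl⟩
    by_cases h1 : t ≤ 1 / 3
    · rw [sectorLoop_left h1]
      exact H.left_mem_frontier hΩ hcl hdis hx₀ hR
        ⟨mul_nonneg hR.1.le (by linarith [ht.1]), mul_le_of_le_one_right hR.1.le (by linarith)⟩
    by_cases h2 : 2 / 3 ≤ t
    · rw [sectorLoop_right h2]
      exact H.right_mem_frontier hΩ hcl hdis hx₀ hR
        ⟨mul_nonneg hR.1.le (by linarith [ht.2]), mul_le_of_le_one_right hR.1.le (by linarith)⟩
    · have htm : t ∈ Icc (1 / 3 : ℝ) (2 / 3) := ⟨by linarith, by linarith⟩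
      rw [sectorLoop_mid htm]
      exact H.arc_mem_frontier hΩ hR (H.mid_angle_mem hR htm)
  · intro x hx
    have hop : IsOpen (omegaBall Ω x₀ R) := isOpen_ball.inter hΩ
    rw [hop.frontier_eq] at hx
    have hxR : dist x x₀ ≤ R := by
      have := closure_mono inter_subset_left hx.1
      exact mem_closedBall.1 (closure_ball_subset_closedBall this)
    have hxcl : x ∈ closure Ω := closure_mono inter_subset_right hx.1
    have hmem := H.mem_of_closure x (mem_ball.2 (hxR.trans_lt hR.2)) hxcl
    obtain ⟨φ, hφ, hxφ⟩ := exists_eq_polarPt (x₀ := x₀) hτ x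
    set s := dist x x₀
    rcases (dist_nonneg : 0 ≤ s).eq_or_lt with h0 | h0
    · refine ⟨0, by simp, ?_⟩
      rw [sectorLoop_left (by norm_num), dist_eq_zero.1 h0.symm]
      simp [polarPt_zero]
    · have hs : s ∈ Ioo 0 ρ := ⟨h0, hxR.trans_lt hR.2⟩
      rw [hxφ] at hmem
      rcases hxR.eq_or_lt with hsR | hsR
      · have hφI : φ ∈ Icc (a s) (b s) := by
          rcases hmem with h | h
          · exact Ioo_subset_Icc_self ((H.mem_domain s hs φ hφ).1 h)
          · rcases (H.mem_curve s hs φ hφ).1 h with rfl | rfl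
            · exact left_mem_Icc.2 (H.a_lt_b hs).le
            · exact right_mem_Icc.2 (H.a_lt_b hs).le
        have hab := sub_pos.2 (H.a_lt_b hs)
        have hq0 : 0 ≤ (φ - a s) / (b s - a s) := div_nonneg (by linarith [hφI.1]) hab.le
        have hq1 : (φ - a s) / (b s - a s) ≤ 1 := (div_le_one hab).2 (by linarith [hφI.2])
        refine ⟨(1 + (φ - a s) / (b s - a s)) / 3, ⟨by linarith, by linarith⟩, ?_⟩
        rw [← hsR, sectorLoop_mid ⟨by linarith, by linarith⟩, hxφ]
        congr 1
        field_simp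
        ring
      · have hΓ : φ = a s ∨ φ = b s := by
          rcases hmem with h | h
          · exact (hx.2 ⟨hsR, hxφ ▸ h⟩).elim
          · exact (H.mem_curve s hs φ hφ).1 h
        have hq1 : s / R ≤ 1 := (div_le_one hR.1).2 hxR
        have hq0 : 0 ≤ s / R := div_nonneg h0.le hR.1.le
        have hR0 := hR.1.ne'
        rcases hΓ with rfl | rfl
        · refine ⟨s / R / 3, ⟨by linarith, by linarith⟩, ?_⟩
          have e : R * (3 * (s / R / 3)) = s := by field_simp
          rw [sectorLoop_left (by linarith), e, ← hxφ]
        · refine ⟨1 - s / R / 3, ⟨by linarith, by linarith⟩, ?_⟩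
          have e : R * (3 - 3 * (1 - s / R / 3)) = s := by field_simp; ring
          rw [sectorLoop_right (by linarith), e, ← hxφ]

/-- The distance to x₀ recovers the radial factor. Radius 0 forces t = 0, as t = 1 is excluded;
otherwise the opening is below 2π, so the point determines the angular mix. -/
theorem injOn_sectorLoop (H : IsBoundarySector Ω Γ x₀ τ ρ M a b) {R : ℝ} (hR : R ∈ Ioo 0 ρ) :
    InjOn (sectorLoop x₀ τ a b R) (Ico 0 1) := by
  have hτ := H.norm_eq
  have hmix : ∀ t, sectorMix t ∈ Icc (0 : ℝ) 1 := fun t =>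
    ⟨le_max_left _ _, max_le zero_le_one (min_le_left _ _)⟩
  intro t ht t' ht' he
  have hm := sectorRad_mem hR.1.le ⟨ht.1, ht.2.le⟩
  have hm' := sectorRad_mem hR.1.le ⟨ht'.1, ht'.2.le⟩
  have hrad : sectorRad R t = sectorRad R t' := by
    have := congrArg (fun z => dist z x₀) he
    simpa only [sectorLoop, dist_polarPt hτ hm.1, dist_polarPt hτ hm'.1] using this
  have hmin : min 1 (min (3 * t) (3 - 3 * t)) = min 1 (min (3 * t') (3 - 3 * t')) :=
    mul_left_cancel₀ hR.1.ne' hrad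
  rcases hm.1.eq_or_lt with h0 | h0
  · have h1 : ∀ y : ℝ, y ∈ Ico (0 : ℝ) 1 → 0 = sectorRad R y → y = 0 := by
      intro y hy h
      have := (mul_eq_zero.1 h.symm).resolve_left hR.1.ne'
      rcases min_choice 1 (min (3 * y) (3 - 3 * y)) with e | e
      · linarith
      · rcases min_choice (3 * y) (3 - 3 * y) with e' | e' <;> linarith [hy.2]
    rw [h1 t ht h0, h1 t' ht' (h0.trans hrad)]
  · set s := sectorRad R t
    have hs : s ∈ Ioo 0 ρ := ⟨h0, hm.2.trans_lt hR.2⟩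
    have hab := H.a_lt_b hs
    have hbd := H.angle_bounds hs
    rw [sectorLoop, sectorLoop, ← hrad] at he
    have hang := polarPt_inj hτ h0 (by
      have e : ((1 - sectorMix t) * a s + sectorMix t * b s) -
          ((1 - sectorMix t') * a s + sectorMix t' * b s)
          = (sectorMix t - sectorMix t') * (b s - a s) := by ring
      rw [e, abs_mul, abs_of_pos (sub_pos.2 hab)]
      have h1 : |sectorMix t - sectorMix t'| ≤ 1 := by
        rw [abs_le]
        constructor <;> linarith [(hmix t).1, (hmix t).2, (hmix t').1, (hmix t').2]
      have h2 := (abs_lt.1 hbd.1).1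
      have h3 := (abs_lt.1 hbd.2).2
      have := mul_le_of_le_one_left (sub_pos.2 hab).le h1
      linarith [Real.pi_gt_three]) he
    have hmx : sectorMix t = sectorMix t' := by
      have e : (sectorMix t - sectorMix t') * (b s - a s) = 0 := by linarith
      rcases mul_eq_zero.1 e with h | h <;> linarith
    exact sector_param_inj hmx hmin

end IsBoundarySector

/-! ### Degree and phase on the boundary arc -/

/-- The degree along another simple closed parametrization, up to a nonzero factor. -/
theorem exists_degree_of_same_image {c c₀ : ℝ → ℂ} {J : Set ℂ} {w : ℂ → ℂ} {z₀ : ℂ} {D : ℤ}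
    (hc : ContinuousOn c (Icc 0 1)) (hcl : c 0 = c 1) (hinj : InjOn c (Ico 0 1))
    (him : c '' Icc 0 1 = J)
    (hc₀ : ContinuousOn c₀ (Icc 0 1)) (hcl₀ : c₀ 0 = c₀ 1) (hinj₀ : InjOn c₀ (Ico 0 1))
    (him₀ : c₀ '' Icc 0 1 = J) (hw : ContinuousOn w J)
    (hz : HasDegree (fun t => c t - z₀) 1) (hD : HasDegree (fun t => w (c t)) D) :
    ∃ D' : ℤ, |D| ≤ |D'| ∧ HasDegree (fun t => w (c₀ t)) D' := by
  have hmem₀ : ∀ t ∈ Icc (0 : ℝ) 1, c₀ t ∈ J := fun t ht => him₀ ▸ mem_image_of_mem c₀ ht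
  have hne : ∀ x ∈ J, w x ≠ 0 ∧ x - z₀ ≠ 0 := by
    intro x hx
    rw [← him] at hx
    obtain ⟨t, ht, rfl⟩ := hx
    obtain ⟨_, -, h1, -⟩ := hD
    obtain ⟨_, -, h2, -⟩ := hz
    exact ⟨(h1 t ht).1, (h2 t ht).1⟩
  obtain ⟨D', hD'⟩ := exists_hasDegree (v := fun t => w (c₀ t)) (hw.comp hc₀ hmem₀)
    (fun t ht => (hne _ (hmem₀ t ht)).1) (by simp only [hcl₀])
  obtain ⟨m, hm⟩ := exists_hasDegree (v := fun t => c₀ t - z₀) (hc₀.sub continuousOn_const)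
    (fun t ht => (hne _ (hmem₀ t ht)).2) (by simp only [hcl₀])
  -- If c₀ had winding number 0 about z₀, so would every closed curve in its image, including c,
  -- whose winding number is 1.
  have hm0 : m ≠ 0 := by
    rintro rfl
    have h := HasDegree.zero_of_simple_closed (f := fun z => z - z₀) hc₀ hinj₀ hcl₀ hc hcl
      (by rw [him, him₀]) hm
    exact one_ne_zero (HasDegree.unique hz h)
  have comb : ∀ {e : ℝ → ℂ} {p q : ℤ}, HasDegree (fun t => w (e t)) p →
      HasDegree (fun t => e t - z₀) q →
      HasDegree (fun t => (fun z => w z * (z - z₀) ^ (-D)) (e t)) (p - D * q) := by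
    intro e p q hp hq
    rw [hasDegree_iff] at hp hq ⊢
    obtain ⟨θ, h1, h2⟩ := hp
    obtain ⟨χ, h3, h4⟩ := hq
    refine ⟨_, h1.mul (h3.zpow (-D)), ?_⟩
    push_cast
    linear_combination h2 - (D : ℝ) * h4
  -- The map w(z)(z - z₀)^(-D) has degree D - D·1 = 0 along c, hence also along c₀, where its degree
  -- is D' - Dm. Thus D' = Dm with m ≠ 0, without determining the orientation of c₀.
  have h0 := comb hD hz
  rw [mul_one, sub_self] at h0
  have h1 := HasDegree.zero_of_simple_closed (f := fun z => w z * (z - z₀) ^ (-D)) hc hinj hcl hc₀ hcl₀ (by rw [him, him₀]) h0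
  have h2 := HasDegree.unique (comb hD' hm) h1
  refine ⟨D', ?_, hD'⟩
  have : D' = D * m := by linarith
  rw [this, abs_mul]
  exact le_mul_of_one_le_right (abs_nonneg _) (Int.one_le_abs hm0)

/-- Here Re z ≥ 1/4, so |sin arg z| = |Im z|/|z| ≤ 4|z - 1|, and |arg z| ≤ (π/2)|sin arg z| in the
right half plane. -/
theorem abs_arg_le_of_norm_sub_one_le {z : ℂ} (h : ‖z - 1‖ ≤ 3 / 4) :
    |z.arg| ≤ 2 * Real.pi * ‖z - 1‖ := by
  have hre : 1 / 4 ≤ z.re := by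
    have := (abs_le.1 ((Complex.abs_re_le_norm (z - 1)).trans h)).1
    simp at this
    linarith
  have hn : 1 / 4 ≤ ‖z‖ := hre.trans (Complex.re_le_norm z)
  have h1 : |z.arg| ≤ Real.pi / 2 := Complex.abs_arg_le_pi_div_two_iff.2 (by linarith)
  have h2 := Real.mul_abs_le_abs_sin h1
  have h3 : |z.im| ≤ ‖z - 1‖ := by
    have := Complex.abs_im_le_norm (z - 1)
    simpa using this
  rw [Complex.sin_arg, abs_div, abs_norm] at h2
  have h4 : |z.im| / ‖z‖ ≤ 4 * ‖z - 1‖ := by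
    rw [div_le_iff₀ (by linarith)]
    nlinarith [norm_nonneg (z - 1)]
  have h5 := h2.trans h4
  rw [div_mul_eq_mul_div, div_le_iff₀ Real.pi_pos] at h5
  linarith

/-- The near part is ε^α/r ≤ 1/κ; the tail is ε^(α-γ)(1 + |ln ε|), bounded since γ < α. -/
theorem lintegral_boundary_error_le {ε α γ κ r R : ℝ} (hε : 0 < ε) (hε1 : ε < 1) (hγ : γ < α)
    (hκ : 0 < κ) (hr : κ * ε ^ α ≤ r) :
    ∫⁻ s in Ioo r R, ENNReal.ofReal (ε ^ α / scaleWeight ε γ s * s ^ (-2 : ℝ)) ≤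
      ENNReal.ofReal (1 / κ + (1 + 1 / (α - γ))) := by
  have hεα : 0 < ε ^ α := Real.rpow_pos_of_pos hε α
  have hr0 : 0 < r := (mul_pos hκ hεα).trans_le hr
  refine (lintegral_inv_scaleWeight_le hε hr0 hεα.le (by norm_num)).trans
    (ENNReal.ofReal_le_ofReal ?_)
  have e1 : r ^ ((1 : ℝ) - 2) = r⁻¹ := by
    rw [show (1 : ℝ) - 2 = -1 by norm_num, Real.rpow_neg_one]
  have e2 : ε ^ α * (1 + |Real.log ε|) * (ε ^ γ) ^ ((1 : ℝ) - 2)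
      = ε ^ (α - γ) * (1 + |Real.log ε|) := by
    rw [← Real.rpow_mul hε.le, mul_right_comm, ← Real.rpow_add hε]
    congr 2
    ring
  rw [e1, e2]
  have h1 := rpow_mul_one_add_abs_log_le hε hε1 (show 0 < α - γ by linarith)
  have h2 : ε ^ α * r⁻¹ ≤ 1 / κ := by
    rw [← div_eq_mul_inv, div_le_div_iff₀ hr0 hκ, one_mul, mul_comm]
    exact hr
  norm_num only
  simp only [div_one]
  linarith

/-- On each circle around a boundary point, the phase of `u` increases along the arc in `Ω` by
almost `2π` times the degree. -/
theorem IsBoundarySector.exists_phase_on_arc {Ω Γ : Set ℂ} {x₀ τ : ℂ} {ρ M : ℝ} {a b : ℝ → ℝ}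
    (H : IsBoundarySector Ω Γ x₀ τ ρ M a b) (hΩ : IsOpen Ω)
    (hcl : Γ ⊆ closure Ω) (hdis : Disjoint Γ Ω) (hx₀ : x₀ ∈ Γ) {g u w : ℂ → ℂ} {r R L : ℝ}
    (hu : ContinuousOn u (closure Ω)) (hr : 0 < r) (hRρ : R < ρ)
    (hA : ∀ x ∈ annulusIn Ω x₀ r R, 1 / 2 ≤ ‖u x‖ ∧ ‖u x‖ ≤ 1)
    (hw : ContinuousOn w (frontier (omegaBall Ω x₀ R)))
    (hwu : ∀ x ∈ frontier (omegaBall Ω x₀ R), r ≤ dist x x₀ → w x = u x)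
    (hwg : ∀ x ∈ Γ ∩ ball x₀ R, ‖w x - g x‖ ≤ 1 / 2) (hg1 : ‖g x₀‖ = 1)
    (hgL : ∀ x ∈ Γ ∩ ball x₀ R, ‖g x - g x₀‖ ≤ L * dist x x₀) (hL0 : 0 ≤ L) (hL : L * R ≤ 1 / 4)
    {D : ℤ} (hD : HasDegree (fun t => w (sectorLoop x₀ τ a b R t)) D) {s : ℝ}
    (hs : s ∈ Ioo r R) :
    ∃ θ : ℝ → ℝ, IsPhase (fun φ => u (polarPt x₀ τ s φ)) θ (Icc (a s) (b s)) ∧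
      2 * Real.pi * |(D : ℝ)| - 2 * Real.pi *
        (‖u (polarPt x₀ τ s (a s)) - g (polarPt x₀ τ s (a s))‖ +
          ‖u (polarPt x₀ τ s (b s)) - g (polarPt x₀ τ s (b s))‖ + 2 * L * s) ≤
        |θ (b s) - θ (a s)| := by
  classical
  have hpi := Real.pi_pos
  have hτ := H.norm_eq
  have hs0 : 0 < s := hr.trans hs.1
  have hR : R ∈ Ioo 0 ρ := ⟨hs0.trans hs.2, hRρ⟩
  have hsρ : s ∈ Ioo 0 ρ := ⟨hs0, hs.2.trans hRρ⟩
  set J := frontier (omegaBall Ω x₀ R)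
  set e : ℝ → ℝ → ℂ := sectorLoop x₀ τ a b
  have he : ContinuousOn (fun p : ℝ × ℝ => e p.1 p.2) (Icc 0 R ×ˢ Icc 0 1) :=
    continuousOn_sectorLoop H.cont_a H.cont_b hRρ
  have heJ : e R '' Icc 0 1 = J := H.image_sectorLoop hΩ hcl hdis hx₀ hR
  have hwne : ∀ x ∈ J, w x ≠ 0 := by
    intro x hx
    rw [← heJ] at hx
    obtain ⟨t, ht, rfl⟩ := hx
    obtain ⟨_, -, h1, -⟩ := hD
    exact (h1 t ht).1
  have hleft : ∀ s' ∈ Icc s R, ∀ t ∈ Icc (0 : ℝ) (1 / 3), e s' t ∈ J := by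
    intro s' hs' t ht
    simp only [e]
    rw [sectorLoop_left ht.2]
    have hs'0 := hs0.le.trans hs'.1
    exact H.left_mem_frontier hΩ hcl hdis hx₀ hR ⟨mul_nonneg hs'0 (by linarith [ht.1]),
      (mul_le_of_le_one_right hs'0 (by linarith [ht.2])).trans hs'.2⟩
  have hright : ∀ s' ∈ Icc s R, ∀ t ∈ Icc (2 / 3 : ℝ) 1, e s' t ∈ J := by
    intro s' hs' t ht
    simp only [e]
    rw [sectorLoop_right ht.1]
    have hs'0 := hs0.le.trans hs'.1
    exact H.right_mem_frontier hΩ hcl hdis hx₀ hR ⟨mul_nonneg hs'0 (by linarith [ht.2]),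
      (mul_le_of_le_one_right hs'0 (by linarith [ht.1])).trans hs'.2⟩
  have hdistmid : ∀ s' ∈ Icc s R, ∀ t ∈ Icc (1 / 3 : ℝ) (2 / 3), dist (e s' t) x₀ = s' := by
    intro s' hs' t ht
    simp only [e]
    rw [sectorLoop_mid ht, dist_polarPt hτ (hs0.le.trans hs'.1)]
  have hmidcl : ∀ s' ∈ Icc s R, ∀ t ∈ Icc (1 / 3 : ℝ) (2 / 3), e s' t ∈ closure Ω := by
    intro s' hs' t ht
    have hs'ρ : s' ∈ Ioo 0 ρ := ⟨hs0.trans_le hs'.1, hs'.2.trans_lt hRρ⟩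
    simp only [e]
    rw [sectorLoop_mid ht]
    exact closure_mono inter_subset_right
      (frontier_subset_closure (H.arc_mem_frontier hΩ hs'ρ (H.mid_angle_mem hs'ρ ht)))
  -- The map w lives only on ∂ω_R. For smaller radii the arc carries u and the two sides, which stay
  -- on ∂ω_R, carry w; at the corners both agree because w = u at distance at least r.
  set F : ℝ → ℝ → ℂ := fun s' t =>
    if t ∈ Icc (1 / 3 : ℝ) (2 / 3) then u (e s' t) else w (e s' t)
  have hFmid : ∀ s', ∀ t ∈ Icc (1 / 3 : ℝ) (2 / 3), F s' t = u (e s' t) := fun s' t ht => if_pos ht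
  have hFleft : ∀ s' ∈ Icc s R, ∀ t ∈ Icc (0 : ℝ) (1 / 3), F s' t = w (e s' t) := by
    intro s' hs' t ht
    by_cases h : t ∈ Icc (1 / 3 : ℝ) (2 / 3)
    · rw [hFmid s' t h, hwu _ (hleft s' hs' t ht)
        (by rw [hdistmid s' hs' t h]; exact hs.1.le.trans hs'.1)]
    · exact if_neg h
  have hFright : ∀ s' ∈ Icc s R, ∀ t ∈ Icc (2 / 3 : ℝ) 1, F s' t = w (e s' t) := by
    intro s' hs' t ht
    by_cases h : t ∈ Icc (1 / 3 : ℝ) (2 / 3)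
    · rw [hFmid s' t h, hwu _ (hright s' hs' t ht)
        (by rw [hdistmid s' hs' t h]; exact hs.1.le.trans hs'.1)]
    · exact if_neg h
  have hcover : ∀ t ∈ Icc (0 : ℝ) 1,
      t ∈ Icc (0 : ℝ) (1 / 3) ∨ t ∈ Icc (1 / 3 : ℝ) (2 / 3) ∨ t ∈ Icc (2 / 3 : ℝ) 1 := by
    intro t ht
    rcases le_total t (1 / 3) with h | h
    · exact Or.inl ⟨ht.1, h⟩
    · rcases le_total t (2 / 3) with h' | h'
      · exact Or.inr (Or.inl ⟨h, h'⟩)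
      · exact Or.inr (Or.inr ⟨h', ht.2⟩)
  have hFc : ContinuousOn (fun p : ℝ × ℝ => F p.1 p.2) (Icc s R ×ˢ Icc 0 1) := by
    have c1 : ContinuousOn (fun p : ℝ × ℝ => F p.1 p.2) (Icc s R ×ˢ Icc 0 (1 / 3)) :=
      (hw.comp (he.mono (prod_mono (Icc_subset_Icc_left hs0.le)
        (Icc_subset_Icc_right (by norm_num)))) fun p hp => hleft _ hp.1 _ hp.2).congr
        fun p hp => hFleft _ hp.1 _ hp.2
    have c2 : ContinuousOn (fun p : ℝ × ℝ => F p.1 p.2) (Icc s R ×ˢ Icc (1 / 3) (2 / 3)) :=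
      (hu.comp (he.mono (prod_mono (Icc_subset_Icc_left hs0.le)
        (Icc_subset_Icc (by norm_num) (by norm_num)))) fun p hp => hmidcl _ hp.1 _ hp.2).congr
        fun p hp => hFmid _ _ hp.2
    have c3 : ContinuousOn (fun p : ℝ × ℝ => F p.1 p.2) (Icc s R ×ˢ Icc (2 / 3) 1) :=
      (hw.comp (he.mono (prod_mono (Icc_subset_Icc_left hs0.le)
        (Icc_subset_Icc_left (by norm_num)))) fun p hp => hright _ hp.1 _ hp.2).congr
        fun p hp => hFright _ hp.1 _ hp.2
    have hc : ∀ p q : ℝ, IsClosed (Icc s R ×ˢ Icc p q) := fun p q => isClosed_Icc.prod isClosed_Icc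
    refine ((c1.union_of_isClosed c2 (hc _ _) (hc _ _)).union_of_isClosed c3
      ((hc _ _).union (hc _ _)) (hc _ _)).mono fun p hp => ?_
    rcases hcover p.2 hp.2 with h | h | h
    · exact Or.inl (Or.inl ⟨hp.1, h⟩)
    · exact Or.inl (Or.inr ⟨hp.1, h⟩)
    · exact Or.inr ⟨hp.1, h⟩
  have hFne : ∀ s' ∈ Icc s R, ∀ t ∈ Icc (0 : ℝ) 1, F s' t ≠ 0 := by
    intro s' hs' t ht
    rcases hcover t ht with h | h | h
    · rw [hFleft s' hs' t h]; exact hwne _ (hleft s' hs' t h)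
    · have hrs : r ≤ s' := hs.1.le.trans hs'.1
      rw [hFmid s' t h]
      by_cases hJ : e s' t ∈ J
      · rw [← hwu _ hJ (by rw [hdistmid s' hs' t h]; exact hrs)]
        exact hwne _ hJ
      · have hs'ρ : s' ∈ Ioo 0 ρ := ⟨hs0.trans_le hs'.1, hs'.2.trans_lt hRρ⟩
        have hsR : s' < R := by
          refine lt_of_le_of_ne hs'.2 ?_
          rintro rfl
          exact hJ (heJ ▸ mem_image_of_mem _ ht)
        have hxΩ : e s' t ∈ Ω := by
          refine (H.mem_of_closure _ ?_ (hmidcl s' hs' t h)).resolve_right fun hΓ => hJ ?_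
          · rw [mem_ball, hdistmid s' hs' t h]; exact hs'ρ.2
          · exact IsBoundarySector.curve_mem_frontier hΩ hcl hdis hΓ
              (by rw [mem_ball, hdistmid s' hs' t h]; exact hsR)
        have := (hA _ (mem_annulusIn.2 ⟨hxΩ, by rw [hdistmid s' hs' t h]; exact hrs,
          by rw [hdistmid s' hs' t h]; exact hsR⟩)).1
        intro h0
        rw [h0, norm_zero] at this
        norm_num at this
    · rw [hFright s' hs' t h]; exact hwne _ (hright s' hs' t h)
  have hsI : s ∈ Icc s R := left_mem_Icc.2 hs.2.le
  have hRI : R ∈ Icc s R := right_mem_Icc.2 hs.2.le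
  have hFR : HasDegree (F R) D := by
    rw [hasDegree_iff] at hD ⊢
    obtain ⟨θ, h1, h2⟩ := hD
    refine ⟨θ, h1.congr fun t ht => ?_, h2⟩
    rcases hcover t ht with h | h | h
    · exact hFleft R hRI t h
    · rw [hFmid R t h]
      exact (hwu _ (heJ ▸ mem_image_of_mem _ ht)
        (by rw [hdistmid R hRI t h]; exact hs.1.le.trans hs.2.le)).symm
    · exact hFright R hRI t h
  have hclosed : ∀ s' ∈ Icc s R, F s' 0 = F s' 1 := by
    intro s' hs'
    rw [hFleft s' hs' 0 (by norm_num), hFright s' hs' 1 (by norm_num)]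
    exact congrArg w sectorLoop_closed
  obtain ⟨θ, hθ, hθD⟩ := hasDegree_iff.1 (HasDegree.homotopy hFc hFne hclosed hRI hsI hFR)
  -- the two sides of the sector, where `w` is close to `g x₀`
  have hg0 : g x₀ ≠ 0 := norm_pos_iff.1 (by rw [hg1]; norm_num)
  -- 3/4 is 1/2 from |w - g| plus 1/4 from LR.
  have hclose : ∀ x ∈ Γ ∩ ball x₀ R, ‖w x / g x₀ - 1‖ ≤ 3 / 4 := by
    intro x hx
    have e1 : w x / g x₀ - 1 = (w x - g x₀) / g x₀ := by field_simp
    rw [e1, norm_div, hg1, div_one]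
    have h1 : ‖w x - g x₀‖ ≤ ‖w x - g x‖ + ‖g x - g x₀‖ := norm_sub_le_norm_sub_add_norm_sub _ _ _
    have h2 : L * dist x x₀ ≤ L * R := mul_le_mul_of_nonneg_left (mem_ball.1 hx.2).le hL0
    linarith [hwg x hx, hgL x hx]
  -- Along a side w/g(x₀) stays in the slit plane, so the phase changes by the difference of
  -- principal arguments, without winding.
  have hphase : ∀ p q : ℝ, (∀ t ∈ Icc p q, e s t ∈ J ∧ e s t ∈ Γ ∩ ball x₀ R ∧
      F s t = w (e s t)) → p ≤ q → Icc p q ⊆ Icc 0 1 →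
      θ q - θ p = (w (e s q) / g x₀).arg - (w (e s p) / g x₀).arg := by
    intro p q hpq hle hsub
    have hce : ContinuousOn (fun t => e s t) (Icc p q) :=
      he.comp (f := fun t : ℝ => (s, t)) (by fun_prop) fun t ht => ⟨⟨hs0.le, hs.2.le⟩, hsub ht⟩
    have hwc : ContinuousOn (fun t => w (e s t) / g x₀) (Icc p q) :=
      (hw.comp hce fun t ht => (hpq t ht).1).div_const _
    have h1 : IsPhase (fun t => w (e s t) / g x₀) (fun t => (w (e s t) / g x₀).arg) (Icc p q) :=
      isPhase_arg hwc fun t ht => mem_slitPlane_of_norm_sub_one_lt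
        ((hclose _ (hpq t ht).2.1).trans_lt (by norm_num))
    have h2 : IsPhase (fun _ : ℝ => g x₀) (fun _ => (g x₀).arg) (Icc p q) :=
      ⟨continuousOn_const, fun t _ => ⟨hg0, div_norm_eq_exp_arg hg0⟩⟩
    have h3 : IsPhase (F s) (fun t => (w (e s t) / g x₀).arg + (g x₀).arg) (Icc p q) :=
      (h1.mul h2).congr fun t ht => by
        rw [(hpq t ht).2.2]
        field_simp
    have := (hθ.mono hsub).sub_eq_sub hle h3
    linarith
  have hmemball : ∀ s' ∈ Icc 0 s, ∀ φ, polarPt x₀ τ s' φ ∈ ball x₀ R := fun s' hs' φ =>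
    polarPt_mem_ball hτ hs'.1 (hs'.2.trans_lt hs.2)
  have hI1 := hphase 0 (1 / 3) (fun t ht => by
    refine ⟨hleft s hsI t ht, ?_, hFleft s hsI t ht⟩
    simp only [e]
    rw [sectorLoop_left ht.2]
    have hm : s * (3 * t) ∈ Icc 0 s := ⟨mul_nonneg hs0.le (by linarith [ht.1]),
      mul_le_of_le_one_right hs0.le (by linarith [ht.2])⟩
    exact ⟨H.left_mem_curve hx₀ ⟨hm.1, hm.2.trans_lt hsρ.2⟩, hmemball _ hm _⟩) (by norm_num)
    (Icc_subset_Icc_right (by norm_num))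
  have hI3 := hphase (2 / 3) 1 (fun t ht => by
    refine ⟨hright s hsI t ht, ?_, hFright s hsI t ht⟩
    simp only [e]
    rw [sectorLoop_right ht.1]
    have hm : s * (3 - 3 * t) ∈ Icc 0 s := ⟨mul_nonneg hs0.le (by linarith [ht.2]),
      mul_le_of_le_one_right hs0.le (by linarith [ht.1])⟩
    exact ⟨H.right_mem_curve hx₀ ⟨hm.1, hm.2.trans_lt hsρ.2⟩, hmemball _ hm _⟩) (by norm_num)
    (Icc_subset_Icc_left (by norm_num))
  have e13 : e s (1 / 3) = polarPt x₀ τ s (a s) := by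
    simp only [e]; rw [sectorLoop_left le_rfl]; norm_num
  have e23 : e s (2 / 3) = polarPt x₀ τ s (b s) := by
    simp only [e]; rw [sectorLoop_right le_rfl]; norm_num
  have e01 : e s 1 = e s 0 := sectorLoop_closed.symm
  rw [e13] at hI1
  rw [e23, e01] at hI3
  -- At the end points of the arc w equals u, so the argument is controlled by the actual defect |u
  -- - g| and not merely by 1/2.
  have hendpoint : ∀ x ∈ Γ ∩ ball x₀ R, dist x x₀ = s → x ∈ J →
      |(w x / g x₀).arg| ≤ 2 * Real.pi * (‖u x - g x‖ + L * s) := by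
    intro x hx hxs hxJ
    refine (abs_arg_le_of_norm_sub_one_le (hclose x hx)).trans ?_
    refine mul_le_mul_of_nonneg_left ?_ (by positivity)
    have e1 : w x / g x₀ - 1 = (u x - g x₀) / g x₀ := by
      rw [hwu x hxJ (by rw [hxs]; exact hs.1.le)]; field_simp
    rw [e1, norm_div, hg1, div_one]
    refine (norm_sub_le_norm_sub_add_norm_sub _ (g x) _).trans ?_
    have := hgL x hx
    rw [hxs] at this
    linarith
  have hsIcc : s ∈ Icc 0 s := ⟨hs0.le, le_rfl⟩
  have hsIco : s ∈ Ico 0 ρ := ⟨hs0.le, hsρ.2⟩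
  have hba := hendpoint _ ⟨H.left_mem_curve hx₀ hsIco, hmemball s hsIcc _⟩
    (dist_polarPt hτ hs0.le) (H.left_mem_frontier hΩ hcl hdis hx₀ hR ⟨hs0.le, hs.2.le⟩)
  have hbb := hendpoint _ ⟨H.right_mem_curve hx₀ hsIco, hmemball s hsIcc _⟩
    (dist_polarPt hτ hs0.le) (H.right_mem_frontier hΩ hcl hdis hx₀ hR ⟨hs0.le, hs.2.le⟩)
  have hab := sub_pos.2 (H.a_lt_b hsρ)
  refine ⟨fun φ => θ ((1 + (φ - a s) / (b s - a s)) / 3), ?_, ?_⟩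
  · have hmem : ∀ φ ∈ Icc (a s) (b s),
        (1 + (φ - a s) / (b s - a s)) / 3 ∈ Icc (1 / 3 : ℝ) (2 / 3) := by
      intro φ hφ
      have hq0 : 0 ≤ (φ - a s) / (b s - a s) := div_nonneg (by linarith [hφ.1]) hab.le
      have hq1 : (φ - a s) / (b s - a s) ≤ 1 := (div_le_one hab).2 (by linarith [hφ.2])
      constructor <;> linarith
    have hmem' : ∀ φ ∈ Icc (a s) (b s),
        (1 + (φ - a s) / (b s - a s)) / 3 ∈ Icc (0 : ℝ) 1 := fun φ hφ =>
      Icc_subset_Icc (by norm_num) (by norm_num) (hmem φ hφ)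
    refine ⟨hθ.1.comp (by fun_prop) hmem', fun φ hφ => ?_⟩
    have h1 := hθ.2 _ (hmem' φ hφ)
    have e1 : F s ((1 + (φ - a s) / (b s - a s)) / 3) = u (polarPt x₀ τ s φ) := by
      rw [hFmid s _ (hmem φ hφ)]
      simp only [e]
      rw [sectorLoop_mid (hmem φ hφ)]
      congr 2
      field_simp
      ring
    rwa [e1] at h1
  · have e1 : (1 + (b s - a s) / (b s - a s)) / 3 = 2 / 3 := by
      rw [div_self hab.ne']; norm_num
    have e2 : (1 + (a s - a s) / (b s - a s)) / 3 = 1 / 3 := by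
      rw [sub_self, zero_div]; norm_num
    simp only [e1, e2]
    -- The whole loop gives 2πD'-type winding with D the degree of this loop; the contributions of
    -- the two sides at x₀ cancel, leaving only the arguments at the ends of the arc.
    have hΔ : θ (2 / 3) - θ (1 / 3) = 2 * Real.pi * D -
        ((w (polarPt x₀ τ s (a s)) / g x₀).arg - (w (polarPt x₀ τ s (b s)) / g x₀).arg) := by
      linarith
    have h3 := abs_sub (w (polarPt x₀ τ s (a s)) / g x₀).arg (w (polarPt x₀ τ s (b s)) / g x₀).arg
    have h4 : |2 * Real.pi * (D : ℝ)| = 2 * Real.pi * |(D : ℝ)| := by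
      rw [abs_mul, abs_of_pos (show 0 < 2 * Real.pi by positivity)]
    have h5 := abs_sub_abs_le_abs_sub (2 * Real.pi * (D : ℝ))
      ((w (polarPt x₀ τ s (a s)) / g x₀).arg - (w (polarPt x₀ τ s (b s)) / g x₀).arg)
    rw [hΔ]
    rw [h4] at h5
    nlinarith

/-! ### The boundary estimate -/

theorem ofReal_le_of_le_sub {A X Y E : ℝ} {I : ℝ≥0∞} (hY : 0 ≤ Y)
    (h : ENNReal.ofReal X ≤ I + ENNReal.ofReal Y) (hA : A ≤ X - Y + E) :
    ENNReal.ofReal A ≤ I + ENNReal.ofReal E := by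
  refine (ENNReal.ofReal_le_ofReal hA).trans (ENNReal.ofReal_add_le.trans ?_)
  refine add_le_add ?_ le_rfl
  rw [ENNReal.ofReal_sub _ hY]
  exact tsub_le_iff_right.2 h

theorem ofReal_linear_combination {p₁ x₁ p₂ x₂ p₃ x₃ p₄ x₄ : ℝ} (hp₁ : 0 ≤ p₁) (hx₁ : 0 ≤ x₁)
    (hp₂ : 0 ≤ p₂) (hx₂ : 0 ≤ x₂) (hp₃ : 0 ≤ p₃) (hx₃ : 0 ≤ x₃) (hp₄ : 0 ≤ p₄) (hx₄ : 0 ≤ x₄) :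
    ENNReal.ofReal (p₁ * x₁ + p₂ * x₂ + p₃ * (2 * x₃) + p₄ * x₄) =
      ENNReal.ofReal p₁ * ENNReal.ofReal x₁ + ENNReal.ofReal p₂ * ENNReal.ofReal x₂ +
      ENNReal.ofReal p₃ * (ENNReal.ofReal x₃ + ENNReal.ofReal x₃) +
      ENNReal.ofReal p₄ * ENNReal.ofReal x₄ := by
  rw [← ENNReal.ofReal_add hx₃ hx₃, ← ENNReal.ofReal_mul hp₁, ← ENNReal.ofReal_mul hp₂,
    ← ENNReal.ofReal_mul hp₃, ← ENNReal.ofReal_mul hp₄,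
    ← ENNReal.ofReal_add (by positivity) (by positivity),
    ← ENNReal.ofReal_add (by positivity) (by positivity),
    ← ENNReal.ofReal_add (by positivity) (by positivity), two_mul x₃]

theorem continuousOn_polarPt_comp (x₀ τ : ℂ) {f g : ℝ → ℝ} {s : Set ℝ} (hf : ContinuousOn f s)
    (hg : ContinuousOn g s) : ContinuousOn (fun x => polarPt x₀ τ (f x) (g x)) s := by
  unfold polarPt; fun_prop

-- The calibration is k = 2δ with δ = |D|: phase term 4πδ²/s, loss 2πδ²/s over a half circle. The
-- excess opening 4Ms costs 8Mδ² and the variation of g costs 8πδL, both constant in s and hence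
-- integrated to at most a multiple of ρ. The endpoint defects go into the boundary penalty.
set_option maxHeartbeats 600000 in
theorem boundary_lower_bound {Ω Γ S : Set ℂ} {x₀ τ : ℂ} {ρ M : ℝ} {a b : ℝ → ℝ}
    (H : IsBoundarySector Ω Γ x₀ τ ρ M a b) (hΩ : IsOpen Ω) (hΓ : IsClosed Γ)
    (hcl : Γ ⊆ closure Ω) (hdis : Disjoint Γ Ω) (hx₀ : x₀ ∈ Γ) {g u : ℂ → ℂ}
    (hu : IsAdmissible Ω S u) (hg : ContinuousOn g Γ)
    {ε α γ K κ C₁ C₂ r R L : ℝ} (hε : 0 < ε) (hε1 : ε < 1) (hα1 : α ≤ 1)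
    (hγ : γ < α) (hK : 0 < K) (hκ : 0 < κ) (hr : κ * ε ^ α ≤ r) (hrR : r < R) (hRρ : R < ρ)
    (hA : ∀ x ∈ annulusIn Ω x₀ r R, 1 / 2 ≤ ‖u x‖ ∧ ‖u x‖ ≤ 1)
    (hE : energy Ω Γ g ε (K * ε ^ (-α)) u ≤ ENNReal.ofReal (C₁ * |Real.log ε|))
    (hP : localPenalty Ω Γ g ε (K * ε ^ (-α)) u x₀ (ε ^ γ) ≤ ENNReal.ofReal C₂)
    (hg1 : ‖g x₀‖ = 1) (hgL : ∀ x ∈ Γ ∩ ball x₀ R, ‖g x - g x₀‖ ≤ L * dist x x₀) (hL0 : 0 ≤ L)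
    (hL : L * R ≤ 1 / 4) {D : ℤ} (hD : HasBoundaryDegree Ω Γ g u x₀ r R D) :
    ENNReal.ofReal (2 * Real.pi * D ^ 2 * Real.log (R / r) +
      -(2 * (2 * |(D : ℝ)|) ^ 2 * (|C₂| + 2 * |C₁|) +
        ((8 * M * D ^ 2 + 8 * Real.pi * |(D : ℝ)| * L) * ρ +
          8 * Real.pi * D ^ 2 * (1 / (2 * κ ^ 2) + (1 + 1 / (2 - 2 * γ)) / 2) +
          2 * Real.pi * |(D : ℝ)| * (2 * (|C₂| + 2 * |C₁|)) +
          4 * Real.pi * |(D : ℝ)| / K * (1 / κ + (1 + 1 / (α - γ)))))) ≤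
      dirichletEnergy u (annulusIn Ω x₀ r R) := by
  have hpi := Real.pi_pos
  have hτ := H.norm_eq
  have hM := H.M_pos
  have hεα : 0 < ε ^ α := Real.rpow_pos_of_pos hε α
  have hr0 : 0 < r := (mul_pos hκ hεα).trans_le hr
  have hρ0 : 0 < ρ := (hr0.trans hrR).trans hRρ
  -- As α ≤ 1, ε ≤ ε^α, so the interior bound for the core error still applies.
  have hr' : κ * ε ≤ r := by
    refine le_trans (mul_le_mul_of_nonneg_left ?_ hκ.le) hr
    calc ε = ε ^ (1 : ℝ) := (Real.rpow_one ε).symm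
      _ ≤ ε ^ α := Real.rpow_le_rpow_of_exponent_ge hε hε1.le hα1
  have hγ1 : γ < 1 := hγ.trans_le hα1
  have hγ2 : 0 < 2 - 2 * γ := by linarith
  have hγ3 : 0 < α - γ := by linarith
  set lam := K * ε ^ (-α)
  have hlam : 0 < lam := mul_pos hK (Real.rpow_pos_of_pos hε _)
  set δ : ℝ := |(D : ℝ)|
  have hδ : 0 ≤ δ := abs_nonneg _
  have hδ2 : (D : ℝ) ^ 2 = δ ^ 2 := (sq_abs _).symm
  rw [hδ2]
  have hR : R ∈ Ioo 0 ρ := ⟨hr0.trans hrR, hRρ⟩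
  obtain ⟨w, c, hw, hwu, hwg, hc, hwc⟩ := hD
  have hloopc : ContinuousOn (sectorLoop x₀ τ a b R) (Icc 0 1) :=
    (continuousOn_sectorLoop H.cont_a H.cont_b hRρ).comp (f := fun t : ℝ => (R, t)) (by fun_prop)
      fun t ht => ⟨right_mem_Icc.2 hR.1.le, ht⟩
  obtain ⟨z₀, hz₀⟩ : ∃ z₀, z₀ ∈ omegaBall Ω x₀ R := by
    have hh : R / 2 ∈ Ioo 0 ρ := ⟨half_pos hR.1, (half_lt_self hR.1).trans hRρ⟩
    obtain ⟨φ, hφ⟩ := exists_between (H.a_lt_b hh)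
    exact ⟨_, polarPt_mem_ball hτ hh.1.le (half_lt_self hR.1), H.mem_domain_of_mem_Ioo hh hφ⟩
  -- Only |D| ≤ |D'| is needed: a larger degree forces a larger phase increment, while the
  -- calibration keeps k = 2|D|.
  obtain ⟨D', hDD', hD'⟩ := exists_degree_of_same_image hc.continuousOn hc.closed hc.injOn
    hc.image_eq hloopc sectorLoop_closed (H.injOn_sectorLoop hR)
    (H.image_sectorLoop hΩ hcl hdis hx₀ hR) hw (hc.positive z₀ hz₀) hwc
  have hDD'' : δ ≤ |(D' : ℝ)| := by
    change |(D : ℝ)| ≤ |(D' : ℝ)|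
    exact_mod_cast hDD'
  set pa : ℝ → ℂ := fun s => polarPt x₀ τ s (a s)
  set pb : ℝ → ℂ := fun s => polarPt x₀ τ s (b s)
  have hsub : Ioo r R ⊆ Ico 0 ρ := fun s hs => ⟨(hr0.trans hs.1).le, hs.2.trans hRρ⟩
  have hpac : ContinuousOn pa (Ioo r R) :=
    continuousOn_polarPt_comp x₀ τ continuousOn_id (H.cont_a.mono hsub)
  have hpbc : ContinuousOn pb (Ioo r R) :=
    continuousOn_polarPt_comp x₀ τ continuousOn_id (H.cont_b.mono hsub)
  have hpaΓ : MapsTo pa (Ioo r R) Γ := fun s hs => H.left_mem_curve hx₀ (hsub hs)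
  have hpbΓ : MapsTo pb (Ioo r R) Γ := fun s hs => H.right_mem_curve hx₀ (hsub hs)
  have huΓ : ContinuousOn u Γ := hu.continuousOn.mono hcl
  set Ua : ℝ → ℝ := fun s => ‖u (pa s) - g (pa s)‖
  set Ub : ℝ → ℝ := fun s => ‖u (pb s) - g (pb s)‖
  have hUa : ContinuousOn Ua (Ioo r R) := ((huΓ.comp hpac hpaΓ).sub (hg.comp hpac hpaΓ)).norm
  have hUb : ContinuousOn Ub (Ioo r R) := ((huΓ.comp hpbc hpbΓ).sub (hg.comp hpbc hpbΓ)).norm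
  set sw := scaleWeight ε γ
  have hsw : ∀ s, 0 < sw s := scaleWeight_pos ε γ
  have hswm : Measurable sw := measurable_scaleWeight ε γ
  set c₀ := 8 * M * δ ^ 2 + 8 * Real.pi * δ * L
  have hc₀ : 0 ≤ c₀ := by positivity
  set e3 : ℝ → ℝ := fun s => ε ^ 2 / sw s * s ^ (-3 : ℝ)
  set e2 : ℝ → ℝ := fun s => ε ^ α / sw s * s ^ (-2 : ℝ)
  have hcirc : ∀ s ∈ Ioo r R, ENNReal.ofReal (2 * Real.pi * δ ^ 2 / s) ≤
      (∫⁻ φ in Ioo (a s) (b s) ∩ polarPt x₀ τ s ⁻¹' Ω,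
        ENNReal.ofReal s * totalDensity ε γ (2 * δ) u x₀ (polarPt x₀ τ s φ)) +
      (ENNReal.ofReal c₀ + ENNReal.ofReal (8 * Real.pi * δ ^ 2) * ENNReal.ofReal (e3 s) +
        ENNReal.ofReal (2 * Real.pi * δ) * (ENNReal.ofReal (sw s * (lam * Ua s ^ 2)) +
          ENNReal.ofReal (sw s * (lam * Ub s ^ 2))) +
        ENNReal.ofReal (4 * Real.pi * δ / K) * ENNReal.ofReal (e2 s)) := by
    intro s hs
    have hs0 : 0 < s := hr0.trans hs.1
    have hsρ : s ∈ Ioo 0 ρ := ⟨hs0, hs.2.trans hRρ⟩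
    have hab := H.a_lt_b hsρ
    have hsws := hsw s
    have he3 : 0 ≤ e3 s := mul_nonneg (by positivity) (Real.rpow_nonneg hs0.le _)
    have he2 : 0 ≤ e2 s := mul_nonneg (by positivity) (Real.rpow_nonneg hs0.le _)
    obtain ⟨θ, hθ, hΔ⟩ := H.exists_phase_on_arc hΩ hcl hdis hx₀ hu.continuousOn hr0 hRρ hA hw hwu
      hwg hg1 hgL hL0 hL hD' hs
    have h1 := ofReal_mul_abs_phase_sub_le hΩ hu.contDiffOn hτ hs0 hab.le
      (show 0 ≤ 2 * δ by positivity) hθ (fun φ _ hx => ⟨rfl, hA _ (mem_annulusIn.2 ⟨hx, by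
        rw [dist_polarPt hτ hs0.le]; exact hs.1.le, by rw [dist_polarPt hτ hs0.le]; exact hs.2⟩)⟩)
      (by
        refine ((toFinite ({a s, b s} : Set ℝ)).image θ).countable.mono (image_mono ?_)
        rintro φ ⟨hφ, hφΩ⟩
        by_contra hne
        simp only [mem_insert_iff, mem_singleton_iff, not_or] at hne
        exact hφΩ (H.mem_domain_of_mem_Ioo hsρ ⟨lt_of_le_of_ne hφ.1 (Ne.symm hne.1),
          lt_of_le_of_ne hφ.2 hne.2⟩))
    have h2 := ofReal_div_le_lintegral_circle (γ := γ) hτ hε hs0 hab.le h1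
    have hUa0 : 0 ≤ sw s * (lam * Ua s ^ 2) := by positivity
    have hUb0 : 0 ≤ sw s * (lam * Ub s ^ 2) := by positivity
    rw [← ENNReal.ofReal_add hUa0 hUb0,
      ← ENNReal.ofReal_mul (p := 8 * Real.pi * δ ^ 2) (by positivity),
      ← ENNReal.ofReal_mul (p := 2 * Real.pi * δ) (by positivity),
      ← ENNReal.ofReal_mul (p := 4 * Real.pi * δ / K) (by positivity),
      ← ENNReal.ofReal_add hc₀ (by positivity),
      ← ENNReal.ofReal_add (by positivity) (by positivity),
      ← ENNReal.ofReal_add (by positivity) (by positivity)]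
    refine ofReal_le_of_le_sub ?_ h2 ?_
    · have hba := sub_pos.2 hab
      change 0 ≤ (b s - a s) * ((2 * δ) ^ 2 / (2 * s)) + (b s - a s) * (2 * δ) ^ 2 * e3 s
      positivity
    change 2 * Real.pi * δ ^ 2 / s ≤ 2 * δ * |θ (b s) - θ (a s)| / s -
      ((b s - a s) * ((2 * δ) ^ 2 / (2 * s)) + (b s - a s) * (2 * δ) ^ 2 * e3 s) + _
    have hba1 : b s - a s ≤ Real.pi + 4 * M * s := by
      have h3 := (abs_le.1 (H.a_le s hsρ)).1
      have h4 := (abs_le.1 (H.b_le s hsρ)).2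
      linarith
    have hba2 : b s - a s ≤ 2 * Real.pi := by
      have h3 := H.angle_bounds hsρ
      have h4 := (abs_lt.1 h3.1).1
      have h5 := (abs_lt.1 h3.2).2
      linarith [Real.pi_gt_three]
    have t1 : (b s - a s) * ((2 * δ) ^ 2 / (2 * s)) ≤ 2 * Real.pi * δ ^ 2 / s + 8 * M * δ ^ 2 := by
      refine (mul_le_mul_of_nonneg_right hba1 (by positivity)).trans (le_of_eq ?_)
      field_simp; ring
    have t2 : (b s - a s) * (2 * δ) ^ 2 * e3 s ≤ 8 * Real.pi * δ ^ 2 * e3 s := by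
      refine mul_le_mul_of_nonneg_right ?_ he3
      have := mul_le_mul_of_nonneg_right hba2 (show 0 ≤ (2 * δ) ^ 2 by positivity)
      linarith
    -- Since 1/λ = ε^α/K, the Young remainder is the density bounded by
    -- `lintegral_boundary_error_le`.
    have hye : (1 / s) ^ 2 / (2 * (sw s * lam)) = e2 s / K / 2 := by
      have hs2 : s ^ (-2 : ℝ) = (s ^ 2)⁻¹ := by
        rw [Real.rpow_neg hs0.le]; norm_cast
      have hne : ε ^ (-α) = (ε ^ α)⁻¹ := Real.rpow_neg hε.le α
      simp only [e2, hs2, lam, hne]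
      field_simp
    have y1 := young_weight (w := sw s * lam) (x := Ua s) (y := 1 / s) (mul_pos hsws hlam)
    have y2 := young_weight (w := sw s * lam) (x := Ub s) (y := 1 / s) (mul_pos hsws hlam)
    rw [hye] at y1 y2
    have t3 : 2 * δ * |θ (b s) - θ (a s)| / s ≥ 4 * Real.pi * δ ^ 2 / s -
        4 * Real.pi * δ * (Ua s * (1 / s) + Ub s * (1 / s)) - 8 * Real.pi * δ * L := by
      have h3 : 2 * Real.pi * δ - 2 * Real.pi * (Ua s + Ub s + 2 * L * s) ≤
          |θ (b s) - θ (a s)| := by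
        refine le_trans ?_ hΔ
        have := mul_le_mul_of_nonneg_left hDD'' (show 0 ≤ 2 * Real.pi by positivity)
        linarith
      have h4 := mul_le_mul_of_nonneg_left h3 (show 0 ≤ 2 * δ / s by positivity)
      have h5 : 2 * δ / s * (2 * Real.pi * δ - 2 * Real.pi * (Ua s + Ub s + 2 * L * s)) =
          4 * Real.pi * δ ^ 2 / s - 4 * Real.pi * δ * (Ua s * (1 / s) + Ub s * (1 / s)) -
            8 * Real.pi * δ * L := by field_simp; ring
      rw [h5] at h4
      have h6 : 2 * δ / s * |θ (b s) - θ (a s)| = 2 * δ * |θ (b s) - θ (a s)| / s := by ring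
      linarith
    have t4 := mul_le_mul_of_nonneg_left (add_le_add y1 y2)
      (show 0 ≤ 4 * Real.pi * δ by positivity)
    have t5 : 4 * Real.pi * δ * (sw s * lam * Ua s ^ 2 / 2 + e2 s / K / 2 +
        (sw s * lam * Ub s ^ 2 / 2 + e2 s / K / 2)) =
        2 * Real.pi * δ * (sw s * (lam * Ua s ^ 2) + sw s * (lam * Ub s ^ 2)) +
          4 * Real.pi * δ / K * e2 s := by ring
    have t6 : 4 * Real.pi * δ ^ 2 / s = 2 * (2 * Real.pi * δ ^ 2 / s) := by ring
    rw [t5] at t4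
    rw [t6] at t3
    simp only [c₀]
    linarith
  have hrest : AEMeasurable sw (volume.restrict (Ioo r R)) := hswm.aemeasurable
  have hma : AEMeasurable (fun s => ENNReal.ofReal (sw s * (lam * Ua s ^ 2)))
      (volume.restrict (Ioo r R)) :=
    (hrest.mul (((hUa.aemeasurable measurableSet_Ioo).pow_const 2).const_mul lam)).ennreal_ofReal
  have hmb : AEMeasurable (fun s => ENNReal.ofReal (sw s * (lam * Ub s ^ 2)))
      (volume.restrict (Ioo r R)) :=
    (hrest.mul (((hUb.aemeasurable measurableSet_Ioo).pow_const 2).const_mul lam)).ennreal_ofReal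
  have hm3 : Measurable fun s => ENNReal.ofReal (e3 s) := by fun_prop
  have hm2 : Measurable fun s => ENNReal.ofReal (e2 s) := by fun_prop
  have hmab : AEMeasurable (fun s => ENNReal.ofReal (2 * Real.pi * δ) *
      (ENNReal.ofReal (sw s * (lam * Ua s ^ 2)) + ENNReal.ofReal (sw s * (lam * Ub s ^ 2))))
      (volume.restrict (Ioo r R)) := (hma.add hmb).const_mul _
  have hm23 := hm3.const_mul (ENNReal.ofReal (8 * Real.pi * δ ^ 2))
  have hm22 := hm2.const_mul (ENNReal.ofReal (4 * Real.pi * δ / K))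
  have hpq : ∀ s ∈ Ioo r R,
      Ioo (a s) (b s) ⊆ Ioc (-(Real.pi / 2)) (-(Real.pi / 2) + 2 * Real.pi) := by
    intro s hs
    have e1 : -(Real.pi / 2) + 2 * Real.pi = 3 * Real.pi / 2 := by ring
    rw [e1]
    exact Ioo_subset_Icc_self.trans (H.Icc_subset ⟨hr0.trans hs.1, hs.2.trans hRρ⟩)
  refine ofReal_log_le_dirichletEnergy (e := fun s => ENNReal.ofReal c₀ +
    ENNReal.ofReal (8 * Real.pi * δ ^ 2) * ENNReal.ofReal (e3 s) +
    ENNReal.ofReal (2 * Real.pi * δ) * (ENNReal.ofReal (sw s * (lam * Ua s ^ 2)) +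
      ENNReal.ofReal (sw s * (lam * Ub s ^ 2))) +
    ENNReal.ofReal (4 * Real.pi * δ / K) * ENNReal.ofReal (e2 s)) hΩ hu.contDiffOn.continuousOn hτ hr0 hrR (by positivity)
    (by positivity) hpq hE hP
    (((measurable_const.add hm23).aemeasurable.add hmab).add hm22.aemeasurable) ?_ hcirc
  have hd : ∀ s ∈ Ioo r R, ∀ φ, dist (polarPt x₀ τ s φ) x₀ = s := fun s hs φ =>
    dist_polarPt hτ (hr0.trans hs.1).le
  have Ia := lintegral_weighted_boundary_le (γ := γ) hΓ huΓ hg hpac hpaΓ (fun s hs => hd s hs _) hE hP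
  have Ib := lintegral_weighted_boundary_le (γ := γ) hΓ huΓ hg hpbc hpbΓ (fun s hs => hd s hs _) hE hP
  have I3 := lintegral_core_error_le (R := R) hε hε1 hγ1 hκ hr'
  have I2 := lintegral_boundary_error_le (R := R) hε hε1 hγ hκ hr
  rw [lintegral_add_right _ hm22, lintegral_add_right' _ hmab,
    lintegral_add_right _ hm23, lintegral_const_mul' _ _ ENNReal.ofReal_ne_top,
    lintegral_const_mul' _ _ ENNReal.ofReal_ne_top, lintegral_const_mul' _ _ ENNReal.ofReal_ne_top,
    lintegral_add_left' hma, setLIntegral_const, Real.volume_Ioo]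
  have hsplit : ENNReal.ofReal (c₀ * ρ +
      8 * Real.pi * δ ^ 2 * (1 / (2 * κ ^ 2) + (1 + 1 / (2 - 2 * γ)) / 2) +
      2 * Real.pi * δ * (2 * (|C₂| + 2 * |C₁|)) +
      4 * Real.pi * δ / K * (1 / κ + (1 + 1 / (α - γ)))) =
      ENNReal.ofReal c₀ * ENNReal.ofReal ρ + ENNReal.ofReal (8 * Real.pi * δ ^ 2) *
        ENNReal.ofReal (1 / (2 * κ ^ 2) + (1 + 1 / (2 - 2 * γ)) / 2) +
      ENNReal.ofReal (2 * Real.pi * δ) *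
        (ENNReal.ofReal (|C₂| + 2 * |C₁|) + ENNReal.ofReal (|C₂| + 2 * |C₁|)) +
      ENNReal.ofReal (4 * Real.pi * δ / K) * ENNReal.ofReal (1 / κ + (1 + 1 / (α - γ))) := by
    exact ofReal_linear_combination hc₀ hρ0.le (by positivity) (by positivity) (by positivity)
      (by positivity) (by positivity) (by positivity)
  refine le_of_le_of_eq ?_ hsplit.symm
  refine add_le_add (add_le_add (add_le_add ?_ (mul_le_mul_right I3 _))
    (mul_le_mul_right (add_le_add Ia Ib) _)) (mul_le_mul_right I2 _)
  exact mul_le_mul_right (ENNReal.ofReal_le_ofReal (by linarith)) _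

end WeakAnchoring

/-! ### Choice of r₀ and C -/

theorem proposition4p3 (Ω Γ S : Set ℂ) (hΩ : Geometry Ω Γ S)
    (g : ℂ → ℂ) (hg : IsC2CircleMapOn g Γ) :
    ∃ r₀ : ℝ, 0 < r₀ ∧
    ∀ (α γ K : ℝ), 0 < α → α ≤ 1 → 3 / 4 * α < γ → γ < α → 0 < K →
    ∀ (C₁ C₂ κ : ℝ), 0 < κ → ∀ N : ℕ,
    ∃ C : ℝ, ∀ ε : ℝ, 0 < ε → ε < 1 →
    ∀ u : ℂ → ℂ, IsAdmissible Ω S u →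
    ∀ x₀ ∈ closure Ω, ∀ r R : ℝ, 0 < r → r < R → R < r₀ →
    (∀ x ∈ annulusIn Ω x₀ r R, 1 / 2 ≤ ‖u x‖ ∧ ‖u x‖ ≤ 1) →
    (∀ x ∈ Γ ∩ (ball x₀ R \ ball x₀ r), ‖u x - g x‖ ≤ 1 / 4) →
    energy Ω Γ g ε (K * ε ^ (-α)) u ≤ ENNReal.ofReal (C₁ * |Real.log ε|) →
    localPenalty Ω Γ g ε (K * ε ^ (-α)) u x₀ (ε ^ γ) ≤ ENNReal.ofReal C₂ →
    (∀ d : ℤ, |d| ≤ N → ball x₀ R ∩ Γ = ∅ → κ * ε ≤ r → HasInteriorDegree Ω u x₀ R d →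
      ENNReal.ofReal (Real.pi * d ^ 2 * Real.log (R / r) + C) ≤
        dirichletEnergy u (annulusIn Ω x₀ r R)) ∧
    (∀ D : ℤ, |D| ≤ N → x₀ ∈ Γ → κ * ε ^ α ≤ r → HasBoundaryDegree Ω Γ g u x₀ r R D →
      ENNReal.ofReal (2 * Real.pi * D ^ 2 * Real.log (R / r) + C) ≤
        dirichletEnergy u (annulusIn Ω x₀ r R)) := by
  obtain ⟨ρ, M, hρ, hM, -, hchart⟩ := hΩ.exists_hasChart
  obtain ⟨ρ', L, hρ', hL, hlip⟩ := hg.exists_lipschitz hΩ.isCompact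
  obtain ⟨η, hη, hsep⟩ := hΩ.disjoint.exists_thickenings hΩ.isCompact hΩ.isClosed
  -- The radius ρ comes from the charts, ρ' from the Lipschitz bound on g, η separates Γ from S, and
  -- 1/(4L) keeps g within 1/4 of g(x₀).
  refine ⟨min (min ρ ρ') (min η (1 / (4 * L))), by positivity, ?_⟩
  intro α γ K hα hα1 hαγ hγα hK C₁ C₂ κ hκ N
  have hpi := Real.pi_pos
  have hγ1 : 0 < 2 - 2 * γ := by linarith
  have hγ2 : 0 < α - γ := by linarith
  set n : ℝ := (N : ℝ)
  have hn : 0 ≤ n := N.cast_nonneg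
  -- A and B are the interior and boundary error constants with the degree replaced by its bound N,
  -- in which they are monotone; C = -(A + B) serves both cases.
  set A : ℝ := 2 * n ^ 2 * (|C₂| + 2 * |C₁|) +
    2 * Real.pi * n ^ 2 * (1 / (2 * κ ^ 2) + (1 + 1 / (2 - 2 * γ)) / 2)
  set B : ℝ := 2 * (2 * n) ^ 2 * (|C₂| + 2 * |C₁|) +
    ((8 * M * n ^ 2 + 8 * Real.pi * n * L) * ρ +
      8 * Real.pi * n ^ 2 * (1 / (2 * κ ^ 2) + (1 + 1 / (2 - 2 * γ)) / 2) +
      2 * Real.pi * n * (2 * (|C₂| + 2 * |C₁|)) +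
      4 * Real.pi * n / K * (1 / κ + (1 + 1 / (α - γ))))
  have hA : 0 ≤ A := by positivity
  have hB : 0 ≤ B := by positivity
  refine ⟨-(A + B), ?_⟩
  intro ε hε hε1 u hu x₀ hx₀ r R hr hrR hR hu1 _ hE hP
  obtain ⟨⟨hRρ, hRρ'⟩, hRη, hRL⟩ : (R < ρ ∧ R < ρ') ∧ R < η ∧ R < 1 / (4 * L) := by
    simpa only [lt_min_iff] using hR
  refine ⟨fun d hd hb hκr hdeg => ?_, fun D hD hxΓ hκr hdeg => ?_⟩
  · have hδ : |(d : ℝ)| ≤ n := by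
      have := (Int.cast_le (R := ℝ)).2 hd
      rwa [Int.cast_abs, Int.cast_natCast] at this
    -- A ball meeting S whose closure meets Γ would put x₀ into both of two disjoint thickenings.
    have hor : ball x₀ R ∩ S = ∅ ∨ closedBall x₀ R ∩ Γ = ∅ := by
      by_contra! h
      obtain ⟨⟨q, hq, hqS⟩, p, hp, hpΓ⟩ := h
      have h1 : x₀ ∈ thickening η Γ := mem_thickening_iff.2
        ⟨p, hpΓ, ((dist_comm _ _).trans_le (mem_closedBall.1 hp)).trans_lt hRη⟩
      have h2 : x₀ ∈ thickening η S := mem_thickening_iff.2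
        ⟨q, hqS, ((dist_comm _ _).trans_lt (mem_ball.1 hq)).trans hRη⟩
      exact Set.disjoint_left.1 hsep h1 h2
    refine le_trans (ENNReal.ofReal_le_ofReal ?_) (interior_lower_bound hΩ.isOpen
      hΩ.frontier_subset hu hx₀ hε hε1 (by linarith) hκ hκr hrR hb hor hu1 hE hP hdeg)
    have : 2 * |(d : ℝ)| ^ 2 * (|C₂| + 2 * |C₁|) + 2 * Real.pi * |(d : ℝ)| ^ 2 *
        (1 / (2 * κ ^ 2) + (1 + 1 / (2 - 2 * γ)) / 2) ≤ A := by
      simp only [A]; gcongr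
    rw [sq_abs] at this ⊢
    linarith
  · have hδ : |(D : ℝ)| ≤ n := by
      have := (Int.cast_le (R := ℝ)).2 hD
      rwa [Int.cast_abs, Int.cast_natCast] at this
    obtain ⟨τ, h, hc, hs⟩ := hchart x₀ hxΓ
    obtain ⟨a, b, H⟩ := hc.exists_sector (fun x hx => (hs x hx).1) fun x hx => (hs x hx).2
    have hLR : L * R ≤ 1 / 4 := by
      rw [lt_div_iff₀ (by positivity)] at hRL
      linarith
    refine le_trans (ENNReal.ofReal_le_ofReal ?_) (boundary_lower_bound H hΩ.isOpen
      hΩ.isCompact.isClosed hΩ.subset_closure hΩ.disjoint_domain hxΓ hu hg.continuousOn hε hε1 hα1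
      hγα hK hκ hκr hrR hRρ hu1 hE hP (hg.norm_eq_one x₀ hxΓ)
      (fun x hx => hlip x₀ hxΓ x ⟨hx.1, ball_subset_ball hRρ'.le hx.2⟩) hL.le hLR hdeg)
    have : 2 * (2 * |(D : ℝ)|) ^ 2 * (|C₂| + 2 * |C₁|) +
        ((8 * M * |(D : ℝ)| ^ 2 + 8 * Real.pi * |(D : ℝ)| * L) * ρ +
          8 * Real.pi * |(D : ℝ)| ^ 2 * (1 / (2 * κ ^ 2) + (1 + 1 / (2 - 2 * γ)) / 2) +
          2 * Real.pi * |(D : ℝ)| * (2 * (|C₂| + 2 * |C₁|)) +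
          4 * Real.pi * |(D : ℝ)| / K * (1 / κ + (1 + 1 / (α - γ)))) ≤ B := by
      simp only [B]; gcongr
    simp only [sq_abs] at this ⊢
    linarith
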